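/- \textbf{Setting.} Let $d=2$. For $k\ge1$ consider kernels $f(\underline x_k;\underline x_k')\in L^2(\mathbb R^{2k}\times\mathbb R^{2k})$, and put $$S^{(k,\alpha)}=\prod_{j=1}^k(1-\Delta_{x_j})^{\alpha/2}(1-\Delta_{x_j'})^{\alpha/2},\qquad \Delta^{(k)}_\pm=\sum_{j=1}^k(\Delta_{x_j}-\Delta_{x_j'}),\qquad B_{k+2}=\sum_{j=1}^k\big(B^+_{j;k+1,k+2}-B^-_{j;k+1,k+2}\big),$$ where $B^{+}_{j;k+1,k+2}f$ (resp. $B^-_{j;k+1,k+2}f$) is obtained from $f(x_1,\dots,x_{k+2};x_1',\dots,x_{k+2}')$ by setting $x_{k+1}=x_{k+2}=x_{k+1}'=x_{k+2}'$ equal to $x_j$ (resp. to $x_j'$). This is understood on the Fourier side: with all variables transformed with the same sign of the phase, the transform of $B^+_{j;k+1,k+2}f$ at $(\underline u_k;\underline u_k')$ is $$\int \widehat f\big(u_1,\dots,u_j-q_1-q_2-q_1'-q_2',\dots,u_k,q_1,q_2;\,\underline u_k',q_1',q_2'\big)\,dq_1\,dq_2\,dq_1'\,dq_2',$$ and for $B^-$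 the shift is applied to $u_j'$ instead of $u_j$; $f$ is in the domain if this integral converges absolutely for almost every $(\underline u_k;\underline u'_k)$ and defines an $L^2$ function. A \emph{hierarchy of energy $A>0$ on $[0,T]$} is a sequence $\gamma=(\gamma^{(k)})_{k\ge1}$ of weakly continuous maps $\gamma^{(k)}:[0,T]\to L^2(\mathbb R^{2k}\times\mathbb R^{2k})$ such that, for all $k\ge 1$ and $t\in[0,T]$, $\gamma^{(k)}(t)$ is invariant under simultaneous permutations of $(x_1,x_1'),\dots,(x_k,x_k')$ and $\|S^{(k,1)}\gamma^{(k)}(t)\|_{L^2}\le A^k$. It \emph{solves the quintic Gross--Pitaevskii (GP) hierarchy} with coupling constant $b_0\in\mathbb R$ if for all $k\ge1$ and $t\in[0,T]$ $$\gamma^{(k)}(t)=e^{it\Delta_\pm^{(k)}}\gamma^{(k)}(0)-ib_0\int_0^te^{i(t-s)\Delta^{(k)}_\pm}B_{k+2}\gamma^{(k+2)}(s)\,ds .$$ For $r\ge1$, $n\ge0$, $t_r\in[0,T]$ let $$J^r(t_r,t_{r+2},\dots,t_{r+2n})=e^{i(t_r-t_{r+2})\Delta_\pm^{(r)}}B_{r+2}\,e^{i(t_{r+2}-t_{r+4})\Delta_\pm^{(r+2)}}B_{r+4}\cdots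 e^{i(t_{r+2n-2}-t_{r+2n})\Delta_\pm^{(r+2n-2)}}B_{r+2n}\,\gamma^{(r+2n)}(t_{r+2n}),$$ $$D_n^r(t_r)=\int_0^{t_r}\!\!\int_0^{t_{r+2}}\!\!\cdots\int_0^{t_{r+2n-2}}J^r(t_r,t_{r+2},\dots,t_{r+2n})\,dt_{r+2n}\cdots dt_{r+2}.$$ \textbf{Theorem 6.2.} Let $\frac56<\alpha<1$, $A>0$ and $b_0\in\mathbb R$. There are constants $C,C_0>0$, depending only on $\alpha,A,b_0$ (in particular not on $r$, $n$, $T$), such that the following holds for every $T>0$. (1) For every hierarchy $\gamma$ of energy $A$ on $[0,T]$ and all $r\ge1$, $n\ge0$, $t_r\in[0,T]$: for almost all times $t_r\ge t_{r+2}\ge\dots\ge t_{r+2n}\ge0$ all operators $B$ in $J^r$ act on elements of their domains; $J^r$ is Bochner integrable in $L^2$ over this set of times; and $$\big\|S^{(r,\alpha)}D^r_n(t_r)\big\|_{L^2(\mathbb R^{2r}\times\mathbb R^{2r})}<C^r\big(C_0\max\{T,T^{1/2}\}\big)^n .$$ (2) If, in addition, $\gamma$ solves the GP hierarchy with $\gamma^{(k)}(0)=0$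 for all $k\ge1$ (for instance, if $\gamma$ is the difference of two solutions with the same initial data), then for all $r\ge1$, $n\ge0$, $t_r\in[0,T]$ $$\gamma^{(r)}(t_r)=(-ib_0)^nD^r_n(t_r)\qquad\text{and}\qquad \big\|S^{(r,\alpha)}D^r_n(t_r)\big\|_{L^2(\mathbb R^{2r}\times\mathbb R^{2r})}<C^r(C_0T)^n .$$ (3) If $C_0T<1$, then two solutions of the GP hierarchy that are hierarchies of energy $A$ on $[0,T]$ and have the same initial data coincide on $[0,T]$. -/

import Mathlib

open MeasureTheory Set
open scoped ENNReal FourierTransform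

noncomputable section

namespace QuinticGP

/-- Indices of the particle variables of a `k`-particle density matrix in the plane:
`Sum.inl j` stands for the unprimed variable `x_j`, `Sum.inr j` for the primed variable `x'_j`. -/
abbrev Particle (k : ℕ) : Type := Fin k ⊕ Fin k

/-- The space `ℝ^{2k} × ℝ^{2k}` of the points `(x_1, …, x_k; x'_1, …, x'_k)`, with its Euclidean
structure and Lebesgue measure; `x (a, c)` is the `c`-th coordinate of the variable with index `a`.
The same space serves as the space of Fourier variables `(u_1, …, u_k; u'_1, …, u'_k)`. -/
abbrev Conf (k : ℕ) : Type := EuclideanSpace ℝ (Particle k × Fin 2)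

/-- The space `L²(ℝ^{2k} × ℝ^{2k})` of (Hilbert–Schmidt) kernels of `k`-particle operators. -/
abbrev Ker (k : ℕ) : Type := Lp ℂ 2 (volume : Measure (Conf k))

/-- The squared length `|u_a|²` of the planar vector with index `a`. -/
def normSqAt {k : ℕ} (a : Particle k) (u : Conf k) : ℝ := ∑ c : Fin 2, u (a, c) ^ 2

/-- The Fourier symbol of `S^{(k,α)} = ∏_j (1 - Δ_{x_j})^{α/2} (1 - Δ_{x'_j})^{α/2}`.
The Fourier transform is normalized with `exp(-2πi⟨x, u⟩)`, so `-Δ` has the symbol `4π²|u|²`. -/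
def sobolevWeight {k : ℕ} (α : ℝ) (u : Conf k) : ℝ :=
  ∏ a : Particle k, (1 + 4 * Real.pi ^ 2 * normSqAt a u) ^ (α / 2)

/-- The norm `‖S^{(k,α)} f‖_{L²}`, by Plancherel's theorem; it is `∞` exactly when `f` is not in the
domain of `S^{(k,α)}`. -/
def sobolevNorm {k : ℕ} (α : ℝ) (f : Ker k) : ℝ≥0∞ :=
  eLpNorm (fun u : Conf k => (sobolevWeight α u : ℂ) * (𝓕 f : Ker k) u) 2 volume

/-- The Fourier symbol of `Δ_± = ∑_j (Δ_{x_j} - Δ_{x'_j})`. -/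
def laplacianSymbol {k : ℕ} (u : Conf k) : ℝ :=
  -(4 * Real.pi ^ 2) * ∑ j : Fin k, (normSqAt (Sum.inl j) u - normSqAt (Sum.inr j) u)

theorem continuous_laplacianSymbol {k : ℕ} :
    Continuous (laplacianSymbol : Conf k → ℝ) := by
  unfold laplacianSymbol normSqAt
  fun_prop

theorem memLp_freeEvolution {k : ℕ} (t : ℝ) (f : Ker k) :
    MemLp (fun u : Conf k => Complex.exp ((t * laplacianSymbol u : ℝ) * Complex.I) * f u)
      2 volume := by
  have hc : Continuous fun u : Conf k =>
      Complex.exp ((t * laplacianSymbol u : ℝ) * Complex.I) := by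
    have := continuous_laplacianSymbol (k := k)
    fun_prop
  refine (Lp.memLp f).of_le (hc.aestronglyMeasurable.mul (Lp.aestronglyMeasurable f)) ?_
  refine Filter.Eventually.of_forall fun u => ?_
  rw [norm_mul, Complex.norm_exp_ofReal_mul_I, one_mul]

/-- The free evolution `exp(i t Δ_±^{(k)})` on `L²`. -/
def freeEvolution {k : ℕ} (t : ℝ) (f : Ker k) : Ker k :=
  𝓕⁻ ((memLp_freeEvolution t (𝓕 f : Ker k)).toLp _ : Ker k)

/-- For Fourier variables `u` of `k` particles and `q = (q_1, q_2; q'_1, q'_2)` of the two additional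
ones, the point of the `(k+2)`-particle Fourier space with the same entries as `u`, except that
`u_a` is replaced by `u_a - q_1 - q_2 - q'_1 - q'_2`, and with the entries of `q` in the places
`k+1` and `k+2`. -/
def insertPair {k : ℕ} (a : Particle k) (u : Conf k) (q : Conf 2) : Conf (k + 2) :=
  WithLp.toLp 2 fun p : Particle (k + 2) × Fin 2 =>
    let old : Particle k → ℝ := fun b => u (b, p.2) - if b = a then ∑ e : Particle 2, q (e, p.2) else 0
    match p.1 with
    | Sum.inl i => Fin.addCases (fun j => old (Sum.inl j)) (fun l => q (Sum.inl l, p.2)) i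
    | Sum.inr i => Fin.addCases (fun j => old (Sum.inr j)) (fun l => q (Sum.inr l, p.2)) i

/-- The Fourier transform of the function obtained from `f` by setting all four variables
`x_{k+1}, x_{k+2}, x'_{k+1}, x'_{k+2}` equal to the variable with index `a`. -/
def contractionFourier {k : ℕ} (a : Particle k) (f : Ker (k + 2)) (u : Conf k) : ℂ :=
  ∫ q : Conf 2, (𝓕 f : Ker (k + 2)) (insertPair a u q)

/-- The contraction of `f` at the variable `a` is a well-defined element of `L²`: the integrals in
`contractionFourier` converge absolutely almost everywhere, and they define an `L²` function. -/
def HasContraction {k : ℕ} (a : Particle k) (f : Ker (k + 2)) : Prop :=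
  (∀ᵐ u : Conf k, Integrable fun q : Conf 2 => (𝓕 f : Ker (k + 2)) (insertPair a u q)) ∧
    MemLp (contractionFourier a f) 2 volume

open Classical in
/-- The contraction at the variable `a`, that is `B⁺_{j;k+1,k+2} f` for `a = Sum.inl j` and
`B⁻_{j;k+1,k+2} f` for `a = Sum.inr j`. (It is set to `0` outside of its domain.) -/
def contraction {k : ℕ} (a : Particle k) (f : Ker (k + 2)) : Ker k :=
  if h : HasContraction a f then 𝓕⁻ (h.2.toLp _ : Ker k) else 0

/-- The operator `B_{k+2} = ∑_{j=1}^k (B⁺_{j;k+1,k+2} - B⁻_{j;k+1,k+2})`. -/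
def interaction {k : ℕ} (f : Ker (k + 2)) : Ker k :=
  ∑ j : Fin k, (contraction (Sum.inl j) f - contraction (Sum.inr j) f)

/-- A sequence of time dependent kernels `γ^{(k)}(t)`. -/
abbrev Hierarchy : Type := (k : ℕ) → ℝ → Ker k

/-- The Duhamel integrand
`J^r = e^{i(t_r - t_{r+2})Δ_±} B_{r+2} e^{i(t_{r+2} - t_{r+4})Δ_±} B_{r+4} ⋯ B_{r+2n} γ^{(r+2n)}(t_{r+2n})`
with `t_r = t` and `(t_{r+2}, …, t_{r+2n}) = (s 0, …, s (n-1))`. -/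
def duhamelIntegrand (γ : Hierarchy) : (n r : ℕ) → ℝ → (Fin n → ℝ) → Ker r
  | 0, r, t, _ => γ r t
  | n + 1, r, t, s =>
      freeEvolution (t - s 0) (interaction (duhamelIntegrand γ n (r + 2) (s 0) (Fin.tail s)))

/-- All contractions that occur in the Duhamel integrand are taken within their domains. -/
def DuhamelDefined (γ : Hierarchy) : (n r : ℕ) → (Fin n → ℝ) → Prop
  | 0, _, _ => True
  | n + 1, r, s =>
      DuhamelDefined γ n (r + 2) (Fin.tail s) ∧
        ∀ a : Particle r, HasContraction a (duhamelIntegrand γ n (r + 2) (s 0) (Fin.tail s))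

/-- The domain `t ≥ t_{r+2} ≥ t_{r+4} ≥ ⋯ ≥ t_{r+2n} ≥ 0` of the iterated time integral
`∫_0^t ∫_0^{t_{r+2}} ⋯ ∫_0^{t_{r+2n-2}}`. -/
def timeSimplex (n : ℕ) (t : ℝ) : Set (Fin n → ℝ) :=
  {s | (∀ i, s i ∈ Icc 0 t) ∧ Antitone s}

/-- The `n`-fold iterated Duhamel term
`∫_0^t ∫_0^{t_{r+2}} ⋯ ∫_0^{t_{r+2n-2}} J^r dt_{r+2n} ⋯ dt_{r+2}`, as a Bochner integral in `L²`. -/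
def duhamelTerm (γ : Hierarchy) (n r : ℕ) (t : ℝ) : Ker r :=
  ∫ s in timeSimplex n t, duhamelIntegrand γ n r t s

/-- The point `(x_{σ(1)}, …, x_{σ(k)}; x'_{σ(1)}, …, x'_{σ(k)})`. -/
def permutePoint {k : ℕ} (σ : Equiv.Perm (Fin k)) (x : Conf k) : Conf k :=
  WithLp.toLp 2 fun p => x (Sum.map σ σ p.1, p.2)

/-- Hierarchies of finite energy on `[0, T]`: each `γ^{(k)}` is weakly continuous in time, symmetric
under simultaneous permutations of the particles, and bounded in the energy space, with
`‖S^{(k,1)} γ^{(k)}(t)‖_{L²} ≤ A^k`. -/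
structure IsEnergyHierarchy (A T : ℝ) (γ : Hierarchy) : Prop where
  continuous : ∀ k, 1 ≤ k → ∀ f : Ker k, ContinuousOn (fun t => inner ℂ f (γ k t)) (Icc 0 T)
  symmetric : ∀ k, 1 ≤ k → ∀ t ∈ Icc 0 T, ∀ σ : Equiv.Perm (Fin k),
    ∀ᵐ x : Conf k, γ k t (permutePoint σ x) = γ k t x
  energy : ∀ k, 1 ≤ k → ∀ t ∈ Icc 0 T, sobolevNorm 1 (γ k t) ≤ ENNReal.ofReal (A ^ k)

/-- The quintic Gross–Pitaevskii hierarchy with coupling constant `b₀`, in integral form: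
`γ^{(k)}(t) = e^{itΔ_±} γ^{(k)}(0) - i b₀ ∫_0^t e^{i(t-s)Δ_±} B_{k+2} γ^{(k+2)}(s) ds`. -/
def SolvesGP (b₀ T : ℝ) (γ : Hierarchy) : Prop :=
  ∀ k, 1 ≤ k → ∀ t ∈ Icc 0 T,
    γ k t = freeEvolution t (γ k 0) -
      (Complex.I * (b₀ : ℂ)) • ∫ s in (0 : ℝ)..t, freeEvolution (t - s) (interaction (γ (k + 2) s))

end QuinticGP

end

open MeasureTheory Set
open scoped ENNReal FourierTransform SchwartzMap

noncomputable section

namespace QuinticGP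

/-- The momentum plane of a single leg. -/
abbrev Plane : Type := Fin 2 → ℝ

section Legs

variable {m : ℕ}

theorem lintegral_insertNth {X : Type*} [MeasureSpace X] [SigmaFinite (volume : Measure X)]
    (i : Fin (m + 1)) {f : (Fin (m + 1) → X) → ℝ≥0∞} (hf : Measurable f) :
    ∫⁻ q, f q = ∫⁻ y : Fin m → X, ∫⁻ x : X, f (i.insertNth x y) := by
  have h := (volume_preserving_piFinSuccAbove (fun _ : Fin (m + 1) => X) i).symm
  rw [← h.lintegral_comp hf]
  exact lintegral_prod_symm' _ (hf.comp (MeasurableEquiv.measurable _))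

theorem integrable_comp_insertNth {X : Type*} [MeasureSpace X] [SigmaFinite (volume : Measure X)]
    (i : Fin (m + 1)) {f : (Fin (m + 1) → X) → ℂ} (hf : Integrable f) :
    Integrable (fun z : X × (Fin m → X) => f (i.insertNth z.1 z.2)) := by
  have h := (volume_preserving_piFinSuccAbove (fun _ : Fin (m + 1) => X) i).symm
  exact (h.integrable_comp_emb (MeasurableEquiv.measurableEmbedding _)).2 hf

theorem integral_insertNth {X : Type*} [MeasureSpace X] [SigmaFinite (volume : Measure X)]
    (i : Fin (m + 1)) {f : (Fin (m + 1) → X) → ℂ} (hf : Integrable f) :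
    ∫ q, f q = ∫ y : Fin m → X, ∫ x : X, f (i.insertNth x y) := by
  have h := (volume_preserving_piFinSuccAbove (fun _ : Fin (m + 1) => X) i).symm
  rw [← h.integral_comp (MeasurableEquiv.measurableEmbedding _)]
  exact integral_prod_symm _ (integrable_comp_insertNth i hf)

theorem measurable_insertNth {X : Type*} [MeasurableSpace X] (i : Fin (m + 1)) :
    Measurable fun z : X × (Fin m → X) => (i.insertNth z.1 z.2 : Fin (m + 1) → X) :=
  (MeasurableEquiv.piFinSuccAbove (fun _ : Fin (m + 1) => X) i).symm.measurable

theorem lintegral_prod_legs (f : Plane → ℝ≥0∞) (hf : Measurable f) :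
    ∫⁻ q : Fin m → Plane, ∏ b, f (q b) = (∫⁻ x, f x) ^ m := by
  induction m with
  | zero => simp [volume_pi]
  | succ m ih =>
    rw [lintegral_insertNth 0 (by fun_prop)]
    simp only [Fin.prod_univ_succAbove _ 0, Fin.insertNth_apply_same,
      Fin.insertNth_apply_succAbove]
    simp_rw [lintegral_mul_const _ hf]
    rw [lintegral_const_mul _ (by fun_prop), ih, pow_succ, mul_comm]

/-- Exchange of the leg `i` with the main leg, whose momentum is `v - ∑ j, q j`. -/
def legSwap (v : Plane) (i : Fin m) (q : Fin m → Plane) : Fin m → Plane :=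
  Function.update q i (v - ∑ j, q j)

theorem sum_legSwap (v : Plane) (i : Fin m) (q : Fin m → Plane) :
    v - ∑ j, legSwap v i q j = q i := by
  unfold legSwap
  rw [Finset.sum_update_of_mem (Finset.mem_univ i), ← Finset.add_sum_erase _ q (Finset.mem_univ i),
    ← Finset.erase_eq]
  abel

theorem legSwap_legSwap (v : Plane) (i : Fin m) (q : Fin m → Plane) :
    legSwap v i (legSwap v i q) = q := by
  conv_lhs => rw [legSwap, sum_legSwap]
  simp [legSwap]

theorem measurable_legSwap (v : Plane) (i : Fin m) : Measurable (legSwap v i) := by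
  refine measurable_pi_lambda _ fun j => ?_
  unfold legSwap
  by_cases h : j = i
  · subst h; simp only [Function.update_self]; fun_prop
  · simp only [Function.update_of_ne h]; fun_prop

theorem legSwap_insertNth (v : Plane) (i : Fin (m + 1)) (x : Plane) (y : Fin m → Plane) :
    legSwap v i (i.insertNth x y : Fin (m + 1) → Plane) = i.insertNth (v - ∑ j, y j - x) y := by
  unfold legSwap
  rw [Fin.sum_univ_succAbove _ i]
  simp only [Fin.insertNth_apply_same, Fin.insertNth_apply_succAbove, Fin.update_insertNth]
  congr 1
  abel

theorem lintegral_legSwap (v : Plane) (i : Fin m) {f : (Fin m → Plane) → ℝ≥0∞}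
    (hf : Measurable f) : ∫⁻ q, f (legSwap v i q) = ∫⁻ q, f q := by
  cases m with
  | zero => exact i.elim0
  | succ m =>
    rw [lintegral_insertNth i (f := fun q => f (legSwap v i q)) (hf.comp (measurable_legSwap v i)),
      lintegral_insertNth i hf]
    refine lintegral_congr fun y => ?_
    simp only [legSwap_insertNth]
    exact lintegral_sub_left_eq_self (fun x : Plane => f (i.insertNth x y)) _

/-- The exchange of legs as an equivalence. -/
def legSwapEquiv (v : Plane) (i : Fin m) : (Fin m → Plane) ≃ᵐ (Fin m → Plane) where
  toFun := legSwap v i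
  invFun := legSwap v i
  left_inv := legSwap_legSwap v i
  right_inv := legSwap_legSwap v i
  measurable_toFun := measurable_legSwap v i
  measurable_invFun := measurable_legSwap v i

theorem measurePreserving_legSwap (v : Plane) (i : Fin m) :
    MeasurePreserving (legSwap v i) := by
  refine ⟨measurable_legSwap v i, Measure.ext fun s hs => ?_⟩
  rw [← lintegral_indicator_one hs, lintegral_map (measurable_one.indicator hs)
    (measurable_legSwap v i), lintegral_legSwap v i (measurable_one.indicator hs),
    lintegral_indicator_one hs]

theorem integral_legSwap (v : Plane) (i : Fin m) (f : (Fin m → Plane) → ℂ) :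
    ∫ q, f (legSwap v i q) = ∫ q, f q :=
  (measurePreserving_legSwap v i).integral_comp (legSwapEquiv v i).measurableEmbedding f

/-- Young's inequality for the convolution of `m + 1` functions, the first of which is `f₀`, while
the others are equal. -/
theorem lintegral_young {f₀ f : Plane → ℝ≥0∞} (hf₀ : Measurable f₀) (hf : Measurable f)
    {p₀ p : ℝ} (hp₀ : 1 ≤ p₀) (hp : 1 ≤ p) (h : 1 / p₀ + m / p = m) (v : Plane) :
    ∫⁻ q : Fin m → Plane, f₀ (v - ∑ j, q j) * ∏ b, f (q b) ≤
      (∫⁻ x, f₀ x ^ p₀) ^ (1 / p₀) * (∫⁻ x, f x ^ p) ^ (m / p) := by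
  have hp₀' : 0 < p₀ := by linarith
  have hp' : 0 < p := by linarith
  set A := ∫⁻ x, f₀ x ^ p₀
  set B := ∫⁻ x, f x ^ p
  let F : Option (Fin m) → (Fin m → Plane) → ℝ≥0∞ := fun o q => match o with
    | none => ∏ b, f (q b) ^ p
    | some i => f₀ (v - ∑ j, q j) ^ p₀ * ∏ b ∈ Finset.univ.erase i, f (q b) ^ p
  let w : Option (Fin m) → ℝ := fun o => match o with
    | none => 1 - 1 / p₀
    | some _ => 1 - 1 / p
  have hwn : 0 ≤ 1 - 1 / p₀ := by rw [sub_nonneg, div_le_one hp₀']; exact hp₀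
  have hws : 0 ≤ 1 - 1 / p := by rw [sub_nonneg, div_le_one hp']; exact hp
  have hFm : ∀ o, Measurable (F o) := by
    rintro (_ | i)
    · show Measurable fun q : Fin m → Plane => ∏ b, f (q b) ^ p
      fun_prop
    · show Measurable fun q : Fin m → Plane => f₀ (v - ∑ j, q j) ^ p₀ *
        ∏ b ∈ Finset.univ.erase i, f (q b) ^ p
      fun_prop
  have hsum : ∑ o, w o = 1 := by
    rw [Fintype.sum_option]
    simp only [w, Finset.sum_const, Finset.card_univ, Fintype.card_fin, nsmul_eq_mul]
    have : (m : ℝ) * (1 - 1 / p) = m - m / p := by ring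
    rw [this]; linarith
  have hw0 : ∀ o, 0 ≤ w o := by rintro (_ | i) <;> assumption
  have hsumF : (m : ℝ) * (1 - 1 / p) = 1 / p₀ := by
    have : (m : ℝ) * (1 - 1 / p) = m - m / p := by ring
    rw [this]; linarith
  have hI0 : ∫⁻ q, F none q = B ^ m := lintegral_prod_legs (fun x => f x ^ p) (by fun_prop)
  have hI1 : ∀ i, ∫⁻ q, F (some i) q = A * B ^ (m - 1) := by
    intro i
    cases m with
    | zero => exact i.elim0
    | succ n =>
      rw [lintegral_insertNth i (f := fun q => F (some i) q) (hFm (some i))]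
      have : ∀ y : Fin n → Plane, ∀ x : Plane, F (some i) (i.insertNth x y) =
          f₀ (v - ∑ j, y j - x) ^ p₀ * ∏ b, f (y b) ^ p := by
        intro y x
        show f₀ (v - ∑ j, (i.insertNth x y : Fin (n + 1) → Plane) j) ^ p₀ *
          ∏ b ∈ Finset.univ.erase i, f ((i.insertNth x y : Fin (n + 1) → Plane) b) ^ p = _
        have h1 : (Finset.univ.erase i : Finset (Fin (n + 1))) =
            Finset.univ.map i.succAboveEmb := by
          rw [Fin.univ_succAbove _ i]; simp
        rw [h1, Finset.prod_map, Fin.sum_univ_succAbove _ i]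
        simp only [Fin.insertNth_apply_same, Fin.coe_succAboveEmb, Fin.insertNth_apply_succAbove]
        congr 3
        abel
      simp_rw [this]
      have h2 : ∀ y : Fin n → Plane, ∫⁻ x, f₀ (v - ∑ j, y j - x) ^ p₀ * ∏ b, f (y b) ^ p =
          A * ∏ b, f (y b) ^ p := by
        intro y
        rw [lintegral_mul_const _ (by fun_prop)]
        congr 1
        exact lintegral_sub_left_eq_self (fun x : Plane => f₀ x ^ p₀) _
      simp_rw [h2]
      rw [lintegral_const_mul _ (by fun_prop), lintegral_prod_legs (fun x => f x ^ p) (by fun_prop)]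
      rfl
  have hpt : ∀ q : Fin m → Plane, f₀ (v - ∑ j, q j) * ∏ b, f (q b) = ∏ o, F o q ^ w o := by
    intro q
    rw [Fintype.prod_option]
    have e1 : ∀ i, F (some i) q ^ w (some i) = f₀ (v - ∑ j, q j) ^ (p₀ * (1 - 1 / p)) *
        ∏ b ∈ Finset.univ.erase i, f (q b) ^ (p * (1 - 1 / p)) := by
      intro i
      show (f₀ (v - ∑ j, q j) ^ p₀ * ∏ b ∈ Finset.univ.erase i, f (q b) ^ p) ^ (1 - 1 / p) = _
      rw [ENNReal.mul_rpow_of_nonneg _ _ hws, ← ENNReal.prod_rpow_of_nonneg hws, ENNReal.rpow_mul]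
      simp_rw [ENNReal.rpow_mul]
    have e2 : F none q ^ w none = ∏ b, f (q b) ^ (p * (1 - 1 / p₀)) := by
      show (∏ b, f (q b) ^ p) ^ (1 - 1 / p₀) = _
      rw [← ENNReal.prod_rpow_of_nonneg hwn]
      simp_rw [ENNReal.rpow_mul]
    simp_rw [e1]
    rw [e2, Finset.prod_mul_distrib, Finset.prod_const, Finset.card_univ, Fintype.card_fin,
      ← ENNReal.rpow_natCast, ← ENNReal.rpow_mul]
    have e3 : p₀ * (1 - 1 / p) * m = 1 := by
      calc p₀ * (1 - 1 / p) * m = p₀ * (m * (1 - 1 / p)) := by ring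
        _ = 1 := by rw [hsumF]; field_simp
    have e4 : ∏ i : Fin m, ∏ b ∈ Finset.univ.erase i, f (q b) ^ (p * (1 - 1 / p)) =
        ∏ b, f (q b) ^ (p * (1 - 1 / p) * (m - 1 : ℕ)) := by
      rw [Finset.prod_comm' (t' := Finset.univ) (s' := fun b => Finset.univ.erase b)
        (by intro x y; simp [eq_comm])]
      refine Finset.prod_congr rfl fun b _ => ?_
      rw [Finset.prod_const, Finset.card_erase_of_mem (Finset.mem_univ b), Finset.card_univ,
        Fintype.card_fin, ENNReal.rpow_mul _ _ ((m - 1 : ℕ) : ℝ), ENNReal.rpow_natCast]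
    rw [e3, ENNReal.rpow_one, e4, mul_left_comm, ← Finset.prod_mul_distrib]
    congr 1
    refine Finset.prod_congr rfl fun b _ => ?_
    have hm1 : 1 ≤ m := Nat.one_le_of_lt b.pos
    rw [← ENNReal.rpow_add_of_nonneg _ _ (by positivity) (by positivity)]
    have : p * (1 - 1 / p₀) + p * (1 - 1 / p) * (m - 1 : ℕ) = 1 := by
      rw [Nat.cast_sub hm1, Nat.cast_one]
      have : p * (1 - 1 / p₀) + p * (1 - 1 / p) * ((m : ℝ) - 1) =
        p * (1 - 1 / p₀ + m * (1 - 1 / p) - (1 - 1 / p)) := by ring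
      rw [this, hsumF]; field_simp; ring
    rw [this, ENNReal.rpow_one]
  calc ∫⁻ q : Fin m → Plane, f₀ (v - ∑ j, q j) * ∏ b, f (q b)
      = ∫⁻ q, ∏ o, F o q ^ w o := lintegral_congr hpt
    _ ≤ ∏ o, (∫⁻ q, F o q) ^ w o :=
        ENNReal.lintegral_prod_norm_pow_le _ (fun o _ => (hFm o).aemeasurable) hsum
          (fun o _ => hw0 o)
    _ = A ^ (1 / p₀) * B ^ (m / p) := by
      rw [Fintype.prod_option]
      simp_rw [hI1]
      rw [hI0]
      show (B ^ m) ^ (1 - 1 / p₀) * ∏ _i : Fin m, (A * B ^ (m - 1)) ^ (1 - 1 / p) = _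
      rw [Finset.prod_const, Finset.card_univ, Fintype.card_fin]
      rw [ENNReal.mul_rpow_of_nonneg _ _ hws, mul_pow, ← ENNReal.rpow_natCast B m,
        ← ENNReal.rpow_natCast B (m - 1), ← ENNReal.rpow_natCast (_ ^ (1 - 1 / p)),
        ← ENNReal.rpow_natCast (_ ^ (1 - 1 / p)), ← ENNReal.rpow_mul, ← ENNReal.rpow_mul,
        ← ENNReal.rpow_mul, ← ENNReal.rpow_mul, mul_left_comm, mul_comm (1 - 1 / p), hsumF]
      congr 1
      rw [← ENNReal.rpow_add_of_nonneg _ _ (by positivity) (by positivity)]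
      congr 1
      rcases Nat.eq_zero_or_pos m with rfl | hm1
      · simp
      · rw [Nat.cast_sub hm1, Nat.cast_one]
        have : (m : ℝ) * (1 - 1 / p₀) + ((m : ℝ) - 1) * (1 / p₀) = m - 1 / p₀ := by ring
        rw [this]; linarith

end Legs

/-- The symbol `1 + 4π²|p|²` of `1 - Δ` in the plane. -/
def bracket (p : Plane) : ℝ := 1 + 4 * Real.pi ^ 2 * ∑ c, p c ^ 2

theorem measurable_bracket : Measurable bracket := by unfold bracket; fun_prop

theorem one_le_bracket (p : Plane) : 1 ≤ bracket p := by
  unfold bracket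
  have : 0 ≤ 4 * Real.pi ^ 2 * ∑ c, p c ^ 2 := by positivity
  linarith

theorem bracket_pos (p : Plane) : 0 < bracket p := lt_of_lt_of_le one_pos (one_le_bracket p)

theorem one_le_four_pi_sq : 1 ≤ 4 * Real.pi ^ 2 := by
  nlinarith [Real.pi_gt_three]

theorem one_add_norm_sq_le_bracket (p : Plane) : 1 + ‖p‖ ^ 2 ≤ bracket p := by
  unfold bracket
  have h : ‖p‖ ^ 2 ≤ ∑ c, p c ^ 2 := by
    obtain ⟨c, -, hc⟩ : ∃ c ∈ Finset.univ, ‖p‖ = ‖p c‖ := by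
      obtain ⟨c, hc⟩ := Finite.exists_max fun c => ‖p c‖
      exact ⟨c, Finset.mem_univ c, le_antisymm ((pi_norm_le_iff_of_nonneg (norm_nonneg _)).2 hc)
        (norm_le_pi_norm p c)⟩
    rw [hc, Real.norm_eq_abs, sq_abs]
    exact Finset.single_le_sum (f := fun c => p c ^ 2) (fun _ _ => sq_nonneg _) (Finset.mem_univ c)
  have h0 : 0 ≤ ∑ c, p c ^ 2 := Finset.sum_nonneg fun _ _ => sq_nonneg _
  nlinarith [one_le_four_pi_sq]

/-- The power `⟨p⟩^s` as an extended nonnegative number. -/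
def jap (s : ℝ) (p : Plane) : ℝ≥0∞ := ENNReal.ofReal (bracket p ^ s)

@[fun_prop]
theorem measurable_jap (s : ℝ) : Measurable (jap s) :=
  (measurable_bracket.pow_const s).ennreal_ofReal

theorem jap_mul (s t : ℝ) (p : Plane) : jap s p * jap t p = jap (s + t) p := by
  unfold jap
  rw [← ENNReal.ofReal_mul (Real.rpow_nonneg (bracket_pos p).le _), Real.rpow_add (bracket_pos p)]

theorem jap_rpow (s t : ℝ) (p : Plane) : jap s p ^ t = jap (s * t) p := by
  unfold jap
  rw [ENNReal.ofReal_rpow_of_pos (Real.rpow_pos_of_pos (bracket_pos p) _),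
    Real.rpow_mul (bracket_pos p).le]

theorem jap_mono {s t : ℝ} (h : s ≤ t) (p : Plane) : jap s p ≤ jap t p :=
  ENNReal.ofReal_le_ofReal (Real.rpow_le_rpow_of_exponent_le (one_le_bracket p) h)

theorem jap_zero (p : Plane) : jap 0 p = 1 := by simp [jap]

theorem jap_ne_zero (s : ℝ) (p : Plane) : jap s p ≠ 0 := by
  simpa [jap] using Real.rpow_pos_of_pos (bracket_pos p) s

theorem jap_ne_top (s : ℝ) (p : Plane) : jap s p ≠ ∞ := ENNReal.ofReal_ne_top

theorem lintegral_jap_lt_top {s : ℝ} (hs : 1 < s) : ∫⁻ p, jap (-s) p < ∞ := by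
  have h := integrable_rpow_neg_one_add_norm_sq (E := Plane) (μ := volume) (r := 2 * s)
    (by simp; linarith)
  refine lt_of_le_of_lt (lintegral_mono fun p => ?_) h.lintegral_lt_top
  refine ENNReal.ofReal_le_ofReal ?_
  rw [show -(2 * s) / 2 = -s by ring]
  exact Real.rpow_le_rpow_of_nonpos (by positivity) (one_add_norm_sq_le_bracket p) (by linarith)

/-! ### Crude integral bounds -/

theorem prod_legSwap {m : ℕ} (v : Plane) (i : Fin m) (q : Fin m → Plane) (F : Plane → ℝ≥0∞) :
    F (v - ∑ j, legSwap v i q j) * ∏ b, F (legSwap v i q b) =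
      F (v - ∑ j, q j) * ∏ b, F (q b) := by
  rw [sum_legSwap, ← Finset.mul_prod_erase _ _ (Finset.mem_univ i),
    ← Finset.mul_prod_erase _ (fun b => F (q b)) (Finset.mem_univ i), mul_left_comm]
  have h : ∏ b ∈ Finset.univ.erase i, F (legSwap v i q b) =
      ∏ b ∈ Finset.univ.erase i, F (q b) := by
    refine Finset.prod_congr rfl fun b hb => ?_
    rw [legSwap, Function.update_of_ne (Finset.ne_of_mem_erase hb)]
  rw [h]
  simp [legSwap]

theorem bracket_le_sum (v : Plane) (q : Fin 4 → Plane) :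
    bracket v ≤ 5 * (bracket (v - ∑ j, q j) + ∑ j, bracket (q j)) := by
  set p := v - ∑ j, q j with hp
  have hv : v = p + ∑ j, q j := by rw [hp]; abel
  rw [hv]
  simp only [bracket, Fin.sum_univ_four, Fin.sum_univ_two, Pi.add_apply]
  have key : ∀ a b c d e : ℝ, (a + (b + c + d + e)) ^ 2 ≤
      5 * (a ^ 2 + b ^ 2 + c ^ 2 + d ^ 2 + e ^ 2) := by
    intro a b c d e
    nlinarith [sq_nonneg (a - b), sq_nonneg (a - c), sq_nonneg (a - d), sq_nonneg (a - e),
      sq_nonneg (b - c), sq_nonneg (b - d), sq_nonneg (b - e), sq_nonneg (c - d),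
      sq_nonneg (c - e), sq_nonneg (d - e)]
  have h0 := mul_le_mul_of_nonneg_left
    (key (p 0) (q 0 0) (q 1 0) (q 2 0) (q 3 0)) (zero_le_one.trans one_le_four_pi_sq)
  have h1 := mul_le_mul_of_nonneg_left
    (key (p 1) (q 0 1) (q 1 1) (q 2 1) (q 3 1)) (zero_le_one.trans one_le_four_pi_sq)
  nlinarith

theorem jap_le_sum {s : ℝ} (hs : 0 ≤ s) (hs1 : s ≤ 1) (v : Plane) (q : Fin 4 → Plane) :
    jap s v ≤ 25 * (jap s (v - ∑ j, q j) + ∑ j, jap s (q j)) := by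
  let P : Fin 5 → Plane := Fin.cons (v - ∑ j, q j) q
  have hP : ∀ F : Plane → ℝ≥0∞, ∑ i, F (P i) = F (v - ∑ j, q j) + ∑ j, F (q j) := by
    intro F; rw [Fin.sum_univ_succ]; simp [P]
  obtain ⟨i, hi⟩ := Finite.exists_max fun i => bracket (P i)
  have h1 : bracket v ≤ 25 * bracket (P i) := by
    refine (bracket_le_sum v q).trans ?_
    have h2 : bracket (v - ∑ j, q j) + ∑ j, bracket (q j) = ∑ i, bracket (P i) := by
      rw [Fin.sum_univ_succ (fun i => bracket (P i))]; simp [P]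
    have h3 := Finset.sum_le_card_nsmul Finset.univ _ _ fun j _ => hi j
    rw [h2]
    simp at h3
    linarith
  calc jap s v ≤ 25 * jap s (P i) := by
        unfold jap
        rw [show (25 : ℝ≥0∞) = ENNReal.ofReal 25 by norm_num, ← ENNReal.ofReal_mul (by norm_num)]
        refine ENNReal.ofReal_le_ofReal ?_
        calc bracket v ^ s ≤ (25 * bracket (P i)) ^ s :=
              Real.rpow_le_rpow (bracket_pos v).le h1 hs
          _ = 25 ^ s * bracket (P i) ^ s := Real.mul_rpow (by norm_num) (bracket_pos _).le
          _ ≤ 25 * bracket (P i) ^ s := by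
            refine mul_le_mul_of_nonneg_right ?_ (Real.rpow_nonneg (bracket_pos _).le _)
            calc (25 : ℝ) ^ s ≤ 25 ^ (1 : ℝ) :=
                  Real.rpow_le_rpow_of_exponent_le (by norm_num) hs1
              _ = 25 := Real.rpow_one _
    _ ≤ 25 * ∑ i, jap s (P i) := by
        gcongr
        exact Finset.single_le_sum (f := fun i => jap s (P i)) (fun _ _ => zero_le)
          (Finset.mem_univ i)
    _ = _ := by rw [hP]

/-- The fivefold convolution of `⟨p⟩^{-2β}` decays like `⟨v⟩^{-2β'}`. -/
theorem exists_lintegral_jap_le {β β' : ℝ} (hβ' : 0 ≤ β') (h : β' < 5 * β - 4) (hβ : β ≤ 1) :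
    ∃ C : ℝ≥0∞, C ≠ ∞ ∧ ∀ v : Plane, jap β' v *
      ∫⁻ q : Fin 4 → Plane, jap (-β) (v - ∑ j, q j) * ∏ b, jap (-β) (q b) ≤ C := by
  set η := (5 * β - 4 - β') / 8 with hη
  have hη0 : 0 < η := by rw [hη]; linarith
  set θ := β - η with hθ
  have hθ0 : 0 < θ := by linarith
  have hθ1 : θ < 1 := by linarith
  set p := 1 / θ with hp
  set p₀ := 1 / (4 - 4 * θ) with hp₀
  have hd : 0 < 4 - 4 * θ := by linarith
  have hp1 : 1 ≤ p := by rw [hp, le_div_iff₀ hθ0]; linarith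
  have hp₀1 : 1 ≤ p₀ := by rw [hp₀, le_div_iff₀ hd]; linarith
  have hsum : 1 / p₀ + (4 : ℕ) / p = (4 : ℕ) := by
    rw [hp, hp₀]; push_cast; field_simp; ring
  have hA : ∫⁻ x, jap (β' - β) x ^ p₀ < ∞ := by
    have e : ∀ x, jap (β' - β) x ^ p₀ = jap (-((β - β') * p₀)) x := by
      intro x; rw [jap_rpow]; congr 1; ring
    simp_rw [e]
    refine lintegral_jap_lt_top ?_
    rw [hp₀, mul_one_div, lt_div_iff₀ hd]; linarith
  have hB : ∫⁻ x, jap (-β) x ^ p < ∞ := by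
    have e : ∀ x, jap (-β) x ^ p = jap (-(β * p)) x := by
      intro x; rw [jap_rpow]; congr 1; ring
    simp_rw [e]
    refine lintegral_jap_lt_top ?_
    rw [hp, mul_one_div, lt_div_iff₀ hθ0]; linarith
  set Y := (∫⁻ x, jap (β' - β) x ^ p₀) ^ (1 / p₀) * (∫⁻ x, jap (-β) x ^ p) ^ ((4 : ℕ) / p)
  have hY : Y ≠ ∞ := ENNReal.mul_ne_top
    (ENNReal.rpow_ne_top_of_nonneg (by positivity) hA.ne)
    (ENNReal.rpow_ne_top_of_nonneg (by positivity) hB.ne)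
  refine ⟨25 * (5 * Y), ENNReal.mul_ne_top (by norm_num) (ENNReal.mul_ne_top (by norm_num) hY), ?_⟩
  intro v
  let W : (Fin 4 → Plane) → ℝ≥0∞ := fun q => jap (-β) (v - ∑ j, q j) * ∏ b, jap (-β) (q b)
  have hWm : Measurable W := by
    show Measurable fun q : Fin 4 → Plane => jap (-β) (v - ∑ j, q j) * ∏ b, jap (-β) (q b)
    fun_prop
  have hmain : ∫⁻ q, jap β' (v - ∑ j, q j) * W q ≤ Y := by
    refine le_trans (le_of_eq (lintegral_congr fun q => ?_))
      (lintegral_young (m := 4) (measurable_jap (β' - β)) (measurable_jap (-β)) hp₀1 hp1 hsum v)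
    show jap β' _ * (jap (-β) _ * _) = _
    rw [← mul_assoc, jap_mul, ← sub_eq_add_neg]
  have hleg : ∀ i, ∫⁻ q, jap β' (q i) * W q ≤ Y := by
    intro i
    rw [← lintegral_legSwap v i (by fun_prop)]
    refine le_trans (le_of_eq (lintegral_congr fun q => ?_)) hmain
    have h1 : W (legSwap v i q) = W q := prod_legSwap v i q (jap (-β))
    have h2 : legSwap v i q i = v - ∑ j, q j := by simp [legSwap]
    rw [h1, h2]
  show jap β' v * ∫⁻ q, W q ≤ _
  rw [← lintegral_const_mul _ hWm]
  calc ∫⁻ q, jap β' v * W q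
      ≤ ∫⁻ q, 25 * (jap β' (v - ∑ j, q j) * W q + ∑ i, jap β' (q i) * W q) := by
        refine lintegral_mono fun q => ?_
        refine (mul_le_mul_left (jap_le_sum hβ' (by linarith) v q) (W q)).trans ?_
        rw [mul_assoc, add_mul, Finset.sum_mul]
    _ = 25 * ((∫⁻ q, jap β' (v - ∑ j, q j) * W q) + ∑ i, ∫⁻ q, jap β' (q i) * W q) := by
        rw [lintegral_const_mul _ (by fun_prop), lintegral_add_left (by fun_prop),
          lintegral_finsetSum _ (fun i _ => by fun_prop)]
    _ ≤ 25 * (Y + ∑ i : Fin 4, Y) := by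
        gcongr with i
        exact hleg i
    _ = 25 * (5 * Y) := by
        rw [Finset.sum_const, Finset.card_univ, Fintype.card_fin, nsmul_eq_mul]
        push_cast
        ring

/-! ### Cauchy–Schwarz in time-dependent integrals -/

theorem lintegral_sq_le {Ω : Type*} [MeasurableSpace Ω] {μ : Measure Ω} {g w : Ω → ℝ≥0∞}
    (hw : Measurable w) (hg : AEMeasurable g μ) (hwt : ∀ ω, w ω ≠ ∞)
    (hwi : ∫⁻ ω, (w ω)⁻¹ ∂μ ≠ ∞) :
    (∫⁻ ω, g ω ∂μ) ^ 2 ≤ (∫⁻ ω, (w ω)⁻¹ ∂μ) * ∫⁻ ω, w ω * g ω ^ 2 ∂μ := by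
  have hw0 : ∀ᵐ ω ∂μ, w ω ≠ 0 := by
    filter_upwards [ae_lt_top hw.inv hwi] with ω h
    intro h0
    simp [h0] at h
  have h1 : ∫⁻ ω, g ω ∂μ ≤ ∫⁻ ω, (w ω)⁻¹ ^ (1 / 2 : ℝ) * (w ω ^ (1 / 2 : ℝ) * g ω) ∂μ := by
    refine le_of_eq (lintegral_congr_ae ?_)
    filter_upwards [hw0] with ω h
    rw [← mul_assoc, ← ENNReal.mul_rpow_of_nonneg _ _ (by norm_num),
      ENNReal.inv_mul_cancel h (hwt ω), ENNReal.one_rpow, one_mul]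
  have h2 := ENNReal.lintegral_mul_le_Lp_mul_Lq μ Real.HolderConjugate.two_two
    (f := fun ω => (w ω)⁻¹ ^ (1 / 2 : ℝ)) (g := fun ω => w ω ^ (1 / 2 : ℝ) * g ω)
    (by fun_prop) (by fun_prop)
  have h3 := h1.trans h2
  have e1 : ∀ ω, ((w ω)⁻¹ ^ (1 / 2 : ℝ)) ^ (2 : ℝ) = (w ω)⁻¹ := by
    intro ω; rw [← ENNReal.rpow_mul]; norm_num
  have e2 : ∀ ω, (w ω ^ (1 / 2 : ℝ) * g ω) ^ (2 : ℝ) = w ω * g ω ^ 2 := by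
    intro ω
    rw [ENNReal.mul_rpow_of_nonneg _ _ (by norm_num), ← ENNReal.rpow_mul]
    norm_num
  simp only [e1, e2] at h3
  calc (∫⁻ ω, g ω ∂μ) ^ 2 ≤ _ := pow_le_pow_left' h3 2
    _ = _ := by
      rw [mul_pow, ← ENNReal.rpow_natCast, ← ENNReal.rpow_natCast, ← ENNReal.rpow_mul,
        ← ENNReal.rpow_mul]
      norm_num

theorem enorm_integral_sq_le {Ω : Type*} [MeasurableSpace Ω] {μ : Measure Ω} {H : Ω → ℂ}
    {w : Ω → ℝ≥0∞} (hw : Measurable w) (hH : AEStronglyMeasurable H μ) (hwt : ∀ ω, w ω ≠ ∞)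
    (hwi : ∫⁻ ω, (w ω)⁻¹ ∂μ ≠ ∞) :
    ‖∫ ω, H ω ∂μ‖ₑ ^ 2 ≤ (∫⁻ ω, (w ω)⁻¹ ∂μ) * ∫⁻ ω, w ω * ‖H ω‖ₑ ^ 2 ∂μ :=
  (pow_le_pow_left' (enorm_integral_le_lintegral_enorm _) 2).trans
    (lintegral_sq_le hw hH.enorm hwt hwi)

theorem lintegral_enorm_integral_sq_le {Ω : Type*} [MeasurableSpace Ω] {μ : Measure Ω}
    [SFinite μ] {H : ℝ → Ω → ℂ} {w K : Ω → ℝ≥0∞} (hw : Measurable w)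
    (hH : StronglyMeasurable (Function.uncurry H)) (hwt : ∀ ω, w ω ≠ ∞)
    (hwi : ∫⁻ ω, (w ω)⁻¹ ∂μ ≠ ∞) (hK : ∀ᵐ ω ∂μ, ∫⁻ s, ‖H s ω‖ₑ ^ 2 ≤ K ω) :
    ∫⁻ s, ‖∫ ω, H s ω ∂μ‖ₑ ^ 2 ≤ (∫⁻ ω, (w ω)⁻¹ ∂μ) * ∫⁻ ω, w ω * K ω ∂μ := by
  have hm : Measurable fun z : ℝ × Ω => w z.2 * ‖H z.1 z.2‖ₑ ^ 2 :=
    (hw.comp measurable_snd).mul (hH.measurable.enorm.pow_const 2)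
  calc ∫⁻ s, ‖∫ ω, H s ω ∂μ‖ₑ ^ 2
      ≤ ∫⁻ s, (∫⁻ ω, (w ω)⁻¹ ∂μ) * ∫⁻ ω, w ω * ‖H s ω‖ₑ ^ 2 ∂μ := by
        refine lintegral_mono fun s => enorm_integral_sq_le hw ?_ hwt hwi
        exact (hH.comp_measurable measurable_prodMk_left).aestronglyMeasurable
    _ = (∫⁻ ω, (w ω)⁻¹ ∂μ) * ∫⁻ s, ∫⁻ ω, w ω * ‖H s ω‖ₑ ^ 2 ∂μ :=
        lintegral_const_mul _ hm.lintegral_prod_right'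
    _ = (∫⁻ ω, (w ω)⁻¹ ∂μ) * ∫⁻ ω, w ω * (∫⁻ s, ‖H s ω‖ₑ ^ 2) ∂μ := by
        rw [lintegral_lintegral_swap (f := fun s ω => w ω * ‖H s ω‖ₑ ^ 2) hm.aemeasurable]
        congr 1
        refine lintegral_congr fun ω => lintegral_const_mul _ ?_
        exact (hH.measurable.comp measurable_prodMk_right).enorm.pow_const 2
    _ ≤ _ := by
        refine mul_le_mul_right (lintegral_mono_ae ?_) _
        filter_upwards [hK] with ω h
        exact mul_le_mul_right h _

/-! ### Plancherel's theorem and oscillatory integrals -/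

theorem Lp_fourier_ae_eq {f : ℝ → ℂ} (hf : Integrable f) (hf2 : MemLp f 2) :
    (𝓕 (hf2.toLp f) : Lp ℂ 2 (volume : Measure ℝ)) =ᵐ[volume] 𝓕 f := by
  have hcont : Continuous (𝓕 f) := by
    exact VectorFourier.fourierIntegral_continuous Real.continuous_fourierChar
      (by exact continuous_inner) hf
  refine ae_eq_of_integral_contDiff_smul_eq
    ((Lp.memLp _).locallyIntegrable (by norm_num)) hcont.locallyIntegrable ?_
  intro g hg hgs
  have hgs' : HasCompactSupport fun x => (g x : ℂ) := hgs.comp_left (g := ((↑) : ℝ → ℂ)) rfl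
  let G : 𝓢(ℝ, ℂ) := hgs'.toSchwartzMap (Complex.ofRealCLM.contDiff.comp hg)
  have hG : ∀ x, G x = (g x : ℂ) := fun x => rfl
  have h1 := congrArg (fun D => D G) (Lp.fourier_toTemperedDistribution_eq (hf2.toLp f))
  simp only [TemperedDistribution.fourier_apply, Lp.toTemperedDistribution_apply] at h1
  have h2 : ∫ x, (𝓕 G : 𝓢(ℝ, ℂ)) x • (hf2.toLp f) x = ∫ x, G x • 𝓕 f x := by
    have h3 := VectorFourier.integral_fourierIntegral_smul_eq_flip (L := innerₗ ℝ)
      (μ := volume) (ν := volume) Real.continuous_fourierChar continuous_inner G.integrable hf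
    rw [flip_innerₗ] at h3
    refine Eq.trans (integral_congr_ae ?_) h3
    filter_upwards [hf2.coeFn_toLp] with x hx
    rw [hx]
    rfl
  rw [h2] at h1
  simpa [hG] using h1.symm

theorem eLpNorm_two_sq {Ω : Type*} [MeasurableSpace Ω] {μ : Measure Ω} (f : Ω → ℂ) :
    eLpNorm f 2 μ ^ 2 = ∫⁻ x, ‖f x‖ₑ ^ 2 ∂μ := by
  rw [eLpNorm_eq_lintegral_rpow_enorm_toReal (by norm_num) (by norm_num), ← ENNReal.rpow_natCast,
    ← ENNReal.rpow_mul]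
  norm_num

theorem lintegral_enorm_fourier_sq {f : ℝ → ℂ} (hf : Integrable f) (hf2 : MemLp f 2) :
    ∫⁻ ξ, ‖𝓕 f ξ‖ₑ ^ 2 = ∫⁻ x, ‖f x‖ₑ ^ 2 := by
  rw [← eLpNorm_two_sq, ← eLpNorm_two_sq, ← eLpNorm_congr_ae (Lp_fourier_ae_eq hf hf2),
    ← eLpNorm_congr_ae hf2.coeFn_toLp, ← Lp.enorm_def, ← Lp.enorm_def]
  simp only [enorm_eq_nnnorm, Lp.norm_fourier_eq, nnnorm]

theorem lintegral_oscillatory_line {G : ℝ → ℂ} (hG : Integrable G) {l : ℝ} (hl : l ≠ 0) :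
    ∫⁻ s : ℝ, ‖∫ x : ℝ, Complex.exp ((s * (l * x) : ℝ) * Complex.I) * G x‖ₑ ^ 2 ≤
      ENNReal.ofReal (2 * Real.pi) * ‖l‖ₑ⁻¹ * ∫⁻ x, ‖G x‖ₑ ^ 2 := by
  by_cases hfin : ∫⁻ x, ‖G x‖ₑ ^ 2 = ∞
  · rw [hfin, ENNReal.mul_top]
    · exact le_top
    · simp [Real.pi_pos]
  have hG2 : MemLp G 2 := by
    refine ⟨hG.aestronglyMeasurable, ?_⟩
    rw [← eLpNorm_two_sq] at hfin
    exact lt_top_iff_ne_top.2 fun h => hfin (by rw [h]; simp)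
  set a := -l / (2 * Real.pi) with ha
  have ha0 : a ≠ 0 := div_ne_zero (neg_ne_zero.2 hl) Real.two_pi_pos.ne'
  have h1 : ∀ s : ℝ, ∫ x : ℝ, Complex.exp ((s * (l * x) : ℝ) * Complex.I) * G x =
      𝓕 G (a * s) := by
    intro s
    rw [Real.fourier_real_eq_integral_exp_smul]
    refine integral_congr_ae (Filter.Eventually.of_forall fun x => ?_)
    simp only [smul_eq_mul]
    congr 3
    rw [ha]
    push_cast
    field_simp
  simp_rw [h1]
  have hm : Measurable fun ξ => ‖𝓕 G ξ‖ₑ ^ 2 := by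
    have hcont : Continuous (𝓕 G) := by
      exact VectorFourier.fourierIntegral_continuous Real.continuous_fourierChar
        (by exact continuous_inner) hG
    fun_prop
  have h2 : ∫⁻ s, ‖𝓕 G (a * s)‖ₑ ^ 2 = ENNReal.ofReal |a⁻¹| * ∫⁻ ξ, ‖𝓕 G ξ‖ₑ ^ 2 := by
    rw [← lintegral_map hm (measurable_const_mul a), Real.map_volume_mul_left ha0,
      lintegral_smul_measure]
    rfl
  rw [h2, lintegral_enorm_fourier_sq hG hG2]
  gcongr
  rw [ha, ← ofReal_norm, ← ENNReal.ofReal_inv_of_pos (norm_pos_iff.2 hl),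
    ← ENNReal.ofReal_mul (by positivity)]
  refine le_of_eq (congrArg _ ?_)
  rw [inv_div, abs_div, abs_neg, abs_of_pos Real.two_pi_pos, Real.norm_eq_abs, div_eq_mul_inv]

theorem lintegral_mul_const_mul_lintegral {X Ω : Type*} [MeasureSpace X] [MeasureSpace Ω]
    [SFinite (volume : Measure X)] {w : Ω → ℝ≥0∞} {N : X → Ω → ℝ≥0∞} (hw : Measurable w)
    (hN : Measurable fun z : X × Ω => N z.1 z.2) (c : ℝ≥0∞) :
    ∫⁻ z, w z * (c * ∫⁻ x, N x z) = c * ∫⁻ z, ∫⁻ x, w z * N x z := by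
  have h1 : ∀ z, Measurable fun x => N x z := fun z => hN.comp measurable_prodMk_right
  have h2 : Measurable fun z => ∫⁻ x, N x z := hN.lintegral_prod_left'
  have h3 : ∀ z, ∫⁻ x, w z * N x z = w z * ∫⁻ x, N x z := fun z => lintegral_const_mul _ (h1 z)
  simp_rw [h3]
  rw [← lintegral_const_mul c (f := fun z => w z * ∫⁻ x, N x z) (hw.mul h2)]
  exact lintegral_congr fun z => mul_left_comm _ _ _

theorem lintegral_japanese_line {α : ℝ} (hα : 1 / 2 < α) :
    ∫⁻ z : Fin 1 → ℝ, (ENNReal.ofReal ((1 + ‖z‖ ^ 2) ^ α))⁻¹ < ∞ := by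
  have h := integrable_rpow_neg_one_add_norm_sq (E := Fin 1 → ℝ) (μ := volume) (r := 2 * α)
    (by simp; linarith)
  refine lt_of_le_of_lt (lintegral_mono fun z => le_of_eq ?_) h.lintegral_lt_top
  rw [← ENNReal.ofReal_inv_of_pos (by positivity), ← Real.rpow_neg (by positivity)]
  congr 2
  ring

theorem exists_lintegral_oscillatory_plane {α : ℝ} (hα : 1 / 2 < α) :
    ∃ C : ℝ≥0∞, C ≠ ∞ ∧ ∀ (G : Plane → ℂ), StronglyMeasurable G → Integrable G →
      ∀ (η : Plane), η ≠ 0 →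
      ∫⁻ s : ℝ, ‖∫ p, Complex.exp ((s * ∑ c, η c * p c : ℝ) * Complex.I) * G p‖ₑ ^ 2 ≤
        C * ‖η‖ₑ⁻¹ * ∫⁻ p, jap α p * ‖G p‖ₑ ^ 2 := by
  set Z := ∫⁻ z : Fin 1 → ℝ, (ENNReal.ofReal ((1 + ‖z‖ ^ 2) ^ α))⁻¹ with hZ
  have hZt : Z ≠ ∞ := (lintegral_japanese_line hα).ne
  refine ⟨Z * ENNReal.ofReal (2 * Real.pi), ENNReal.mul_ne_top hZt ENNReal.ofReal_ne_top, ?_⟩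
  intro G hGm hG η hη
  obtain ⟨c, hc⟩ : ∃ c, ‖η‖ = ‖η c‖ := by
    obtain ⟨c, hc⟩ := Finite.exists_max fun c => ‖η c‖
    exact ⟨c, le_antisymm ((pi_norm_le_iff_of_nonneg (norm_nonneg _)).2 hc) (norm_le_pi_norm η c)⟩
  have hηc : η c ≠ 0 := by rw [← norm_pos_iff, ← hc]; exact norm_pos_iff.2 hη
  have hcE : ‖η‖ₑ = ‖η c‖ₑ := by rw [← ofReal_norm, hc, ofReal_norm]
  let ins : ℝ → (Fin 1 → ℝ) → Plane := fun x z => c.insertNth x z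
  have hins : Measurable fun z : ℝ × (Fin 1 → ℝ) => ins z.1 z.2 := measurable_insertNth c
  let ph : ℝ → Plane → ℂ := fun s p => Complex.exp ((s * ∑ c, η c * p c : ℝ) * Complex.I)
  have hph : Measurable fun z : ℝ × Plane => ph z.1 z.2 := by
    show Measurable fun z : ℝ × Plane =>
      Complex.exp ((z.1 * ∑ c, η c * z.2 c : ℝ) * Complex.I)
    fun_prop
  have hphn : ∀ s p, ‖ph s p‖ = 1 := fun s p => Complex.norm_exp_ofReal_mul_I _
  let H : ℝ → (Fin 1 → ℝ) → ℂ := fun s z => ∫ x, ph s (ins x z) * G (ins x z)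
  have hHm : StronglyMeasurable (Function.uncurry H) := by
    have : StronglyMeasurable fun z : (ℝ × (Fin 1 → ℝ)) × ℝ =>
        ph z.1.1 (ins z.2 z.1.2) * G (ins z.2 z.1.2) := by
      have h1 : Measurable fun z : (ℝ × (Fin 1 → ℝ)) × ℝ => ins z.2 z.1.2 :=
        hins.comp (measurable_snd.prodMk (measurable_snd.comp measurable_fst))
      exact ((hph.comp ((measurable_fst.comp measurable_fst).prodMk h1)).mul
        (hGm.measurable.comp h1)).stronglyMeasurable
    exact this.integral_prod_right'
  have hI : ∀ s, Integrable fun p => ph s p * G p := by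
    intro s
    refine hG.bdd_mul (c := 1) ?_ (Filter.Eventually.of_forall fun p => (hphn s p).le)
    exact (hph.comp measurable_prodMk_left).aestronglyMeasurable
  have h1 : ∀ s, ∫ p, ph s p * G p = ∫ z, H s z := fun s => integral_insertNth c (hI s)
  show ∫⁻ s, ‖∫ p, ph s p * G p‖ₑ ^ 2 ≤ _
  simp_rw [h1]
  let w : (Fin 1 → ℝ) → ℝ≥0∞ := fun z => ENNReal.ofReal ((1 + ‖z‖ ^ 2) ^ α)
  let K : (Fin 1 → ℝ) → ℝ≥0∞ := fun z =>
    ENNReal.ofReal (2 * Real.pi) * ‖η c‖ₑ⁻¹ * ∫⁻ x, ‖G (ins x z)‖ₑ ^ 2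
  have hwm : Measurable w := by
    show Measurable fun z : Fin 1 → ℝ => ENNReal.ofReal ((1 + ‖z‖ ^ 2) ^ α)
    fun_prop
  have hGi : Measurable fun z : ℝ × (Fin 1 → ℝ) => ‖G (ins z.1 z.2)‖ₑ ^ 2 :=
    (hGm.measurable.comp hins).enorm.pow_const 2
  have hK : ∀ᵐ z, ∫⁻ s, ‖H s z‖ₑ ^ 2 ≤ K z := by
    filter_upwards [(integrable_comp_insertNth c hG).prod_left_ae] with z hz
    refine le_trans (le_of_eq (lintegral_congr fun s => ?_)) (lintegral_oscillatory_line hz hηc)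
    congr 1
    have e1 : ∀ x, ph s (ins x z) = Complex.exp ((s * ∑ j, η (c.succAbove j) * z j : ℝ) *
        Complex.I) * Complex.exp ((s * (η c * x) : ℝ) * Complex.I) := by
      intro x
      show Complex.exp ((s * ∑ c', η c' * ins x z c' : ℝ) * Complex.I) = _
      rw [← Complex.exp_add, Fin.sum_univ_succAbove _ c]
      simp only [ins, Fin.insertNth_apply_same, Fin.insertNth_apply_succAbove]
      congr 1
      push_cast
      ring
    show ‖∫ x, ph s (ins x z) * G (ins x z)‖ₑ = _
    simp_rw [e1, mul_assoc]
    rw [integral_const_mul, enorm_mul, ← ofReal_norm, Complex.norm_exp_ofReal_mul_I,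
      ENNReal.ofReal_one, one_mul]
  refine (lintegral_enorm_integral_sq_le hwm hHm (fun _ => ENNReal.ofReal_ne_top) hZt hK).trans ?_
  have h2 : ∫⁻ z, w z * K z = ENNReal.ofReal (2 * Real.pi) * ‖η c‖ₑ⁻¹ *
      ∫⁻ z, ∫⁻ x, w z * ‖G (ins x z)‖ₑ ^ 2 :=
    lintegral_mul_const_mul_lintegral (N := fun x z => ‖G (ins x z)‖ₑ ^ 2) hwm hGi _
  rw [h2, hcE, ← hZ, ← mul_assoc, ← mul_assoc]
  refine mul_le_mul_right ?_ _
  rw [lintegral_insertNth c (by have := hGm.measurable; fun_prop)]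
  refine lintegral_mono fun z => lintegral_mono fun x => mul_le_mul_left ?_ _
  refine ENNReal.ofReal_le_ofReal (Real.rpow_le_rpow (by positivity) ?_ (by linarith))
  refine le_trans ?_ (one_add_norm_sq_le_bracket _)
  have : ‖z‖ ≤ ‖ins x z‖ := by
    refine (pi_norm_le_iff_of_nonneg (norm_nonneg _)).2 fun j => ?_
    have := norm_le_pi_norm (ins x z) (c.succAbove j)
    simpa [ins] using this
  gcongr

/-! ### The space-time estimate for a single contraction -/

theorem lintegral_inv_norm_near_lt_top :
    ∫⁻ ξ : Plane, (Metric.closedBall (0 : Plane) 1).indicator (fun ξ => ‖ξ‖ₑ⁻¹) ξ < ∞ := by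
  have h1 : Integrable (fun ξ : Plane => (Iic (1 : ℝ)).indicator (fun y => y⁻¹) ‖ξ‖) := by
    rw [integrable_fun_norm_addHaar (μ := (volume : Measure Plane))
      (f := (Iic (1 : ℝ)).indicator (fun y => y⁻¹))]
    have h2 : IntegrableOn (fun _ : ℝ => (1 : ℝ)) (Ioc 0 1) := by simp
    have h3 : IntegrableOn ((Ioc (0 : ℝ) 1).indicator fun _ : ℝ => (1 : ℝ)) (Ioi 0) :=
      (integrable_indicator_iff measurableSet_Ioc).2 h2 |>.integrableOn
    refine h3.congr_fun (fun y hy => ?_) measurableSet_Ioi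
    have hy0 : (0 : ℝ) < y := hy
    by_cases hy1 : y ≤ 1
    · simp [hy0, hy1, hy0.ne']
    · simp [hy1]
  refine lt_of_le_of_lt (le_of_eq (lintegral_congr_ae ?_)) h1.lintegral_lt_top
  have h0 : ∀ᵐ ξ : Plane, ξ ≠ 0 := by simp [ae_iff]
  filter_upwards [h0] with ξ hξ
  by_cases h : ‖ξ‖ ≤ 1
  · rw [indicator_of_mem (by simpa using h), indicator_of_mem (by simpa using h),
      ENNReal.ofReal_inv_of_pos (norm_pos_iff.2 hξ), ofReal_norm]
  · rw [indicator_of_notMem (by simpa using h), indicator_of_notMem (by simpa using h)]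
    simp

theorem inv_enorm_far_le (ξ : Plane) (h : 1 < ‖ξ‖) :
    ‖ξ‖ₑ⁻¹ ≤ ENNReal.ofReal (1 + 8 * Real.pi ^ 2) * jap (-(1 / 2)) ξ := by
  have h0 : 0 < ‖ξ‖ := by linarith
  rw [← ofReal_norm, ← ENNReal.ofReal_inv_of_pos h0, jap, ← ENNReal.ofReal_mul (by positivity)]
  refine ENNReal.ofReal_le_ofReal ?_
  have hb : bracket ξ ≤ (1 + 8 * Real.pi ^ 2) ^ 2 * ‖ξ‖ ^ 2 := by
    have e : ∀ c, ξ c ^ 2 ≤ ‖ξ‖ ^ 2 := fun c => by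
      rw [← sq_abs, ← Real.norm_eq_abs]
      exact pow_le_pow_left₀ (norm_nonneg _) (norm_le_pi_norm ξ c) 2
    have h1 : bracket ξ ≤ (1 + 8 * Real.pi ^ 2) * ‖ξ‖ ^ 2 := by
      unfold bracket
      rw [Fin.sum_univ_two]
      have := mul_le_mul_of_nonneg_left (add_le_add (e 0) (e 1))
        (zero_le_one.trans one_le_four_pi_sq)
      nlinarith
    refine h1.trans (mul_le_mul_of_nonneg_right ?_ (by positivity))
    nlinarith [sq_nonneg Real.pi]
  rw [Real.rpow_neg (bracket_pos ξ).le, ← div_eq_mul_inv, le_div_iff₀ (by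
    exact Real.rpow_pos_of_pos (bracket_pos ξ) _), inv_mul_le_iff₀ h0, mul_comm ‖ξ‖]
  calc bracket ξ ^ (1 / 2 : ℝ) ≤ ((1 + 8 * Real.pi ^ 2) ^ 2 * ‖ξ‖ ^ 2) ^ (1 / 2 : ℝ) :=
        Real.rpow_le_rpow (bracket_pos ξ).le hb (by norm_num)
    _ = (1 + 8 * Real.pi ^ 2) * ‖ξ‖ := by
      rw [← mul_pow, ← Real.sqrt_eq_rpow, Real.sqrt_sq (by positivity)]

/-- The kernel bound behind the space-time estimate; this is where `α > 5/6` is needed. -/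
theorem exists_lintegral_inv_norm_le {α : ℝ} (hα : 5 / 6 < α) (hα1 : α < 1) :
    ∃ C : ℝ≥0∞, C ≠ ∞ ∧ ∀ v : Plane,
      ∫⁻ y : Fin 3 → Plane, ‖v - ∑ j, y j‖ₑ⁻¹ * ∏ j, jap (-α) (y j) ≤ C := by
  let near : Plane → ℝ≥0∞ := (Metric.closedBall (0 : Plane) 1).indicator (fun ξ => ‖ξ‖ₑ⁻¹)
  have hnear : Measurable near := Measurable.indicator (by fun_prop) measurableSet_closedBall
  set θ := (5 / 6 + α) / 2 with hθ
  have hθ0 : 0 < θ := by linarith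
  have hd : 0 < 3 - 3 * θ := by linarith
  have hbig : ∀ p : ℝ, 1 < α * p → ∫⁻ x, jap (-α) x ^ p < ∞ := by
    intro p hp
    simp_rw [jap_rpow, neg_mul]
    exact lintegral_jap_lt_top hp
  set N := (∫⁻ x, near x ^ (1 : ℝ)) ^ (1 / 1 : ℝ) *
    (∫⁻ x, jap (-α) x ^ (3 / 2 : ℝ)) ^ ((3 : ℕ) / (3 / 2 : ℝ)) with hN
  set F := (∫⁻ x, jap (-(1 / 2)) x ^ (1 / (3 - 3 * θ))) ^ (1 / (1 / (3 - 3 * θ))) *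
    (∫⁻ x, jap (-α) x ^ (1 / θ)) ^ ((3 : ℕ) / (1 / θ)) with hF
  have hNt : N ≠ ∞ := by
    refine ENNReal.mul_ne_top (ENNReal.rpow_ne_top_of_nonneg (by norm_num) ?_)
      (ENNReal.rpow_ne_top_of_nonneg (by norm_num) (hbig _ (by linarith)).ne)
    simpa using lintegral_inv_norm_near_lt_top.ne
  have hFt : F ≠ ∞ := by
    refine ENNReal.mul_ne_top (ENNReal.rpow_ne_top_of_nonneg (by positivity) ?_)
      (ENNReal.rpow_ne_top_of_nonneg (by positivity) (hbig _ ?_).ne)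
    · simp_rw [jap_rpow, neg_mul]
      refine (lintegral_jap_lt_top ?_).ne
      rw [mul_one_div, lt_div_iff₀ hd]; linarith
    · rw [mul_one_div, lt_div_iff₀ hθ0]; linarith
  set c := ENNReal.ofReal (1 + 8 * Real.pi ^ 2)
  refine ⟨N + c * F, ENNReal.add_ne_top.2 ⟨hNt, ENNReal.mul_ne_top ENNReal.ofReal_ne_top hFt⟩, ?_⟩
  intro v
  have hpt : ∀ ξ : Plane, ‖ξ‖ₑ⁻¹ ≤ near ξ + c * jap (-(1 / 2)) ξ := by
    intro ξ
    by_cases h : ‖ξ‖ ≤ 1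
    · have : near ξ = ‖ξ‖ₑ⁻¹ := indicator_of_mem (by simpa using h) _
      rw [this]; exact le_self_add
    · exact (inv_enorm_far_le ξ (not_le.1 h)).trans le_add_self
  calc ∫⁻ y : Fin 3 → Plane, ‖v - ∑ j, y j‖ₑ⁻¹ * ∏ j, jap (-α) (y j)
      ≤ ∫⁻ y : Fin 3 → Plane, (near (v - ∑ j, y j) * ∏ j, jap (-α) (y j) +
          c * (jap (-(1 / 2)) (v - ∑ j, y j) * ∏ j, jap (-α) (y j))) := by
        refine lintegral_mono fun y => ?_
        rw [← mul_assoc, ← add_mul]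
        exact mul_le_mul_left (hpt _) _
    _ = (∫⁻ y : Fin 3 → Plane, near (v - ∑ j, y j) * ∏ j, jap (-α) (y j)) +
        c * ∫⁻ y : Fin 3 → Plane, jap (-(1 / 2)) (v - ∑ j, y j) * ∏ j, jap (-α) (y j) := by
        rw [lintegral_add_left (by fun_prop), lintegral_const_mul _ (by fun_prop)]
    _ ≤ N + c * F := by
        gcongr
        · exact lintegral_young hnear (measurable_jap _) le_rfl (by norm_num) (by norm_num) v
        · refine lintegral_young (measurable_jap _) (measurable_jap _) ?_ ?_ ?_ v
          · rw [le_div_iff₀ hd]; linarith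
          · rw [le_div_iff₀ hθ0]; linarith
          · push_cast; field_simp; ring

/-- The kinetic energy of five legs with signs `ε₀, ε`, the main leg having the momentum
`v - ∑ j, q j`. -/
def legEnergy (ε₀ : ℝ) (ε : Fin 4 → ℝ) (v : Plane) (q : Fin 4 → Plane) : ℝ :=
  ε₀ * ∑ c, (v - ∑ j, q j) c ^ 2 + ∑ j, ε j * ∑ c, q j c ^ 2

theorem measurable_legEnergy (ε₀ : ℝ) (ε : Fin 4 → ℝ) (v : Plane) :
    Measurable (legEnergy ε₀ ε v) := by
  unfold legEnergy; fun_prop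

theorem legEnergy_insertNth {ε₀ : ℝ} {ε : Fin 4 → ℝ} {b : Fin 4} (hb : ε b = -ε₀) (v p : Plane)
    (y : Fin 3 → Plane) :
    legEnergy ε₀ ε v (b.insertNth p y) =
      (ε₀ * ∑ c, (v - ∑ j, y j) c ^ 2 + ∑ j, ε (b.succAbove j) * ∑ c, y j c ^ 2) +
        ∑ c, (-2 * ε₀ * (v - ∑ j, y j) c) * p c := by
  unfold legEnergy
  rw [Fin.sum_univ_succAbove (fun j => (b.insertNth p y : Fin 4 → Plane) j) b,
    Fin.sum_univ_succAbove (fun j => ε j * ∑ c, (b.insertNth p y : Fin 4 → Plane) j c ^ 2) b]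
  simp only [Fin.insertNth_apply_same, Fin.insertNth_apply_succAbove, hb]
  set S := ∑ j, y j
  rw [add_comm p S, ← sub_sub]
  simp only [Fin.sum_univ_two, Pi.sub_apply]
  ring

theorem exists_lintegral_oscillatory_legs {α : ℝ} (hα : 5 / 6 < α) (hα1 : α < 1) :
    ∃ C : ℝ≥0∞, C ≠ ∞ ∧ ∀ (G : (Fin 4 → Plane) → ℂ), StronglyMeasurable G → Integrable G →
      ∀ (v : Plane) (ε₀ : ℝ) (ε : Fin 4 → ℝ) (b : Fin 4) (k : ℝ), ε b = -ε₀ → |ε₀| = 1 → 1 ≤ |k| →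
      ∫⁻ s : ℝ, ‖∫ q, Complex.exp ((s * (k * legEnergy ε₀ ε v q) : ℝ) * Complex.I) * G q‖ₑ ^ 2 ≤
        C * ∫⁻ q, (∏ j, jap α (q j)) * ‖G q‖ₑ ^ 2 := by
  obtain ⟨M, hM, hMv⟩ := exists_lintegral_inv_norm_le hα hα1
  obtain ⟨P, hP, hPG⟩ := exists_lintegral_oscillatory_plane (α := α) (by linarith)
  refine ⟨M * P, ENNReal.mul_ne_top hM hP, ?_⟩
  intro G hGm hG v ε₀ ε b k hb hε hk
  let ξ : (Fin 3 → Plane) → Plane := fun y => v - ∑ j, y j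
  have hξm : Measurable ξ := by show Measurable fun y : Fin 3 → Plane => v - ∑ j, y j; fun_prop
  let ins : Plane → (Fin 3 → Plane) → (Fin 4 → Plane) := fun p y => b.insertNth p y
  have hins : Measurable fun z : Plane × (Fin 3 → Plane) => ins z.1 z.2 := measurable_insertNth b
  let ph : ℝ → (Fin 4 → Plane) → ℂ := fun s q =>
    Complex.exp ((s * (k * legEnergy ε₀ ε v q) : ℝ) * Complex.I)
  have hph : Measurable fun z : ℝ × (Fin 4 → Plane) => ph z.1 z.2 := by
    show Measurable fun z : ℝ × (Fin 4 → Plane) =>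
      Complex.exp ((z.1 * (k * legEnergy ε₀ ε v z.2) : ℝ) * Complex.I)
    have := measurable_legEnergy ε₀ ε v
    fun_prop
  have hphn : ∀ s p, ‖ph s p‖ = 1 := fun s p => Complex.norm_exp_ofReal_mul_I _
  let H : ℝ → (Fin 3 → Plane) → ℂ := fun s y => ∫ p, ph s (ins p y) * G (ins p y)
  have hHm : StronglyMeasurable (Function.uncurry H) := by
    have : StronglyMeasurable fun z : (ℝ × (Fin 3 → Plane)) × Plane =>
        ph z.1.1 (ins z.2 z.1.2) * G (ins z.2 z.1.2) := by
      have h1 : Measurable fun z : (ℝ × (Fin 3 → Plane)) × Plane => ins z.2 z.1.2 :=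
        hins.comp (measurable_snd.prodMk (measurable_snd.comp measurable_fst))
      exact ((hph.comp ((measurable_fst.comp measurable_fst).prodMk h1)).mul
        (hGm.measurable.comp h1)).stronglyMeasurable
    exact this.integral_prod_right'
  have hI : ∀ s, Integrable fun p => ph s p * G p := by
    intro s
    refine hG.bdd_mul (c := 1) ?_ (Filter.Eventually.of_forall fun p => (hphn s p).le)
    exact (hph.comp measurable_prodMk_left).aestronglyMeasurable
  have h1 : ∀ s, ∫ p, ph s p * G p = ∫ z, H s z := fun s => integral_insertNth b (hI s)
  show ∫⁻ s, ‖∫ p, ph s p * G p‖ₑ ^ 2 ≤ _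
  simp_rw [h1]
  let w : (Fin 3 → Plane) → ℝ≥0∞ := fun y => ‖ξ y‖ₑ * ∏ j, jap α (y j)
  let J : (Fin 3 → Plane) → ℝ≥0∞ := fun y => ∫⁻ p, jap α p * ‖G (ins p y)‖ₑ ^ 2
  have hwm : Measurable w := by
    show Measurable fun y => ‖ξ y‖ₑ * ∏ j, jap α (y j)
    fun_prop
  have hwt : ∀ y, w y ≠ ∞ := fun y =>
    ENNReal.mul_ne_top enorm_ne_top (ENNReal.prod_ne_top fun j _ => jap_ne_top _ _)
  have hwinv : ∀ y, (w y)⁻¹ = ‖v - ∑ j, y j‖ₑ⁻¹ * ∏ j, jap (-α) (y j) := by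
    intro y
    have h0 : ∏ j, jap α (y j) ≠ 0 := Finset.prod_ne_zero_iff.2 fun j _ => jap_ne_zero _ _
    have e1 : (∏ j, jap α (y j))⁻¹ = ∏ j, jap (-α) (y j) := by
      refine (ENNReal.eq_inv_of_mul_eq_one_left ?_).symm
      rw [← Finset.prod_mul_distrib]
      simp [jap_mul, jap_zero]
    show (‖ξ y‖ₑ * ∏ j, jap α (y j))⁻¹ = _
    rw [ENNReal.mul_inv (Or.inr (ENNReal.prod_ne_top fun j _ => jap_ne_top _ _)) (Or.inr h0), e1]
  have hwi : ∫⁻ y, (w y)⁻¹ ≤ M := by simp_rw [hwinv]; exact hMv v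
  have hξ0 : ∀ᵐ y, ξ y ≠ 0 := by
    filter_upwards [ae_lt_top hwm.inv (ne_top_of_le_ne_top hM hwi)] with y hy h0
    simp [w, h0] at hy
  have hK : ∀ᵐ y, ∫⁻ s, ‖H s y‖ₑ ^ 2 ≤ P * ‖ξ y‖ₑ⁻¹ * J y := by
    filter_upwards [(integrable_comp_insertNth b hG).prod_left_ae, hξ0] with y hy hy0
    let η : Plane := (k * (-2 * ε₀)) • ξ y
    have hk0 : k ≠ 0 := fun h => by rw [h, abs_zero] at hk; linarith
    have hε0 : ε₀ ≠ 0 := fun h => by rw [h, abs_zero] at hε; linarith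
    have hη : η ≠ 0 := smul_ne_zero (mul_ne_zero hk0 (mul_ne_zero (by norm_num) hε0)) hy0
    have hGy : StronglyMeasurable fun p => G (ins p y) :=
      hGm.comp_measurable (hins.comp measurable_prodMk_right)
    refine le_trans (le_of_eq (lintegral_congr fun s => ?_))
      ((hPG _ hGy hy η hη).trans (mul_le_mul_left (mul_le_mul_right ?_ _) _))
    · congr 1
      have e1 : ∀ p, ph s (ins p y) = Complex.exp ((s * (k *
          (ε₀ * ∑ c, (v - ∑ j, y j) c ^ 2 + ∑ j, ε (b.succAbove j) * ∑ c, y j c ^ 2)) : ℝ) *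
          Complex.I) * Complex.exp ((s * ∑ c, η c * p c : ℝ) * Complex.I) := by
        intro p
        show Complex.exp ((s * (k * legEnergy ε₀ ε v (b.insertNth p y)) : ℝ) * Complex.I) = _
        rw [← Complex.exp_add, legEnergy_insertNth hb, ← add_mul, ← Complex.ofReal_add]
        congr 3
        have : ∑ c, η c * p c = k * ∑ c, (-2 * ε₀ * (v - ∑ j, y j) c) * p c := by
          rw [Finset.mul_sum]
          refine Finset.sum_congr rfl fun c _ => ?_
          show (k * (-2 * ε₀)) * (v - ∑ j, y j) c * p c = _
          ring
        rw [this]; ring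
      show ‖∫ p, ph s (ins p y) * G (ins p y)‖ₑ = _
      simp_rw [e1, mul_assoc]
      rw [integral_const_mul, enorm_mul, ← ofReal_norm, Complex.norm_exp_ofReal_mul_I,
        ENNReal.ofReal_one, one_mul]
    · rw [ENNReal.inv_le_inv, ← ofReal_norm, ← ofReal_norm]
      refine ENNReal.ofReal_le_ofReal ?_
      rw [norm_smul, Real.norm_eq_abs, abs_mul, abs_mul, hε]
      have h2 : |(-2 : ℝ)| = 2 := by norm_num
      rw [h2]
      nlinarith [norm_nonneg (ξ y)]
  refine (lintegral_enorm_integral_sq_le hwm hHm hwt (ne_top_of_le_ne_top hM hwi) hK).trans ?_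
  rw [mul_assoc]
  refine mul_le_mul' hwi ?_
  have hJm : Measurable fun z : Plane × (Fin 3 → Plane) => jap α z.1 * ‖G (ins z.1 z.2)‖ₑ ^ 2 := by
    have := hGm.measurable.comp hins
    exact ((measurable_jap α).comp measurable_fst).mul (this.enorm.pow_const 2)
  calc ∫⁻ y, w y * (P * ‖ξ y‖ₑ⁻¹ * J y) ≤ ∫⁻ y, (∏ j, jap α (y j)) * (P * J y) := by
        refine lintegral_mono fun y => ?_
        calc w y * (P * ‖ξ y‖ₑ⁻¹ * J y)
            = (‖ξ y‖ₑ * ‖ξ y‖ₑ⁻¹) * ((∏ j, jap α (y j)) * (P * J y)) := by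
              show (‖ξ y‖ₑ * ∏ j, jap α (y j)) * _ = _; ring
          _ ≤ 1 * ((∏ j, jap α (y j)) * (P * J y)) :=
              mul_le_mul_left (ENNReal.mul_inv_le_one _) _
          _ = _ := one_mul _
    _ = P * ∫⁻ y, ∫⁻ p, (∏ j, jap α (y j)) * (jap α p * ‖G (ins p y)‖ₑ ^ 2) :=
        lintegral_mul_const_mul_lintegral (w := fun y => ∏ j, jap α (y j))
          (N := fun p y => jap α p * ‖G (ins p y)‖ₑ ^ 2) (by fun_prop) hJm P
    _ = P * ∫⁻ q, (∏ j, jap α (q j)) * ‖G q‖ₑ ^ 2 := by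
        rw [lintegral_insertNth b (by have := hGm.measurable; fun_prop)]
        congr 1
        refine lintegral_congr fun y => lintegral_congr fun p => ?_
        rw [Fin.prod_univ_succAbove _ b]
        simp only [Fin.insertNth_apply_same, Fin.insertNth_apply_succAbove]
        rw [← mul_assoc, mul_comm (∏ j, jap α (y j))]

/-- The product of the weights of five legs with total momentum `v`. -/
def legWeight (β : ℝ) (v : Plane) (q : Fin 4 → Plane) : ℝ≥0∞ :=
  jap β (v - ∑ j, q j) * ∏ j, jap β (q j)

theorem measurable_legWeight (β : ℝ) (v : Plane) : Measurable (legWeight β v) := by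
  unfold legWeight; fun_prop

theorem legWeight_ne_top (β : ℝ) (v : Plane) (q : Fin 4 → Plane) : legWeight β v q ≠ ∞ :=
  ENNReal.mul_ne_top (jap_ne_top _ _) (ENNReal.prod_ne_top fun _ _ => jap_ne_top _ _)

theorem inv_legWeight (β : ℝ) (v : Plane) (q : Fin 4 → Plane) :
    (legWeight β v q)⁻¹ = legWeight (-β) v q := by
  refine (ENNReal.eq_inv_of_mul_eq_one_left ?_).symm
  unfold legWeight
  rw [mul_mul_mul_comm, ← Finset.prod_mul_distrib]
  simp [jap_mul, jap_zero]

/-- The contraction of five legs is bounded from the weight `β` to each weight below `5β - 4`,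
with absolutely convergent integrals. -/
theorem exists_jap_mul_lintegral_sq_le {β β' : ℝ} (hβ' : 0 ≤ β') (h : β' < 5 * β - 4)
    (hβ : β ≤ 1) :
    ∃ C : ℝ≥0∞, C ≠ ∞ ∧ ∀ (v : Plane) (g : (Fin 4 → Plane) → ℝ≥0∞), Measurable g →
      jap β' v * (∫⁻ q, g q) ^ 2 ≤ C * ∫⁻ q, legWeight β v q * g q ^ 2 := by
  obtain ⟨C, hC, hCv⟩ := exists_lintegral_jap_le hβ' h hβ
  refine ⟨C, hC, fun v g hg => ?_⟩
  have hi : ∫⁻ q, (legWeight β v q)⁻¹ ≠ ∞ := by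
    simp_rw [inv_legWeight]
    intro ht
    have := hCv v
    unfold legWeight at ht
    rw [ht, ENNReal.mul_top (jap_ne_zero _ _)] at this
    exact hC (top_le_iff.1 this)
  calc jap β' v * (∫⁻ q, g q) ^ 2
      ≤ jap β' v * ((∫⁻ q, (legWeight β v q)⁻¹) * ∫⁻ q, legWeight β v q * g q ^ 2) :=
        mul_le_mul_right (lintegral_sq_le (measurable_legWeight β v) hg.aemeasurable
          (legWeight_ne_top β v) hi) _
    _ = (jap β' v * ∫⁻ q, legWeight (-β) v q) * ∫⁻ q, legWeight β v q * g q ^ 2 := by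
        simp_rw [inv_legWeight]; rw [mul_assoc]
    _ ≤ _ := mul_le_mul_left (hCv v) _

theorem legEnergy_legSwap (ε₀ : ℝ) (ε : Fin 4 → ℝ) (v : Plane) (i : Fin 4) (q : Fin 4 → Plane) :
    legEnergy ε₀ ε v (legSwap v i q) = legEnergy (ε i) (Function.update ε i ε₀) v q := by
  unfold legEnergy
  rw [sum_legSwap, ← Finset.add_sum_erase _ _ (Finset.mem_univ i),
    ← Finset.add_sum_erase _ (fun j => Function.update ε i ε₀ j * ∑ c, q j c ^ 2)
      (Finset.mem_univ i)]
  have h : ∑ j ∈ Finset.univ.erase i, ε j * ∑ c, legSwap v i q j c ^ 2 =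
      ∑ j ∈ Finset.univ.erase i, Function.update ε i ε₀ j * ∑ c, q j c ^ 2 := by
    refine Finset.sum_congr rfl fun j hj => ?_
    rw [legSwap, Function.update_of_ne (Finset.ne_of_mem_erase hj),
      Function.update_of_ne (Finset.ne_of_mem_erase hj)]
  rw [h]
  simp only [legSwap, Function.update_self]
  ring

/-- The signs of the four additional legs `q₁, q₂, q'₁, q'₂`. -/
def legSign : Fin 4 → ℝ := ![1, 1, -1, -1]

theorem exists_opposite_leg {ε₀ : ℝ} (h : ε₀ = 1 ∨ ε₀ = -1) : ∃ b, legSign b = -ε₀ := by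
  rcases h with rfl | rfl
  · exact ⟨2, by simp [legSign]⟩
  · exact ⟨0, by simp [legSign]⟩

theorem exists_opposite_leg_update (ε₀ : ℝ) (i : Fin 4) :
    ∃ b, Function.update legSign i ε₀ b = -legSign i := by
  fin_cases i
  · exact ⟨2, by simp [legSign]⟩
  · exact ⟨2, by simp [legSign]⟩
  · exact ⟨0, by simp [legSign]⟩
  · exact ⟨0, by simp [legSign]⟩

theorem abs_legSign (i : Fin 4) : |legSign i| = 1 := by
  fin_cases i <;> simp [legSign]

theorem sum_sq_le_card_mul_sum_sq {ι : Type*} [Fintype ι] (a : ι → ℝ≥0∞) :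
    (∑ i, a i) ^ 2 ≤ Fintype.card ι * ∑ i, a i ^ 2 := by
  have h := ENNReal.inner_le_Lp_mul_Lq Finset.univ (fun _ : ι => 1) a Real.HolderConjugate.two_two
  simp only [one_mul, ENNReal.one_rpow, Finset.sum_const, Finset.card_univ, nsmul_eq_mul,
    mul_one] at h
  refine (pow_le_pow_left' h 2).trans (le_of_eq ?_)
  rw [mul_pow, ← ENNReal.rpow_natCast, ← ENNReal.rpow_natCast, ← ENNReal.rpow_mul,
    ← ENNReal.rpow_mul]
  norm_num

/-- The space-time estimate for the contraction of five legs. -/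
theorem exists_lintegral_contraction_legs {α : ℝ} (hα : 5 / 6 < α) (hα1 : α < 1) :
    ∃ C : ℝ≥0∞, C ≠ ∞ ∧ ∀ (G : (Fin 4 → Plane) → ℂ), StronglyMeasurable G → Integrable G →
      ∀ (v : Plane) (ε₀ k : ℝ), (ε₀ = 1 ∨ ε₀ = -1) → 1 ≤ |k| →
      jap α v * ∫⁻ s : ℝ,
        ‖∫ q, Complex.exp ((s * (k * legEnergy ε₀ legSign v q) : ℝ) * Complex.I) * G q‖ₑ ^ 2 ≤
        C * ∫⁻ q, legWeight α v q * ‖G q‖ₑ ^ 2 := by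
  obtain ⟨C, hC, hCG⟩ := exists_lintegral_oscillatory_legs hα hα1
  refine ⟨5 * (5 * (25 * C)), by finiteness, ?_⟩
  intro G hGm hG v ε₀ k hε hk
  have habs : |ε₀| = 1 := by rcases hε with rfl | rfl <;> simp
  let P : Fin 5 → (Fin 4 → Plane) → Plane := fun i q => (Fin.cons (v - ∑ j, q j) q : Fin 5 → Plane) i
  have hP0 : ∀ q, P 0 q = v - ∑ j, q j := fun q => rfl
  have hPs : ∀ i q, P (Fin.succ i) q = q i := fun i q => rfl
  have hPm : ∀ i, Measurable (P i) := by
    intro i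
    refine Fin.cases ?_ (fun j => ?_) i
    · show Measurable fun q : Fin 4 → Plane => v - ∑ j, q j
      fun_prop
    · show Measurable fun q : Fin 4 → Plane => q j
      fun_prop
  let D : (Fin 4 → Plane) → ℝ := fun q => ∑ i, bracket (P i q) ^ α
  have hpos : ∀ i q, 0 < bracket (P i q) ^ α := fun i q => Real.rpow_pos_of_pos (bracket_pos _) _
  have hD : ∀ q, 0 < D q := fun q => Finset.sum_pos (fun i _ => hpos i q) Finset.univ_nonempty
  let θ : Fin 5 → (Fin 4 → Plane) → ℝ := fun i q => bracket (P i q) ^ α / D q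
  have hθ0 : ∀ i q, 0 ≤ θ i q := fun i q => (div_pos (hpos i q) (hD q)).le
  have hθ1 : ∀ i q, θ i q ≤ 1 := fun i q => (div_le_one (hD q)).2
    (Finset.single_le_sum (f := fun i => bracket (P i q) ^ α) (fun i _ => (hpos i q).le)
      (Finset.mem_univ i))
  have hθsum : ∀ q, ∑ i, θ i q = 1 := fun q => by
    show ∑ i, bracket (P i q) ^ α / D q = 1
    rw [← Finset.sum_div]; exact div_self (hD q).ne'
  have hθm : ∀ i, Measurable (θ i) := by
    intro i
    have hb : ∀ i, Measurable fun q => bracket (P i q) ^ α := fun i =>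
      (measurable_bracket.comp (hPm i)).pow_const α
    exact (hb i).div (Finset.measurable_sum _ fun i _ => hb i)
  have hθw : ∀ i q, jap α v * ‖(θ i q : ℂ)‖ₑ ^ 2 ≤ 25 * jap α (P i q) := by
    intro i q
    have e1 : ‖(θ i q : ℂ)‖ₑ = ENNReal.ofReal (θ i q) := by
      rw [← ofReal_norm, Complex.norm_real, Real.norm_of_nonneg (hθ0 i q)]
    have e2 : jap α v ≤ 25 * ENNReal.ofReal (D q) := by
      refine (jap_le_sum (by linarith) hα1.le v q).trans (le_of_eq ?_)
      congr 1
      show _ = ENNReal.ofReal (∑ i, bracket (P i q) ^ α)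
      rw [ENNReal.ofReal_sum_of_nonneg fun i _ => (hpos i q).le, Fin.sum_univ_succ]
      rfl
    rw [e1]
    calc jap α v * ENNReal.ofReal (θ i q) ^ 2 ≤ 25 * ENNReal.ofReal (D q) *
          ENNReal.ofReal (θ i q) := by
          refine mul_le_mul' e2 ?_
          rw [sq]
          refine mul_le_of_le_one_left' ?_
          rw [← ENNReal.ofReal_one]
          exact ENNReal.ofReal_le_ofReal (hθ1 i q)
      _ = 25 * jap α (P i q) := by
          rw [mul_assoc, ← ENNReal.ofReal_mul (hD q).le]
          congr 2
          exact mul_div_cancel₀ _ (hD q).ne'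
  let ph : ℝ → (Fin 4 → Plane) → ℂ := fun s q =>
    Complex.exp ((s * (k * legEnergy ε₀ legSign v q) : ℝ) * Complex.I)
  have hph : ∀ s, Measurable (ph s) := fun s => by
    show Measurable fun q : (Fin 4 → Plane) =>
      Complex.exp ((s * (k * legEnergy ε₀ legSign v q) : ℝ) * Complex.I)
    have := measurable_legEnergy ε₀ legSign v
    fun_prop
  let Gi : Fin 5 → (Fin 4 → Plane) → ℂ := fun i q => (θ i q : ℂ) * G q
  have hGim : ∀ i, StronglyMeasurable (Gi i) := fun i =>
    ((Complex.measurable_ofReal.comp (hθm i)).mul hGm.measurable).stronglyMeasurable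
  have hGii : ∀ i, Integrable (Gi i) := fun i =>
    hG.bdd_mul (c := 1) (Complex.measurable_ofReal.comp (hθm i)).aestronglyMeasurable
      (Filter.Eventually.of_forall fun q => by
        rw [Complex.norm_real, Real.norm_of_nonneg (hθ0 i q)]; exact hθ1 i q)
  have hphi : ∀ s i, Integrable fun q => ph s q * Gi i q := fun s i =>
    (hGii i).bdd_mul (c := 1) (hph s).aestronglyMeasurable
      (Filter.Eventually.of_forall fun q => (Complex.norm_exp_ofReal_mul_I _).le)
  -- the estimate for the part where the leg `i` dominates
  have hpart : ∀ i, jap α v * ∫⁻ s, ‖∫ q, ph s q * Gi i q‖ₑ ^ 2 ≤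
      25 * C * ∫⁻ q, legWeight α v q * ‖G q‖ₑ ^ 2 := by
    intro i
    have key : ∃ R : (Fin 4 → Plane) → ℝ≥0∞, Measurable R ∧
        (∀ q, jap α (P i q) * R q = legWeight α v q) ∧
        ∫⁻ s, ‖∫ q, ph s q * Gi i q‖ₑ ^ 2 ≤ C * ∫⁻ q, R q * ‖Gi i q‖ₑ ^ 2 := by
      refine Fin.cases ?_ (fun j => ?_) i
      · obtain ⟨b, hb⟩ := exists_opposite_leg hε
        exact ⟨fun q => ∏ j, jap α (q j), by fun_prop, fun q => rfl,
          hCG _ (hGim 0) (hGii 0) v ε₀ legSign b k hb habs hk⟩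
      · obtain ⟨b, hb⟩ := exists_opposite_leg_update ε₀ j
        have hR : Measurable fun q : Fin 4 → Plane => ∏ l, jap α (q l) := by fun_prop
        refine ⟨fun q => ∏ l, jap α (legSwap v j q l), hR.comp (measurable_legSwap v j),
          fun q => ?_, ?_⟩
        · rw [legWeight, ← prod_legSwap v j q, sum_legSwap]
          rfl
        · have h1 := hCG _ ((hGim (Fin.succ j)).comp_measurable (measurable_legSwap v j))
            (((measurePreserving_legSwap v j).integrable_comp_emb
              (legSwapEquiv v j).measurableEmbedding).2 (hGii (Fin.succ j)))
            v (legSign j) (Function.update legSign j ε₀) b k hb (abs_legSign j) hk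
          have h2 : ∀ s, ∫ q, ph s q * Gi (Fin.succ j) q = ∫ q, Complex.exp ((s * (k *
              legEnergy (legSign j) (Function.update legSign j ε₀) v q) : ℝ) * Complex.I) *
              (Gi (Fin.succ j) ∘ legSwap v j) q := by
            intro s
            rw [← integral_legSwap v j]
            refine integral_congr_ae (Filter.Eventually.of_forall fun q => ?_)
            show Complex.exp ((s * (k * legEnergy ε₀ legSign v (legSwap v j q)) : ℝ) * Complex.I) *
              _ = _
            rw [legEnergy_legSwap]
            rfl
          simp_rw [h2]
          refine h1.trans (le_of_eq ?_)
          congr 1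
          have h3 := lintegral_legSwap v j (f := fun q =>
            (∏ l, jap α (legSwap v j q l)) * ‖Gi (Fin.succ j) q‖ₑ ^ 2)
            ((hR.comp (measurable_legSwap v j)).mul ((hGim _).measurable.enorm.pow_const 2))
          simp only [legSwap_legSwap] at h3
          exact h3
    obtain ⟨R, hRm, hR, hRb⟩ := key
    calc jap α v * ∫⁻ s, ‖∫ q, ph s q * Gi i q‖ₑ ^ 2
        ≤ jap α v * (C * ∫⁻ q, R q * ‖Gi i q‖ₑ ^ 2) := mul_le_mul_right hRb _
      _ = C * ∫⁻ q, jap α v * (R q * ‖Gi i q‖ₑ ^ 2) := by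
          rw [lintegral_const_mul' _ _ (jap_ne_top _ _)]
          exact mul_left_comm _ _ _
      _ ≤ C * ∫⁻ q, 25 * (legWeight α v q * ‖G q‖ₑ ^ 2) := by
          refine mul_le_mul_right (lintegral_mono fun q => ?_) _
          calc jap α v * (R q * ‖Gi i q‖ₑ ^ 2)
              = (jap α v * ‖(θ i q : ℂ)‖ₑ ^ 2) * (R q * ‖G q‖ₑ ^ 2) := by
                show jap α v * (R q * ‖(θ i q : ℂ) * G q‖ₑ ^ 2) = _
                rw [enorm_mul]; ring
            _ ≤ 25 * jap α (P i q) * (R q * ‖G q‖ₑ ^ 2) := mul_le_mul_left (hθw i q) _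
            _ = _ := by rw [← hR q]; ring
      _ = _ := by
          rw [lintegral_const_mul' _ _ (by norm_num)]
          ring
  have hsplit : ∀ s, ‖∫ q, ph s q * G q‖ₑ ^ 2 ≤ 5 * ∑ i, ‖∫ q, ph s q * Gi i q‖ₑ ^ 2 := by
    intro s
    have h1 : ∫ q, ph s q * G q = ∑ i, ∫ q, ph s q * Gi i q := by
      rw [← integral_finsetSum _ fun i _ => hphi s i]
      refine integral_congr_ae (Filter.Eventually.of_forall fun q => ?_)
      show ph s q * G q = ∑ i, ph s q * ((θ i q : ℂ) * G q)
      rw [← Finset.mul_sum, ← Finset.sum_mul, ← Complex.ofReal_sum, hθsum]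
      simp
    rw [h1]
    exact (pow_le_pow_left' (enorm_sum_le _ _) 2).trans (by
      simpa using sum_sq_le_card_mul_sum_sq fun i => ‖∫ q, ph s q * Gi i q‖ₑ)
  have hms : ∀ i, Measurable fun s => ‖∫ q, ph s q * Gi i q‖ₑ ^ 2 := by
    intro i
    have h1 : StronglyMeasurable fun z : ℝ × (Fin 4 → Plane) => ph z.1 z.2 * Gi i z.2 := by
      have h2 : Measurable fun z : ℝ × (Fin 4 → Plane) => ph z.1 z.2 := by
        show Measurable fun z : ℝ × (Fin 4 → Plane) =>
          Complex.exp ((z.1 * (k * legEnergy ε₀ legSign v z.2) : ℝ) * Complex.I)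
        have := measurable_legEnergy ε₀ legSign v
        fun_prop
      exact (h2.mul ((hGim i).measurable.comp measurable_snd)).stronglyMeasurable
    exact (h1.integral_prod_right').measurable.enorm.pow_const 2
  calc jap α v * ∫⁻ s, ‖∫ q, ph s q * G q‖ₑ ^ 2
      ≤ jap α v * ∫⁻ s, 5 * ∑ i, ‖∫ q, ph s q * Gi i q‖ₑ ^ 2 :=
        mul_le_mul_right (lintegral_mono hsplit) _
    _ = 5 * ∑ i, jap α v * ∫⁻ s, ‖∫ q, ph s q * Gi i q‖ₑ ^ 2 := by
        rw [lintegral_const_mul _ (Finset.measurable_sum _ fun i _ => hms i),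
          lintegral_finsetSum _ fun i _ => hms i, mul_left_comm, Finset.mul_sum]
    _ ≤ 5 * ∑ i : Fin 5, 25 * C * ∫⁻ q, legWeight α v q * ‖G q‖ₑ ^ 2 :=
        mul_le_mul_right (Finset.sum_le_sum fun i _ => hpart i) _
    _ = _ := by
        rw [Finset.sum_const, Finset.card_univ, Fintype.card_fin, nsmul_eq_mul]
        push_cast
        ring

/-! ### Momentum coordinates -/

theorem volume_preserving_uncurry (ι κ : Type*) [Fintype ι] [Fintype κ] :
    MeasurePreserving (fun (f : ι → κ → ℝ) (p : ι × κ) => f p.1 p.2) := by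
  refine ⟨by fun_prop, (Measure.pi_eq fun s hs => ?_).symm⟩
  rw [Measure.map_apply (by fun_prop) (MeasurableSet.univ_pi hs)]
  have h : (fun (f : ι → κ → ℝ) (p : ι × κ) => f p.1 p.2) ⁻¹' univ.pi s =
      univ.pi fun i => univ.pi fun c => s (i, c) := by
    ext f; simp [Set.mem_pi]
  rw [h, volume_pi_pi]
  simp_rw [volume_pi_pi]
  rw [Fintype.prod_prod_type]

/-- The planar momentum of the leg `a`. -/
def leg {k : ℕ} (u : Conf k) (a : Particle k) : Plane := fun c => u (a, c)

/-- Momentum coordinates on the Fourier space. -/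
def legsEquiv (k : ℕ) : Conf k ≃ᵐ (Particle k → Plane) where
  toFun := leg
  invFun x := WithLp.toLp 2 fun p => x p.1 p.2
  left_inv _ := rfl
  right_inv _ := rfl
  measurable_toFun := by
    refine measurable_pi_lambda _ fun a => measurable_pi_lambda _ fun c => ?_
    show Measurable fun u : Conf k => u (a, c)
    fun_prop
  measurable_invFun := (PiLp.volume_preserving_toLp _).measurable.comp
    (volume_preserving_uncurry _ _).measurable

theorem volume_preserving_legsEquiv (k : ℕ) : MeasurePreserving (legsEquiv k) := by
  have h : MeasurePreserving (legsEquiv k).symm :=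
    (PiLp.volume_preserving_toLp _).comp (volume_preserving_uncurry _ _)
  exact h.symm

/-- The momenta of the four additional legs, numbered `q₁, q₂, q'₁, q'₂`. -/
def pairLegs (q : Conf 2) (j : Fin 4) : Plane := leg q (finSumFinEquiv.symm j)

theorem sum_pairLegs {M : Type*} [AddCommMonoid M] (F : Particle 2 → M) :
    ∑ j : Fin 4, F (finSumFinEquiv.symm j) = ∑ e, F e :=
  Equiv.sum_comp (finSumFinEquiv (m := 2) (n := 2)).symm F

theorem volume_preserving_pairLegs : MeasurePreserving pairLegs := by
  have h := (volume_measurePreserving_piCongrLeft (fun _ : Fin 4 => Plane)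
    (finSumFinEquiv (m := 2) (n := 2))).comp (volume_preserving_legsEquiv 2)
  have e : pairLegs = MeasurableEquiv.piCongrLeft (fun _ : Fin 4 => Plane)
      (finSumFinEquiv (m := 2) (n := 2)) ∘ legsEquiv 2 := by
    funext q j
    obtain ⟨e, rfl⟩ := (finSumFinEquiv (m := 2) (n := 2)).surjective j
    rw [Function.comp_apply, MeasurableEquiv.coe_piCongrLeft, Equiv.piCongrLeft_apply_apply,
      pairLegs, Equiv.symm_apply_apply]
    rfl
  rw [e]
  exact h

/-- `pairLegs` as an equivalence. -/
def pairLegsEquiv : Conf 2 ≃ᵐ (Fin 4 → Plane) where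
  toFun := pairLegs
  invFun x := (legsEquiv 2).symm fun e => x (finSumFinEquiv e)
  left_inv _ := by
    refine (legsEquiv 2).injective (funext fun e => ?_)
    exact congrArg (leg _) (Equiv.symm_apply_apply _ e)
  right_inv x := by
    funext j
    exact congrArg x (Equiv.apply_symm_apply _ j)
  measurable_toFun := volume_preserving_pairLegs.measurable
  measurable_invFun := by
    have h : Measurable fun (x : Fin 4 → Plane) (e : Particle 2) => x (finSumFinEquiv e) := by
      fun_prop
    exact (legsEquiv 2).symm.measurable.comp h

/-- Concatenation of the momenta of `k` and of two particles. -/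
def joinLegs {k : ℕ} (x : Particle k → Plane) (y : Particle 2 → Plane) : Particle (k + 2) → Plane
  | Sum.inl i => Fin.addCases (fun j => x (Sum.inl j)) (fun l => y (Sum.inl l)) i
  | Sum.inr i => Fin.addCases (fun j => x (Sum.inr j)) (fun l => y (Sum.inr l)) i

/-- The place of an old particle variable among those of two more particles. -/
def oldParticle {k : ℕ} : Particle k → Particle (k + 2) :=
  Sum.map (Fin.castAdd 2) (Fin.castAdd 2)

/-- The places of the two new particles. -/
def newParticle {k : ℕ} : Particle 2 → Particle (k + 2) :=
  Sum.map (Fin.natAdd k) (Fin.natAdd k)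

@[simp]
theorem joinLegs_old {k : ℕ} (x : Particle k → Plane) (y : Particle 2 → Plane) (b : Particle k) :
    joinLegs x y (oldParticle b) = x b := by
  rcases b with b | b <;> simp [joinLegs, oldParticle]

@[simp]
theorem joinLegs_new {k : ℕ} (x : Particle k → Plane) (y : Particle 2 → Plane) (b : Particle 2) :
    joinLegs x y (newParticle b) = y b := by
  rcases b with b | b <;> simp [joinLegs, newParticle]

theorem particle_cases {k : ℕ} {P : Particle (k + 2) → Prop} (hold : ∀ b, P (oldParticle b))
    (hnew : ∀ b, P (newParticle b)) (p : Particle (k + 2)) : P p := by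
  rcases p with i | i
  · refine Fin.addCases (fun j => ?_) (fun l => ?_) i
    · exact hold (Sum.inl j)
    · exact hnew (Sum.inl l)
  · refine Fin.addCases (fun j => ?_) (fun l => ?_) i
    · exact hold (Sum.inr j)
    · exact hnew (Sum.inr l)

@[to_additive]
theorem prod_particle {k : ℕ} {M : Type*} [CommMonoid M] (F : Particle (k + 2) → M) :
    ∏ p, F p = (∏ b, F (oldParticle b)) * ∏ e, F (newParticle e) := by
  simp only [Fintype.prod_sum_type, Fin.prod_univ_add]
  exact mul_mul_mul_comm _ _ _ _

theorem measurable_joinLegs {k : ℕ} :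
    Measurable fun z : (Particle k → Plane) × (Particle 2 → Plane) => joinLegs z.1 z.2 := by
  refine measurable_pi_lambda _ fun p => ?_
  refine particle_cases (P := fun p => Measurable fun z : (Particle k → Plane) ×
    (Particle 2 → Plane) => joinLegs z.1 z.2 p) (fun b => ?_) (fun b => ?_) p
  · simp only [joinLegs_old]; fun_prop
  · simp only [joinLegs_new]; fun_prop

theorem volume_preserving_joinLegs (k : ℕ) :
    MeasurePreserving fun z : (Particle k → Plane) × (Particle 2 → Plane) =>
      joinLegs z.1 z.2 := by
  refine ⟨measurable_joinLegs, (Measure.pi_eq fun s hs => ?_).symm⟩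
  rw [Measure.map_apply measurable_joinLegs (MeasurableSet.univ_pi hs)]
  have h : (fun z : (Particle k → Plane) × (Particle 2 → Plane) => joinLegs z.1 z.2) ⁻¹'
      univ.pi s = (univ.pi fun b => s (oldParticle b)) ×ˢ (univ.pi fun b => s (newParticle b)) := by
    ext z
    simp only [mem_preimage, Set.mem_pi, mem_univ, true_imp_iff, mem_prod]
    constructor
    · intro hz
      exact ⟨fun b => by simpa using hz (oldParticle b), fun b => by simpa using hz (newParticle b)⟩
    · rintro ⟨h1, h2⟩
      exact particle_cases (fun b => by simpa using h1 b) (fun b => by simpa using h2 b)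
  rw [h, Measure.volume_eq_prod, Measure.prod_prod, volume_pi_pi, volume_pi_pi,
    prod_particle fun p => volume (s p)]

theorem leg_insertPair {k : ℕ} (a : Particle k) (u : Conf k) (q : Conf 2) :
    leg (insertPair a u q) =
      joinLegs (fun b => leg u b - if b = a then ∑ e, leg q e else 0) (leg q) := by
  funext p
  refine particle_cases (P := fun p => leg (insertPair a u q) p = joinLegs _ (leg q) p)
    (fun b => ?_) (fun b => ?_) p
  · rw [joinLegs_old]
    funext c
    rcases b with b | b
    · simp only [leg, insertPair, oldParticle, Sum.map_inl, Fin.addCases_left, Pi.sub_apply]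
      split_ifs <;> simp [leg]
    · simp only [leg, insertPair, oldParticle, Sum.map_inr, Fin.addCases_left, Pi.sub_apply]
      split_ifs <;> simp [leg]
  · rw [joinLegs_new]
    funext c
    rcases b with b | b
    · simp [leg, insertPair, newParticle]
    · simp [leg, insertPair, newParticle]

theorem volume_preserving_insertPair {k : ℕ} (a : Particle k) :
    MeasurePreserving fun z : Conf k × Conf 2 => insertPair a z.1 z.2 := by
  have hsh : MeasurePreserving (fun z : (Particle 2 → Plane) × (Particle k → Plane) =>
      (z.1, (fun b => z.2 b - if b = a then ∑ e, z.1 e else 0 : Particle k → Plane))) := by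
    refine MeasurePreserving.skew_product (f := id) (MeasurePreserving.id _)
      (g := fun (y : Particle 2 → Plane) (x : Particle k → Plane) (b : Particle k) =>
        x b - if b = a then ∑ e, y e else 0) ?_ ?_
    · refine measurable_pi_lambda _ fun b => ?_
      by_cases h : b = a
      · simp only [Function.uncurry, h, if_true]; fun_prop
      · simp only [Function.uncurry, h, if_false]; fun_prop
    · exact Filter.Eventually.of_forall fun y => map_sub_right_eq_self volume
        (fun b => if b = a then ∑ e, y e else 0 : Particle k → Plane)
  have h := (volume_preserving_legsEquiv (k + 2)).symm.comp ((volume_preserving_joinLegs k).comp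
    ((Measure.measurePreserving_swap).comp (hsh.comp ((Measure.measurePreserving_swap).comp
      ((volume_preserving_legsEquiv k).prod (volume_preserving_legsEquiv 2))))))
  refine (congrArg (fun f => MeasurePreserving f volume volume) (funext fun z => ?_)).mpr h
  refine (legsEquiv (k + 2)).injective ?_
  rw [Function.comp_apply, MeasurableEquiv.apply_symm_apply]
  exact leg_insertPair a z.1 z.2

theorem ae_insertPair {k : ℕ} (a : Particle k) {P : Conf (k + 2) → Prop} (h : ∀ᵐ v, P v) :
    ∀ᵐ u : Conf k, ∀ᵐ q : Conf 2, P (insertPair a u q) :=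
  Measure.ae_ae_of_ae_prod ((volume_preserving_insertPair a).quasiMeasurePreserving.ae h)

theorem lintegral_insertPair {k : ℕ} (a : Particle k) {F : Conf (k + 2) → ℝ≥0∞}
    (hF : Measurable F) : ∫⁻ u : Conf k, ∫⁻ q : Conf 2, F (insertPair a u q) = ∫⁻ v, F v := by
  rw [← (volume_preserving_insertPair a).lintegral_comp hF]
  exact (lintegral_prod _ (hF.comp (volume_preserving_insertPair a).measurable).aemeasurable).symm

/-! ### Weights and phases in momentum coordinates -/

/-- The square of the Sobolev weight. -/
def sqWeight {k : ℕ} (β : ℝ) (u : Conf k) : ℝ≥0∞ := ∏ a, jap β (leg u a)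

theorem measurable_leg {k : ℕ} (a : Particle k) : Measurable fun u : Conf k => leg u a :=
  (measurable_pi_apply a).comp (legsEquiv k).measurable

theorem measurable_sqWeight {k : ℕ} (β : ℝ) : Measurable (sqWeight (k := k) β) := by
  unfold sqWeight
  have := fun a => measurable_leg (k := k) a
  fun_prop

theorem bracket_leg {k : ℕ} (u : Conf k) (a : Particle k) :
    bracket (leg u a) = 1 + 4 * Real.pi ^ 2 * normSqAt a u := rfl

theorem sobolevWeight_pos {k : ℕ} (β : ℝ) (u : Conf k) : 0 < sobolevWeight β u :=
  Finset.prod_pos fun a _ => by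
    rw [← bracket_leg]; exact Real.rpow_pos_of_pos (bracket_pos _) _

theorem enorm_sobolevWeight_sq {k : ℕ} (β : ℝ) (u : Conf k) :
    ‖(sobolevWeight β u : ℂ)‖ₑ ^ 2 = sqWeight β u := by
  rw [← ofReal_norm, Complex.norm_real, Real.norm_of_nonneg (sobolevWeight_pos β u).le,
    ← ENNReal.ofReal_pow (sobolevWeight_pos β u).le, sqWeight, sobolevWeight, ← Finset.prod_pow]
  rw [ENNReal.ofReal_prod_of_nonneg]
  · refine Finset.prod_congr rfl fun a _ => ?_
    rw [← bracket_leg, jap, ← Real.rpow_natCast, ← Real.rpow_mul (bracket_pos _).le]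
    congr 2
    push_cast
    ring
  · intro a _
    exact pow_nonneg (Real.rpow_nonneg (bracket_pos (leg u a)).le _) _

/-- The weight of all legs except `a`. -/
def restWeight {k : ℕ} (β : ℝ) (a : Particle k) (u : Conf k) : ℝ≥0∞ :=
  ∏ b ∈ Finset.univ.erase a, jap β (leg u b)

theorem sqWeight_eq {k : ℕ} (β : ℝ) (a : Particle k) (u : Conf k) :
    sqWeight β u = restWeight β a u * jap β (leg u a) := by
  rw [mul_comm]
  exact (Finset.mul_prod_erase _ _ (Finset.mem_univ a)).symm

theorem sqWeight_insertPair {k : ℕ} (β : ℝ) (a : Particle k) (u : Conf k) (q : Conf 2) :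
    sqWeight β (insertPair a u q) = restWeight β a u * legWeight β (leg u a) (pairLegs q) := by
  unfold sqWeight restWeight legWeight
  rw [leg_insertPair, prod_particle, ← Finset.mul_prod_erase _ _ (Finset.mem_univ a)]
  simp only [joinLegs_old, joinLegs_new, if_true]
  have h1 : ∏ b ∈ Finset.univ.erase a, jap β (leg u b - if b = a then ∑ e, leg q e else 0) =
      ∏ b ∈ Finset.univ.erase a, jap β (leg u b) := by
    refine Finset.prod_congr rfl fun b hb => ?_
    rw [if_neg (Finset.ne_of_mem_erase hb), sub_zero]
  have h2 : ∑ j, pairLegs q j = ∑ e, leg q e := sum_pairLegs (leg q)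
  have h3 : ∏ j, jap β (pairLegs q j) = ∏ e, jap β (leg q e) :=
    Equiv.prod_comp (finSumFinEquiv (m := 2) (n := 2)).symm fun e => jap β (leg q e)
  rw [h1, h2, h3]
  ring

theorem restWeight_mono {k : ℕ} {β β' : ℝ} (h : β ≤ β') (a : Particle k) (u : Conf k) :
    restWeight β a u ≤ restWeight β' a u :=
  Finset.prod_le_prod' fun _ _ => jap_mono h _

theorem sqWeight_mono {k : ℕ} {β β' : ℝ} (h : β ≤ β') (u : Conf k) :
    sqWeight β u ≤ sqWeight β' u :=
  Finset.prod_le_prod' fun _ _ => jap_mono h _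

theorem sqWeight_ne_top {k : ℕ} (β : ℝ) (u : Conf k) : sqWeight β u ≠ ∞ :=
  ENNReal.prod_ne_top fun _ _ => jap_ne_top _ _

theorem sqWeight_zero {k : ℕ} (u : Conf k) : sqWeight 0 u = 1 := by simp [sqWeight, jap_zero]

/-- The sign with which the Laplacian of the variable `a` enters `Δ_±`. -/
def particleSign {k : ℕ} : Particle k → ℝ := Sum.elim (fun _ => 1) (fun _ => -1)

theorem particleSign_eq {k : ℕ} (a : Particle k) : particleSign a = 1 ∨ particleSign a = -1 := by
  rcases a with a | a
  · exact Or.inl rfl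
  · exact Or.inr rfl

theorem laplacianSymbol_eq {k : ℕ} (u : Conf k) :
    laplacianSymbol u = -(4 * Real.pi ^ 2) * ∑ a, particleSign a * ∑ c, leg u a c ^ 2 := by
  unfold laplacianSymbol
  rw [Fintype.sum_sum_type, Finset.sum_sub_distrib]
  simp only [particleSign, Sum.elim_inl, Sum.elim_inr, one_mul, neg_mul, Finset.sum_neg_distrib]
  rfl

/-- The change of the kinetic energy in the contraction at the variable `a`. -/
def legPhase {k : ℕ} (a : Particle k) (v : Plane) (q : Conf 2) : ℝ :=
  -(4 * Real.pi ^ 2) * (legEnergy (particleSign a) legSign v (pairLegs q) -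
    particleSign a * ∑ c, v c ^ 2)

theorem laplacianSymbol_insertPair {k : ℕ} (a : Particle k) (u : Conf k) (q : Conf 2) :
    laplacianSymbol (insertPair a u q) = laplacianSymbol u + legPhase a (leg u a) q := by
  rw [laplacianSymbol_eq, laplacianSymbol_eq, leg_insertPair, sum_particle,
    ← Finset.add_sum_erase _ _ (Finset.mem_univ a),
    ← Finset.add_sum_erase _ (fun a => particleSign a * ∑ c, leg u a c ^ 2) (Finset.mem_univ a)]
  simp only [joinLegs_old, joinLegs_new, if_true]
  have h0 : ∀ b : Particle k, particleSign (oldParticle b) = particleSign b := by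
    rintro (b | b) <;> rfl
  have h1 : ∑ b ∈ Finset.univ.erase a, particleSign (oldParticle b) *
      ∑ c, (leg u b - if b = a then ∑ e, leg q e else 0) c ^ 2 =
      ∑ b ∈ Finset.univ.erase a, particleSign b * ∑ c, leg u b c ^ 2 := by
    refine Finset.sum_congr rfl fun b hb => ?_
    rw [if_neg (Finset.ne_of_mem_erase hb), sub_zero, h0]
  have h2 : ∑ j, pairLegs q j = ∑ e, leg q e := sum_pairLegs (leg q)
  have h3 : ∑ j, legSign j * ∑ c, pairLegs q j c ^ 2 =
      ∑ e : Particle 2, particleSign (newParticle (k := k) e) * ∑ c, leg q e c ^ 2 := by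
    rw [← Equiv.sum_comp (finSumFinEquiv (m := 2) (n := 2)).symm]
    refine Finset.sum_congr rfl fun j _ => ?_
    congr 1
    fin_cases j <;> rfl
  rw [h1, legPhase, legEnergy, h2, h3, h0]
  ring

/-! ### Weighted norms on the Fourier side -/

/-- The weighted `L²` norm of a Fourier transform. -/
def nrm {k : ℕ} (β : ℝ) (φ : Ker k) : ℝ≥0∞ :=
  eLpNorm (fun u : Conf k => (sobolevWeight β u : ℂ) * φ u) 2 volume

theorem measurable_sobolevWeight {k : ℕ} (β : ℝ) : Measurable (sobolevWeight (k := k) β) := by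
  have h : (sobolevWeight (k := k) β) = fun u => ∏ a, bracket (leg u a) ^ (β / 2) := rfl
  rw [h]
  exact Finset.measurable_prod _ fun a _ =>
    (measurable_bracket.comp (measurable_leg a)).pow_const _

section Basic

variable {k : ℕ}

theorem Ker.measurable (φ : Ker k) : Measurable φ := (Lp.stronglyMeasurable φ).measurable

theorem aestronglyMeasurable_weight (β : ℝ) (φ : Ker k) :
    AEStronglyMeasurable (fun u : Conf k => (sobolevWeight β u : ℂ) * φ u) volume :=
  ((Complex.measurable_ofReal.comp (measurable_sobolevWeight β)).mul
    (Ker.measurable φ)).aestronglyMeasurable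

theorem nrm_sq (β : ℝ) (φ : Ker k) : nrm β φ ^ 2 = ∫⁻ u, sqWeight β u * ‖φ u‖ₑ ^ 2 := by
  rw [nrm, eLpNorm_two_sq]
  refine lintegral_congr fun u => ?_
  rw [enorm_mul, mul_pow, enorm_sobolevWeight_sq]

theorem nrm_le_of_sq_le {k' : ℕ} {β β' : ℝ} {φ : Ker k} {ψ : Ker k'} {C : ℝ≥0∞}
    (h : nrm β φ ^ 2 ≤ C * nrm β' ψ ^ 2) : nrm β φ ≤ C ^ (1 / 2 : ℝ) * nrm β' ψ := by
  have h1 := ENNReal.rpow_le_rpow h (show (0 : ℝ) ≤ 1 / 2 by norm_num)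
  rw [ENNReal.mul_rpow_of_nonneg _ _ (by norm_num), ← ENNReal.rpow_natCast,
    ← ENNReal.rpow_natCast, ← ENNReal.rpow_mul, ← ENNReal.rpow_mul] at h1
  norm_num at h1
  exact h1

theorem nrm_add_le (β : ℝ) (φ ψ : Ker k) : nrm β (φ + ψ) ≤ nrm β φ + nrm β ψ := by
  have h : eLpNorm (fun u : Conf k => (sobolevWeight β u : ℂ) * (φ + ψ : Ker k) u) 2 volume =
      eLpNorm ((fun u : Conf k => (sobolevWeight β u : ℂ) * φ u) +
        fun u : Conf k => (sobolevWeight β u : ℂ) * ψ u) 2 volume := by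
    refine eLpNorm_congr_ae ?_
    filter_upwards [Lp.coeFn_add φ ψ] with u hu
    rw [hu]
    simp [mul_add]
  unfold nrm
  rw [h]
  exact eLpNorm_add_le (aestronglyMeasurable_weight β φ) (aestronglyMeasurable_weight β ψ)
    (by norm_num)

theorem nrm_smul (β : ℝ) (c : ℂ) (φ : Ker k) : nrm β (c • φ) = ‖c‖ₑ * nrm β φ := by
  have h : eLpNorm (fun u : Conf k => (sobolevWeight β u : ℂ) * (c • φ : Ker k) u) 2 volume =
      eLpNorm (c • fun u : Conf k => (sobolevWeight β u : ℂ) * φ u) 2 volume := by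
    refine eLpNorm_congr_ae ?_
    filter_upwards [Lp.coeFn_smul c φ] with u hu
    rw [hu]
    simp only [Pi.smul_apply, smul_eq_mul]
    ring
  unfold nrm
  rw [h, eLpNorm_const_smul]

theorem nrm_mono {β β' : ℝ} (h : β ≤ β') (φ : Ker k) : nrm β φ ≤ nrm β' φ := by
  have := nrm_le_of_sq_le (β := β) (β' := β') (φ := φ) (ψ := φ) (C := 1) (by
    rw [nrm_sq, nrm_sq, one_mul]
    exact lintegral_mono fun u => mul_le_mul_left (sqWeight_mono h u) _)
  simpa using this

theorem nrm_zero_exponent (φ : Ker k) : nrm 0 φ = ‖φ‖ₑ := by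
  have : ∀ u : Conf k, sobolevWeight 0 u = 1 := fun u => by simp [sobolevWeight]
  simp [nrm, this, Lp.enorm_def]

theorem enorm_le_nrm {β : ℝ} (hβ : 0 ≤ β) (φ : Ker k) : ‖φ‖ₑ ≤ nrm β φ := by
  rw [← nrm_zero_exponent]
  exact nrm_mono hβ φ

@[simp]
theorem nrm_zero (β : ℝ) : nrm β (0 : Ker k) = 0 := by
  have := nrm_smul β 0 (0 : Ker k)
  simpa using this

theorem nrm_sum_le {ι : Type*} (s : Finset ι) (β : ℝ) (φ : ι → Ker k) :
    nrm β (∑ i ∈ s, φ i) ≤ ∑ i ∈ s, nrm β (φ i) := by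
  classical
  induction s using Finset.induction with
  | empty => simp
  | insert i s hi ih =>
    rw [Finset.sum_insert hi, Finset.sum_insert hi]
    exact (nrm_add_le _ _ _).trans (add_le_add le_rfl ih)

/-- The Fourier transforms that have all Sobolev norms below the energy norm. -/
def Nice (φ : Ker k) : Prop := ∀ β < 1, nrm β φ < ∞

theorem nice_of_nrm_one {φ : Ker k} (h : nrm 1 φ < ∞) : Nice φ :=
  fun _ hβ => (nrm_mono hβ.le φ).trans_lt h

theorem Nice.add {φ ψ : Ker k} (h : Nice φ) (h' : Nice ψ) : Nice (φ + ψ) := fun β hβ =>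
  (nrm_add_le β φ ψ).trans_lt (ENNReal.add_lt_top.2 ⟨h β hβ, h' β hβ⟩)

theorem Nice.smul {φ : Ker k} (h : Nice φ) (c : ℂ) : Nice (c • φ) := fun β hβ => by
  rw [nrm_smul]; exact ENNReal.mul_lt_top enorm_lt_top (h β hβ)

theorem nice_zero : Nice (0 : Ker k) := fun β _ => by simp

theorem Nice.sum {ι : Type*} {s : Finset ι} {φ : ι → Ker k} (h : ∀ i ∈ s, Nice (φ i)) :
    Nice (∑ i ∈ s, φ i) := fun β hβ =>
  (nrm_sum_le s β φ).trans_lt (ENNReal.sum_lt_top.2 fun i hi => h i hi β hβ)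

theorem memLp_mul {m : Conf k → ℂ} (hm : Measurable m) (hb : ∀ u, ‖m u‖ ≤ 1) (φ : Ker k) :
    MemLp (fun u => m u * φ u) 2 :=
  (Lp.memLp φ).of_le (hm.mul (Ker.measurable φ)).aestronglyMeasurable
    (Filter.Eventually.of_forall fun u => by
      rw [norm_mul]; exact mul_le_of_le_one_left (norm_nonneg _) (hb u))

/-- Multiplication by a measurable function bounded by `1`. -/
def mulOp (m : Conf k → ℂ) (hm : Measurable m) (hb : ∀ u, ‖m u‖ ≤ 1) : Ker k →L[ℂ] Ker k :=
  have hmem := memLp_mul hm hb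
  LinearMap.mkContinuous
    { toFun := fun φ => (hmem φ).toLp
      map_add' := fun φ ψ => by
        refine Lp.ext ?_
        filter_upwards [(hmem (φ + ψ)).coeFn_toLp, (hmem φ).coeFn_toLp, (hmem ψ).coeFn_toLp,
          Lp.coeFn_add φ ψ, Lp.coeFn_add (hmem φ).toLp (hmem ψ).toLp] with u h1 h2 h3 h4 h5
        rw [h1, h5, Pi.add_apply, h2, h3, h4, Pi.add_apply, mul_add]
      map_smul' := fun c φ => by
        refine Lp.ext ?_
        filter_upwards [(hmem (c • φ)).coeFn_toLp, (hmem φ).coeFn_toLp,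
          Lp.coeFn_smul c φ, Lp.coeFn_smul c (hmem φ).toLp] with u h1 h2 h4 h5
        simp only [RingHom.id_apply]
        rw [h1, h5, Pi.smul_apply, h2, h4, Pi.smul_apply, smul_eq_mul, smul_eq_mul]
        ring } 1 fun φ => by
      rw [one_mul]
      refine Lp.norm_le_norm_of_ae_le ?_
      filter_upwards [(hmem φ).coeFn_toLp] with u h1
      simp only [LinearMap.coe_mk, AddHom.coe_mk]
      rw [h1, norm_mul]
      exact mul_le_of_le_one_left (norm_nonneg _) (hb u)

theorem mulOp_ae (m : Conf k → ℂ) (hm : Measurable m) (hb : ∀ u, ‖m u‖ ≤ 1) (φ : Ker k) :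
    mulOp m hm hb φ =ᵐ[volume] fun u => m u * φ u :=
  (memLp_mul hm hb φ).coeFn_toLp

theorem measurable_phase (s : ℝ) :
    Measurable fun u : Conf k => Complex.exp ((s * laplacianSymbol u : ℝ) * Complex.I) := by
  have := (continuous_laplacianSymbol (k := k)).measurable
  fun_prop

/-- The free evolution on the Fourier side. -/
def phaseMul (s : ℝ) : Ker k →L[ℂ] Ker k :=
  mulOp (fun u => Complex.exp ((s * laplacianSymbol u : ℝ) * Complex.I)) (measurable_phase s)
    fun _ => (Complex.norm_exp_ofReal_mul_I _).le

theorem phaseMul_ae (s : ℝ) (φ : Ker k) : phaseMul s φ =ᵐ[volume] fun u =>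
    Complex.exp ((s * laplacianSymbol u : ℝ) * Complex.I) * φ u :=
  mulOp_ae _ _ _ _

theorem freeEvolution_eq (t : ℝ) (f : Ker k) : freeEvolution t f = 𝓕⁻ (phaseMul t (𝓕 f)) := rfl

theorem fourier_freeEvolution (t : ℝ) (f : Ker k) : 𝓕 (freeEvolution t f) = phaseMul t (𝓕 f) := by
  rw [freeEvolution_eq, FourierTransform.fourier_fourierInv_eq]

theorem phaseMul_add (s t : ℝ) (φ : Ker k) : phaseMul (s + t) φ = phaseMul s (phaseMul t φ) := by
  refine Lp.ext ?_
  filter_upwards [phaseMul_ae (s + t) φ, phaseMul_ae s (phaseMul t φ), phaseMul_ae t φ]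
    with u h1 h2 h3
  rw [h1, h2, h3, ← mul_assoc, ← Complex.exp_add]
  congr 2
  push_cast
  ring

@[simp]
theorem phaseMul_zero (φ : Ker k) : phaseMul 0 φ = φ := by
  refine Lp.ext ?_
  filter_upwards [phaseMul_ae 0 φ] with u h
  rw [h]; simp

@[simp]
theorem nrm_phaseMul (β s : ℝ) (φ : Ker k) : nrm β (phaseMul s φ) = nrm β φ := by
  refine eLpNorm_congr_norm_ae ?_
  filter_upwards [phaseMul_ae s φ] with u h
  rw [h, norm_mul, norm_mul, norm_mul, Complex.norm_exp_ofReal_mul_I, one_mul]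

theorem Nice.phase {φ : Ker k} (h : Nice φ) (s : ℝ) : Nice (phaseMul s φ) := fun β hβ => by
  rw [nrm_phaseMul]; exact h β hβ

end Basic

/-! ### Contractions on the Fourier side -/

section Contraction

variable {k : ℕ}

theorem measurable_insertPair (a : Particle k) :
    Measurable fun z : Conf k × Conf 2 => insertPair a z.1 z.2 :=
  (volume_preserving_insertPair a).measurable

theorem measurable_comp_insertPair (a : Particle k) (φ : Ker (k + 2)) :
    Measurable fun z : Conf k × Conf 2 => φ (insertPair a z.1 z.2) :=
  (Ker.measurable φ).comp (measurable_insertPair a)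

theorem restWeight_ne_top (β : ℝ) (a : Particle k) (u : Conf k) : restWeight β a u ≠ ∞ :=
  ENNReal.prod_ne_top fun _ _ => jap_ne_top _ _

/-- The contraction at the variable `a`, with absolute values inside of the integral, maps the
weight `β` to each weight below `5β - 4`. -/
theorem exists_lintegral_contraction_le {β β' : ℝ} (hβ' : 0 ≤ β') (h : β' < 5 * β - 4)
    (hβ : β ≤ 1) :
    ∃ C : ℝ≥0∞, C ≠ ∞ ∧ ∀ (k : ℕ) (a : Particle k) (φ : Ker (k + 2)),
      ∫⁻ u, sqWeight β' u * (∫⁻ q, ‖φ (insertPair a u q)‖ₑ) ^ 2 ≤ C * nrm β φ ^ 2 := by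
  obtain ⟨C, hC, hCv⟩ := exists_jap_mul_lintegral_sq_le hβ' h hβ
  refine ⟨C, hC, fun k a φ => ?_⟩
  rw [nrm_sq, ← lintegral_insertPair a (F := fun v => sqWeight β v * ‖φ v‖ₑ ^ 2) ((measurable_sqWeight β).mul
    ((Ker.measurable φ).enorm.pow_const 2)), ← lintegral_const_mul' _ _ hC]
  refine lintegral_mono fun u => ?_
  have hg : Measurable fun q => ‖φ (insertPair a u q)‖ₑ :=
    ((measurable_comp_insertPair a φ).comp measurable_prodMk_left).enorm
  let g : (Fin 4 → Plane) → ℝ≥0∞ := fun x => ‖φ (insertPair a u (pairLegsEquiv.symm x))‖ₑ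
  have hgm : Measurable g := hg.comp pairLegsEquiv.symm.measurable
  have hgp : ∀ q, g (pairLegs q) = ‖φ (insertPair a u q)‖ₑ := fun q => by
    show ‖φ (insertPair a u (pairLegsEquiv.symm (pairLegsEquiv q)))‖ₑ = _
    rw [MeasurableEquiv.symm_apply_apply]
  have h1 := hCv (leg u a) g hgm
  rw [← volume_preserving_pairLegs.lintegral_comp hgm, ← volume_preserving_pairLegs.lintegral_comp
    (f := fun x => legWeight β (leg u a) x * g x ^ 2)
    ((measurable_legWeight β _).mul (hgm.pow_const 2))] at h1
  simp_rw [hgp] at h1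
  calc sqWeight β' u * (∫⁻ q, ‖φ (insertPair a u q)‖ₑ) ^ 2
      = restWeight β' a u * (jap β' (leg u a) * (∫⁻ q, ‖φ (insertPair a u q)‖ₑ) ^ 2) := by
        rw [sqWeight_eq β' a, mul_assoc]
    _ ≤ restWeight β a u * (C * ∫⁻ q, legWeight β (leg u a) (pairLegs q) *
          ‖φ (insertPair a u q)‖ₑ ^ 2) :=
        mul_le_mul' (restWeight_mono (by linarith) a u) h1
    _ = C * ∫⁻ q, sqWeight β (insertPair a u q) * ‖φ (insertPair a u q)‖ₑ ^ 2 := by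
        rw [mul_left_comm, ← lintegral_const_mul' _ _
          (restWeight_ne_top _ _ _)]
        congr 1
        refine lintegral_congr fun q => ?_
        rw [sqWeight_insertPair, mul_assoc]

theorem Nice.ae_lintegral_lt_top {φ : Ker (k + 2)} (h : Nice φ) (a : Particle k) :
    ∀ᵐ u, ∫⁻ q, ‖φ (insertPair a u q)‖ₑ < ∞ := by
  obtain ⟨C, hC, hCφ⟩ := exists_lintegral_contraction_le (β := 9 / 10) (β' := 0) le_rfl
    (by norm_num) (by norm_num)
  have h1 := (hCφ k a φ).trans_lt (ENNReal.mul_lt_top hC.lt_top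
    (ENNReal.pow_lt_top (h (9 / 10) (by norm_num))))
  have hm : Measurable fun u => ∫⁻ q, ‖φ (insertPair a u q)‖ₑ :=
    (measurable_comp_insertPair a φ).enorm.lintegral_prod_right'
  filter_upwards [ae_lt_top ((measurable_sqWeight 0).mul (hm.pow_const 2)) h1.ne] with u hu
  have hu' : sqWeight 0 u * (∫⁻ q, ‖φ (insertPair a u q)‖ₑ) ^ 2 < ∞ := hu
  rw [sqWeight_zero, one_mul] at hu'
  by_contra hcon
  rw [not_lt, top_le_iff] at hcon
  rw [hcon] at hu'
  simp at hu'

theorem Nice.ae_integrable {φ : Ker (k + 2)} (h : Nice φ) (a : Particle k) :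
    ∀ᵐ u, Integrable fun q => φ (insertPair a u q) := by
  filter_upwards [h.ae_lintegral_lt_top a] with u hu
  exact ⟨((measurable_comp_insertPair a φ).comp measurable_prodMk_left).aestronglyMeasurable, hu⟩

/-- The integral that defines the contraction on the Fourier side. -/
def contrFun (a : Particle k) (φ : Ker (k + 2)) (u : Conf k) : ℂ := ∫ q, φ (insertPair a u q)

theorem stronglyMeasurable_contrFun (a : Particle k) (φ : Ker (k + 2)) :
    StronglyMeasurable (contrFun a φ) :=
  (measurable_comp_insertPair a φ).stronglyMeasurable.integral_prod_right'

theorem Nice.memLp_contrFun {φ : Ker (k + 2)} (h : Nice φ) (a : Particle k) :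
    MemLp (contrFun a φ) 2 := by
  obtain ⟨C, hC, hCφ⟩ := exists_lintegral_contraction_le (β := 9 / 10) (β' := 0) le_rfl
    (by norm_num) (by norm_num)
  have h1 := (hCφ k a φ).trans_lt (ENNReal.mul_lt_top hC.lt_top
    (ENNReal.pow_lt_top (h (9 / 10) (by norm_num))))
  refine ⟨(stronglyMeasurable_contrFun a φ).aestronglyMeasurable, ?_⟩
  have h2 : eLpNorm (contrFun a φ) 2 volume ^ 2 < ∞ := by
    rw [eLpNorm_two_sq]
    refine lt_of_le_of_lt (lintegral_mono fun u => ?_) h1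
    rw [sqWeight_zero, one_mul]
    exact pow_le_pow_left' (enorm_integral_le_lintegral_enorm _) 2
  by_contra hcon
  rw [not_lt, top_le_iff] at hcon
  rw [hcon] at h2
  simp at h2

open Classical in
/-- The contraction at the variable `a` on the Fourier side. -/
def contr (a : Particle k) (φ : Ker (k + 2)) : Ker k :=
  if h : MemLp (contrFun a φ) 2 volume then h.toLp else 0

theorem Nice.contr_ae {φ : Ker (k + 2)} (h : Nice φ) (a : Particle k) :
    contr a φ =ᵐ[volume] contrFun a φ := by
  rw [contr, dif_pos (h.memLp_contrFun a)]
  exact MemLp.coeFn_toLp _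

theorem hasContraction_of_nice {f : Ker (k + 2)} (h : Nice (𝓕 f : Ker (k + 2))) (a : Particle k) :
    HasContraction a f :=
  ⟨h.ae_integrable a, h.memLp_contrFun a⟩

theorem fourier_contraction {f : Ker (k + 2)} (h : Nice (𝓕 f : Ker (k + 2))) (a : Particle k) :
    (𝓕 (contraction a f) : Ker k) = contr a (𝓕 f) := by
  rw [contraction, dif_pos (hasContraction_of_nice h a), FourierTransform.fourier_fourierInv_eq,
    contr, dif_pos (h.memLp_contrFun a)]
  rfl

theorem exists_nrm_contr_le {β β' : ℝ} (hβ' : 0 ≤ β') (h : β' < 5 * β - 4) (hβ : β ≤ 1) :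
    ∃ C : ℝ≥0∞, C ≠ ∞ ∧ ∀ (k : ℕ) (a : Particle k) (φ : Ker (k + 2)), Nice φ →
      nrm β' (contr a φ) ≤ C * nrm β φ := by
  obtain ⟨C, hC, hCφ⟩ := exists_lintegral_contraction_le hβ' h hβ
  refine ⟨C ^ (1 / 2 : ℝ), ENNReal.rpow_ne_top_of_nonneg (by norm_num) hC, fun k a φ hφ => ?_⟩
  refine nrm_le_of_sq_le ((le_of_eq (nrm_sq _ _)).trans (le_trans ?_ (hCφ k a φ)))
  refine lintegral_mono_ae ?_
  filter_upwards [hφ.contr_ae a] with u hu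
  rw [hu]
  exact mul_le_mul_right (pow_le_pow_left' (enorm_integral_le_lintegral_enorm _) 2) _

theorem Nice.contr_nice {φ : Ker (k + 2)} (h : Nice φ) (a : Particle k) : Nice (contr a φ) := by
  intro β hβ
  have hb : max β 0 < 1 := max_lt hβ one_pos
  have h2 : (max β 0 + 5) / 6 < 1 := by linarith
  obtain ⟨C, hC, hCφ⟩ := exists_nrm_contr_le (β := (max β 0 + 5) / 6) (β' := max β 0)
    (le_max_right _ _) (by linarith) h2.le
  exact (nrm_mono (le_max_left β 0) _).trans_lt
    ((hCφ k a φ h).trans_lt (ENNReal.mul_lt_top hC.lt_top (h _ h2)))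

theorem contr_add {φ ψ : Ker (k + 2)} (h : Nice φ) (h' : Nice ψ) (a : Particle k) :
    contr a (φ + ψ) = contr a φ + contr a ψ := by
  refine Lp.ext ?_
  filter_upwards [(h.add h').contr_ae a, h.contr_ae a, h'.contr_ae a,
    Lp.coeFn_add (contr a φ) (contr a ψ), h.ae_integrable a,
    h'.ae_integrable a, ae_insertPair a (Lp.coeFn_add φ ψ)] with u h1 h2 h3 h4 h5 h6 h7
  rw [h1, h4, Pi.add_apply, h2, h3, contrFun, contrFun, contrFun, ← integral_add h5 h6]
  exact integral_congr_ae h7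

theorem contr_smul {φ : Ker (k + 2)} (h : Nice φ) (c : ℂ) (a : Particle k) :
    contr a (c • φ) = c • contr a φ := by
  refine Lp.ext ?_
  filter_upwards [(h.smul c).contr_ae a, h.contr_ae a,
    Lp.coeFn_smul c (contr a φ), ae_insertPair a (Lp.coeFn_smul c φ)] with u h1 h2 h4 h7
  rw [h1, h4, Pi.smul_apply, h2, contrFun, contrFun, smul_eq_mul, ← integral_const_mul]
  exact integral_congr_ae h7

open Classical in
/-- The contraction at the variable `a` in the interaction picture. -/
def con (a : Particle k) (s : ℝ) (φ : Ker (k + 2)) : Ker k :=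
  if Nice φ then phaseMul (-s) (contr a (phaseMul s φ)) else 0

theorem con_eq {φ : Ker (k + 2)} (h : Nice φ) (a : Particle k) (s : ℝ) :
    con a s φ = phaseMul (-s) (contr a (phaseMul s φ)) := if_pos h

theorem con_of_not_nice {φ : Ker (k + 2)} (h : ¬ Nice φ) (a : Particle k) (s : ℝ) :
    con a s φ = 0 := if_neg h

theorem con_nice (a : Particle k) (s : ℝ) (φ : Ker (k + 2)) : Nice (con a s φ) := by
  by_cases h : Nice φ
  · rw [con_eq h]
    exact ((h.phase s).contr_nice a).phase (-s)
  · rw [con_of_not_nice h]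
    exact nice_zero

theorem con_add {φ ψ : Ker (k + 2)} (h : Nice φ) (h' : Nice ψ) (a : Particle k) (s : ℝ) :
    con a s (φ + ψ) = con a s φ + con a s ψ := by
  simp only [con_eq h, con_eq h', con_eq (h.add h'), map_add, contr_add (h.phase s) (h'.phase s)]

theorem con_smul {φ : Ker (k + 2)} (h : Nice φ) (c : ℂ) (a : Particle k) (s : ℝ) :
    con a s (c • φ) = c • con a s φ := by
  simp only [con_eq h, con_eq (h.smul c), map_smul, contr_smul (h.phase s)]

theorem exists_nrm_con_le {β β' : ℝ} (hβ' : 0 ≤ β') (h : β' < 5 * β - 4) (hβ : β ≤ 1) :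
    ∃ C : ℝ≥0∞, C ≠ ∞ ∧ ∀ (k : ℕ) (a : Particle k) (s : ℝ) (φ : Ker (k + 2)),
      nrm β' (con a s φ) ≤ C * nrm β φ := by
  obtain ⟨C, hC, hCφ⟩ := exists_nrm_contr_le hβ' h hβ
  refine ⟨C, hC, fun k a s φ => ?_⟩
  by_cases hφ : Nice φ
  · rw [con_eq hφ, nrm_phaseMul, ← nrm_phaseMul β s φ]
    exact hCφ k a _ (hφ.phase s)
  · rw [con_of_not_nice hφ, nrm_zero]
    exact zero_le

/-- The integral that defines the contraction in the interaction picture. -/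
def conFun (a : Particle k) (s : ℝ) (φ : Ker (k + 2)) (u : Conf k) : ℂ :=
  ∫ q, Complex.exp ((s * legPhase a (leg u a) q : ℝ) * Complex.I) * φ (insertPair a u q)

theorem measurable_legPhase (a : Particle k) :
    Measurable fun z : Plane × Conf 2 => legPhase a z.1 z.2 := by
  unfold legPhase legEnergy
  have := volume_preserving_pairLegs.measurable
  fun_prop

theorem Nice.con_ae {φ : Ker (k + 2)} (h : Nice φ) (a : Particle k) (s : ℝ) :
    con a s φ =ᵐ[volume] conFun a s φ := by
  filter_upwards [phaseMul_ae (-s) (contr a (phaseMul s φ)), (h.phase s).contr_ae a,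
    ae_insertPair a (phaseMul_ae s φ)] with u h1 h2 h3
  rw [con_eq h, h1, h2, contrFun, conFun, ← integral_const_mul]
  refine integral_congr_ae ?_
  filter_upwards [h3] with q hq
  rw [hq, ← mul_assoc, ← Complex.exp_add, laplacianSymbol_insertPair]
  congr 2
  push_cast
  ring

theorem measurable_phase_mul {X : Type*} [MeasurableSpace X] {f p : X → ℝ} {g : X → ℂ}
    (hf : Measurable f) (hp : Measurable p) (hg : Measurable g) :
    Measurable fun x => Complex.exp ((f x * p x : ℝ) * Complex.I) * g x := by fun_prop

theorem stronglyMeasurable_conFun (a : Particle k) (φ : Ker (k + 2)) :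
    StronglyMeasurable fun z : ℝ × Conf k => conFun a z.1 φ z.2 := by
  have h0 : Measurable fun z : (ℝ × Conf k) × Conf 2 => z.1.2 := by fun_prop
  have h5 : Measurable fun z : (ℝ × Conf k) × Conf 2 => (leg z.1.2 a, z.2) :=
    ((measurable_leg a).comp h0).prodMk
      (measurable_snd : Measurable (Prod.snd : (ℝ × Conf k) × Conf 2 → Conf 2))
  have h1 : Measurable fun z : (ℝ × Conf k) × Conf 2 => legPhase a (leg z.1.2 a) z.2 :=
    Measurable.comp (g := fun w : Plane × Conf 2 => legPhase a w.1 w.2)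
      (f := fun z : (ℝ × Conf k) × Conf 2 => (leg z.1.2 a, z.2)) (measurable_legPhase a) h5
  have h2 : Measurable fun z : (ℝ × Conf k) × Conf 2 => φ (insertPair a z.1.2 z.2) :=
    (measurable_comp_insertPair a φ).comp (h0.prodMk
      (measurable_snd : Measurable (Prod.snd : (ℝ × Conf k) × Conf 2 → Conf 2)))
  have h3 : Measurable fun z : (ℝ × Conf k) × Conf 2 =>
      Complex.exp ((z.1.1 * legPhase a (leg z.1.2 a) z.2 : ℝ) * Complex.I) *
        φ (insertPair a z.1.2 z.2) :=
    measurable_phase_mul (f := fun z : (ℝ × Conf k) × Conf 2 => z.1.1)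
      (measurable_fst.comp measurable_fst) h1 h2
  have h4 := h3.stronglyMeasurable.integral_prod_right' (ν := volume)
  exact h4

/-- The space-time estimate for the contraction along the free evolution. -/
theorem exists_lintegral_nrm_con_sq_le {α : ℝ} (hα : 5 / 6 < α) (hα1 : α < 1) :
    ∃ C : ℝ≥0∞, C ≠ ∞ ∧ ∀ (k : ℕ) (a : Particle k) (φ : Ker (k + 2)),
      ∫⁻ s, nrm α (con a s φ) ^ 2 ≤ C * nrm α φ ^ 2 := by
  obtain ⟨C, hC, hCG⟩ := exists_lintegral_contraction_legs hα hα1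
  refine ⟨C, hC, fun k a φ => ?_⟩
  by_cases hφ : Nice φ
  swap
  · simp [con_of_not_nice hφ]
  have h1 : ∀ s, nrm α (con a s φ) ^ 2 = ∫⁻ u, sqWeight α u * ‖conFun a s φ u‖ₑ ^ 2 := by
    intro s
    rw [nrm_sq]
    refine lintegral_congr_ae ?_
    filter_upwards [hφ.con_ae a s] with u hu
    rw [hu]
  have hm : Measurable fun z : ℝ × Conf k => sqWeight α z.2 * ‖conFun a z.1 φ z.2‖ₑ ^ 2 :=
    ((measurable_sqWeight α).comp measurable_snd).mul
      ((stronglyMeasurable_conFun a φ).measurable.enorm.pow_const 2)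
  simp_rw [h1]
  rw [lintegral_lintegral_swap (f := fun s u => sqWeight α u * ‖conFun a s φ u‖ₑ ^ 2)
    hm.aemeasurable, nrm_sq, ← lintegral_insertPair a (F := fun v => sqWeight α v * ‖φ v‖ₑ ^ 2) ((measurable_sqWeight α).mul
    ((Ker.measurable φ).enorm.pow_const 2)), ← lintegral_const_mul' _ _ hC]
  refine lintegral_mono_ae ?_
  filter_upwards [hφ.ae_integrable a] with u hu
  have hgm : Measurable fun q => φ (insertPair a u q) :=
    (measurable_comp_insertPair a φ).comp measurable_prodMk_left
  let G : (Fin 4 → Plane) → ℂ := fun x => φ (insertPair a u (pairLegsEquiv.symm x))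
  have hG : Measurable G := hgm.comp pairLegsEquiv.symm.measurable
  have hGp : ∀ q, G (pairLegs q) = φ (insertPair a u q) := fun q => by
    show φ (insertPair a u (pairLegsEquiv.symm (pairLegsEquiv q))) = _
    rw [MeasurableEquiv.symm_apply_apply]
  have hemb : MeasurableEmbedding pairLegs := pairLegsEquiv.measurableEmbedding
  have hGi : Integrable G := by
    rw [← volume_preserving_pairLegs.integrable_comp_emb hemb]
    exact hu.congr (Filter.Eventually.of_forall fun q => (hGp q).symm)
  have hk : 1 ≤ |(-(4 * Real.pi ^ 2))| := by
    rw [abs_neg, abs_of_pos (by positivity)]; exact one_le_four_pi_sq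
  have h2 := hCG G hG.stronglyMeasurable hGi (leg u a) (particleSign a) (-(4 * Real.pi ^ 2))
    (particleSign_eq a) hk
  have h3 : ∀ s, ‖∫ x, Complex.exp ((s * (-(4 * Real.pi ^ 2) *
      legEnergy (particleSign a) legSign (leg u a) x) : ℝ) * Complex.I) * G x‖ₑ =
      ‖conFun a s φ u‖ₑ := by
    intro s
    rw [← volume_preserving_pairLegs.integral_comp hemb]
    set c := Complex.exp ((s * (4 * Real.pi ^ 2 * (particleSign a * ∑ c, leg u a c ^ 2)) : ℝ) *
      Complex.I) with hc
    have hcn : ‖c‖ₑ = 1 := by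
      rw [← ofReal_norm, hc, Complex.norm_exp_ofReal_mul_I, ENNReal.ofReal_one]
    rw [← one_mul ‖∫ q, _‖ₑ, ← hcn, ← enorm_mul, ← integral_const_mul, conFun]
    congr 1
    refine integral_congr_ae (Filter.Eventually.of_forall fun q => ?_)
    simp only [hGp]
    rw [← mul_assoc, hc, ← Complex.exp_add, legPhase]
    congr 2
    push_cast
    ring
  simp_rw [h3] at h2
  rw [← volume_preserving_pairLegs.lintegral_comp
    (f := fun x => legWeight α (leg u a) x * ‖G x‖ₑ ^ 2)
    ((measurable_legWeight α _).mul (hG.enorm.pow_const 2))] at h2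
  simp_rw [hGp] at h2
  calc ∫⁻ s, sqWeight α u * ‖conFun a s φ u‖ₑ ^ 2
      = restWeight α a u * (jap α (leg u a) * ∫⁻ s, ‖conFun a s φ u‖ₑ ^ 2) := by
        rw [lintegral_const_mul' _ _ (sqWeight_ne_top _ _), sqWeight_eq α a, mul_assoc]
    _ ≤ restWeight α a u * (C * ∫⁻ q, legWeight α (leg u a) (pairLegs q) *
          ‖φ (insertPair a u q)‖ₑ ^ 2) := mul_le_mul_right h2 _
    _ = C * ∫⁻ q, sqWeight α (insertPair a u q) * ‖φ (insertPair a u q)‖ₑ ^ 2 := by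
        rw [mul_left_comm, ← lintegral_const_mul' _ _
          (restWeight_ne_top _ _ _)]
        congr 1
        refine lintegral_congr fun q => ?_
        rw [sqWeight_insertPair, mul_assoc]

end Contraction

/-! ### Measurability of operations on kernels -/

/-- A weakly measurable map into a separable Hilbert space is measurable. -/
theorem measurable_of_measurable_inner {X E : Type*} [MeasurableSpace X] [NormedAddCommGroup E]
    [InnerProductSpace ℂ E] [TopologicalSpace.SeparableSpace E] [MeasurableSpace E] [BorelSpace E]
    {F : X → E} (hF : ∀ f : E, Measurable fun x => inner ℂ f (F x)) : Measurable F := by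
  obtain ⟨d, hd⟩ := TopologicalSpace.exists_dense_seq E
  have hball : ∀ (y : E) (r : ℝ), 0 < r → MeasurableSet (F ⁻¹' Metric.closedBall y r) := by
    intro y r hr
    have h : F ⁻¹' Metric.closedBall y r =
        ⋂ m, {x | ‖inner ℂ (d m) (F x) - inner ℂ (d m) y‖ ≤ ‖d m‖ * r} := by
      ext x
      simp only [mem_preimage, mem_closedBall_iff_norm, mem_iInter, mem_ofPred_eq, ← inner_sub_right]
      constructor
      · intro h m
        exact (norm_inner_le_norm _ _).trans (mul_le_mul_of_nonneg_left h (norm_nonneg _))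
      · intro h
        have hc : ∀ e : E, ‖inner ℂ e (F x - y)‖ ≤ ‖e‖ * r := by
          intro e
          refine hd.induction_on (p := fun e => ‖inner ℂ e (F x - y)‖ ≤ ‖e‖ * r) e ?_ h
          exact isClosed_le (by fun_prop) (by fun_prop)
        have h1 := hc (F x - y)
        rw [inner_self_eq_norm_sq_to_K] at h1
        rcases (norm_nonneg (F x - y)).eq_or_lt with h0 | h0
        · rw [← h0]; exact hr.le
        · simp at h1
          nlinarith
    rw [h]
    exact MeasurableSet.iInter fun m => measurableSet_le ((hF _).sub_const _).norm measurable_const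
  refine measurable_of_isOpen fun U hU => ?_
  have h : F ⁻¹' U = ⋃ (n : ℕ) (r : ℚ) (_ : (0 : ℝ) < r ∧ Metric.closedBall (d n) r ⊆ U),
      F ⁻¹' Metric.closedBall (d n) r := by
    ext x
    simp only [mem_preimage, mem_iUnion, exists_prop]
    constructor
    · intro hx
      obtain ⟨ε, hε, hεU⟩ := Metric.isOpen_iff.1 hU _ hx
      obtain ⟨r, hr, hr'⟩ := exists_rat_btwn (half_pos hε)
      obtain ⟨n, hn⟩ := hd.exists_dist_lt (F x) hr
      refine ⟨n, r, ⟨dist_nonneg.trans_lt hn, fun z hz => hεU ?_⟩, hn.le⟩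
      have h1 : dist z (d n) ≤ r := hz
      have h2 := dist_triangle z (d n) (F x)
      rw [dist_comm (d n)] at h2
      rw [Metric.mem_ball]
      linarith
    · rintro ⟨n, r, h1, h2⟩
      exact h1.2 h2
  rw [h]
  exact MeasurableSet.iUnion fun n => MeasurableSet.iUnion fun r => MeasurableSet.iUnion fun h =>
    hball _ _ h.1

variable {k : ℕ}

instance instMeasurableSpaceKer : MeasurableSpace (Ker k) := borel _

instance instBorelSpaceKer : BorelSpace (Ker k) := ⟨rfl⟩

instance instFactTwoNeTop : Fact ((2 : ℝ≥0∞) ≠ ∞) := ⟨by norm_num⟩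

/-- Dominated convergence for multiplication operators. -/
theorem tendsto_lintegral_sqWeight_mul {ι : Type*} {l : Filter ι} [l.IsCountablyGenerated]
    {β : ℝ} {φ : Ker k} (hφ : nrm β φ < ∞) {m : ι → Conf k → ℂ} (hm : ∀ i, Measurable (m i))
    (hb : ∀ i u, ‖m i u‖ ≤ 2) (h0 : ∀ u, Filter.Tendsto (fun i => m i u) l (nhds 0)) :
    Filter.Tendsto (fun i => ∫⁻ u, sqWeight β u * ‖m i u * φ u‖ₑ ^ 2) l (nhds 0) := by
  have h := tendsto_lintegral_filter_of_dominated_convergence (μ := (volume : Measure (Conf k)))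
    (l := l) (F := fun i u => sqWeight β u * ‖m i u * φ u‖ₑ ^ 2) (f := fun _ => 0)
    (fun u => 4 * (sqWeight β u * ‖φ u‖ₑ ^ 2)) ?_ ?_ ?_ ?_
  · simpa using h
  · exact Filter.Eventually.of_forall fun i => (measurable_sqWeight β).mul
      (((hm i).mul (Ker.measurable φ)).enorm.pow_const 2)
  · refine Filter.Eventually.of_forall fun i => Filter.Eventually.of_forall fun u => ?_
    have h1 : ‖m i u‖ₑ ≤ 2 := by
      rw [← ofReal_norm, ← ENNReal.ofReal_ofNat 2]
      exact ENNReal.ofReal_le_ofReal (hb i u)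
    calc sqWeight β u * ‖m i u * φ u‖ₑ ^ 2 ≤ sqWeight β u * (2 * ‖φ u‖ₑ) ^ 2 := by
          rw [enorm_mul]; gcongr
      _ = 4 * (sqWeight β u * ‖φ u‖ₑ ^ 2) := by ring
  · rw [lintegral_const_mul' _ _ (by norm_num), ← nrm_sq]
    exact ENNReal.mul_ne_top (by norm_num) (ENNReal.pow_lt_top hφ).ne
  · refine Filter.Eventually.of_forall fun u => ?_
    have h1 : Filter.Tendsto (fun i => ‖m i u * φ u‖ₑ) l (nhds 0) := by
      have := ((h0 u).mul_const (φ u)).enorm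
      simpa using this
    have h2 : Filter.Tendsto (fun i => ‖m i u * φ u‖ₑ ^ 2) l (nhds 0) := by
      have := ENNReal.Tendsto.pow (n := 2) h1
      simpa using this
    have h3 := ENNReal.Tendsto.const_mul h2 (Or.inr (sqWeight_ne_top β u))
    simpa using h3

theorem tendsto_nrm_of_ae {ι : Type*} {l : Filter ι} [l.IsCountablyGenerated]
    {β : ℝ} {φ : Ker k} (hφ : nrm β φ < ∞) {m : ι → Conf k → ℂ} (hm : ∀ i, Measurable (m i))
    (hb : ∀ i u, ‖m i u‖ ≤ 2) (h0 : ∀ u, Filter.Tendsto (fun i => m i u) l (nhds 0))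
    {ψ : ι → Ker k} (hψ : ∀ i, ψ i =ᵐ[volume] fun u => m i u * φ u) :
    Filter.Tendsto (fun i => nrm β (ψ i)) l (nhds 0) := by
  have h1 : ∀ i, nrm β (ψ i) = (∫⁻ u, sqWeight β u * ‖m i u * φ u‖ₑ ^ 2) ^ (1 / 2 : ℝ) := by
    intro i
    have h2 : ∫⁻ u, sqWeight β u * ‖m i u * φ u‖ₑ ^ 2 = nrm β (ψ i) ^ 2 := by
      rw [nrm_sq]
      refine lintegral_congr_ae ?_
      filter_upwards [hψ i] with u hu
      rw [hu]
    rw [h2, ← ENNReal.rpow_natCast, ← ENNReal.rpow_mul]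
    norm_num
  simp_rw [h1]
  have h3 := (tendsto_lintegral_sqWeight_mul hφ hm hb h0).ennrpow_const (1 / 2 : ℝ)
  simpa using h3

theorem continuous_phaseMul (φ : Ker k) : Continuous fun s => phaseMul s φ := by
  rw [continuous_iff_continuousAt]
  intro s₀
  have h0 : nrm 0 φ < ∞ := by rw [nrm_zero_exponent]; exact enorm_lt_top
  have h := tendsto_nrm_of_ae (l := nhds s₀) h0
    (m := fun s u => Complex.exp ((s * laplacianSymbol u : ℝ) * Complex.I) -
      Complex.exp ((s₀ * laplacianSymbol u : ℝ) * Complex.I))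
    (ψ := fun s => phaseMul s φ - phaseMul s₀ φ)
    (fun s => (measurable_phase s).sub (measurable_phase s₀)) (fun s u => ?_) (fun u => ?_)
    fun s => ?_
  · rw [ContinuousAt, tendsto_iff_edist_tendsto_0]
    simp_rw [nrm_zero_exponent] at h
    simpa [edist_eq_enorm_sub] using h
  · refine (norm_sub_le _ _).trans ?_
    rw [Complex.norm_exp_ofReal_mul_I, Complex.norm_exp_ofReal_mul_I]
    norm_num
  · have hc : Continuous fun s : ℝ => Complex.exp ((s * laplacianSymbol u : ℝ) * Complex.I) -
        Complex.exp ((s₀ * laplacianSymbol u : ℝ) * Complex.I) := by fun_prop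
    have := hc.tendsto s₀
    simpa using this
  · filter_upwards [Lp.coeFn_sub (phaseMul s φ) (phaseMul s₀ φ), phaseMul_ae s φ,
      phaseMul_ae s₀ φ] with u h1 h2 h3
    rw [h1, Pi.sub_apply, h2, h3, sub_mul]

theorem measurable_phaseMul : Measurable fun z : ℝ × Ker k => phaseMul z.1 z.2 :=
  measurable_uncurry_of_continuous_of_measurable (u := fun (s : ℝ) (φ : Ker k) => phaseMul s φ)
    (fun φ => continuous_phaseMul φ) fun s => (phaseMul s).continuous.measurable

/-- The cutoff of the Sobolev weight. -/
def cutWeight (β : ℝ) (n : ℕ) (u : Conf k) : ℂ :=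
  if sobolevWeight β u ≤ n then ((sobolevWeight β u / n : ℝ) : ℂ) else 0

theorem measurable_cutWeight (β : ℝ) (n : ℕ) : Measurable (cutWeight (k := k) β n) :=
  Measurable.ite (measurableSet_le (measurable_sobolevWeight β) measurable_const)
    (Complex.measurable_ofReal.comp ((measurable_sobolevWeight β).div_const _)) measurable_const

theorem norm_cutWeight_le (β : ℝ) (n : ℕ) (u : Conf k) : ‖cutWeight β n u‖ ≤ 1 := by
  unfold cutWeight
  split_ifs with h
  · have h0 := sobolevWeight_pos β u
    rw [Complex.norm_real, Real.norm_of_nonneg (by positivity)]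
    exact div_le_one_of_le₀ h (by positivity)
  · simp

theorem sq_mul_enorm_cutWeight_sq {β : ℝ} {n : ℕ} {u : Conf k} (h : sobolevWeight β u ≤ n) :
    (n : ℝ≥0∞) ^ 2 * ‖cutWeight β n u‖ₑ ^ 2 = sqWeight β u := by
  have hn0 : (0 : ℝ) < n := (sobolevWeight_pos β u).trans_le h
  have h2 : (n : ℝ≥0∞) = ‖((n : ℝ) : ℂ)‖ₑ := by
    rw [← ofReal_norm, Complex.norm_real, Real.norm_of_nonneg hn0.le, ENNReal.ofReal_natCast]
  rw [cutWeight, if_pos h, h2, ← mul_pow, ← enorm_mul, ← Complex.ofReal_mul,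
    mul_div_cancel₀ _ hn0.ne', enorm_sobolevWeight_sq]

theorem iSup_enorm_cutWeight (β : ℝ) (u : Conf k) :
    ⨆ n : ℕ, (n : ℝ≥0∞) ^ 2 * ‖cutWeight β n u‖ₑ ^ 2 = sqWeight β u := by
  have hn := fun n : ℕ => sq_mul_enorm_cutWeight_sq (β := β) (n := n) (u := u)
  refine le_antisymm (iSup_le fun n => ?_) ?_
  · by_cases h : sobolevWeight β u ≤ n
    · exact (hn n h).le
    · simp [cutWeight, h]
  · obtain ⟨n, h⟩ := exists_nat_ge (sobolevWeight β u)
    exact (hn n h).symm.le.trans (le_iSup (fun n : ℕ => (n : ℝ≥0∞) ^ 2 * ‖cutWeight β n u‖ₑ ^ 2) n)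

theorem monotone_enorm_cutWeight (β : ℝ) (u : Conf k) :
    Monotone fun n : ℕ => (n : ℝ≥0∞) ^ 2 * ‖cutWeight β n u‖ₑ ^ 2 := by
  have hn := fun n : ℕ => sq_mul_enorm_cutWeight_sq (β := β) (n := n) (u := u)
  intro n m hnm
  by_cases h : sobolevWeight β u ≤ n
  · exact ((hn n h).trans (hn m (h.trans (by exact_mod_cast hnm))).symm).le
  · simp [cutWeight, h]

/-- The operator of multiplication by the cutoff of the Sobolev weight. -/
def cutOp (β : ℝ) (n : ℕ) : Ker k →L[ℂ] Ker k :=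
  mulOp (cutWeight β n) (measurable_cutWeight β n) (norm_cutWeight_le β n)

theorem nrm_eq_iSup (β : ℝ) (φ : Ker k) : nrm β φ = ⨆ n : ℕ, (n : ℝ≥0∞) * ‖cutOp β n φ‖ₑ := by
  have h1 : ∀ n : ℕ, ((n : ℝ≥0∞) * ‖cutOp β n φ‖ₑ) ^ 2 =
      ∫⁻ u, (n : ℝ≥0∞) ^ 2 * ‖cutWeight β n u‖ₑ ^ 2 * ‖φ u‖ₑ ^ 2 := by
    intro n
    rw [mul_pow, ← nrm_zero_exponent, nrm_sq, ← lintegral_const_mul' _ _ (by simp)]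
    refine lintegral_congr_ae ?_
    filter_upwards [mulOp_ae (cutWeight β n) (measurable_cutWeight β n) (norm_cutWeight_le β n) φ]
      with u hu
    rw [cutOp, hu, sqWeight_zero, one_mul, enorm_mul, mul_pow, mul_assoc]
  have h2 : nrm β φ ^ 2 = ⨆ n : ℕ, ((n : ℝ≥0∞) * ‖cutOp β n φ‖ₑ) ^ 2 := by
    simp_rw [h1]
    rw [← lintegral_iSup]
    · rw [nrm_sq]
      refine lintegral_congr fun u => ?_
      rw [← ENNReal.iSup_mul, iSup_enorm_cutWeight]
    · intro n
      exact ((measurable_const.mul ((measurable_cutWeight β n).enorm.pow_const 2))).mul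
        ((Ker.measurable φ).enorm.pow_const 2)
    · intro n m hnm u
      exact mul_le_mul_left (monotone_enorm_cutWeight β u hnm) _
  refine le_antisymm ?_ (iSup_le fun n => ?_)
  · refine (ENNReal.pow_le_pow_left_iff two_ne_zero).1 (h2.le.trans (iSup_le fun n => ?_))
    exact pow_le_pow_left' (le_iSup (fun n : ℕ => (n : ℝ≥0∞) * ‖cutOp β n φ‖ₑ) n) 2
  · refine (ENNReal.pow_le_pow_left_iff two_ne_zero).1 (le_trans ?_ h2.ge)
    exact le_iSup (fun n : ℕ => ((n : ℝ≥0∞) * ‖cutOp β n φ‖ₑ) ^ 2) n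

theorem measurable_nrm (β : ℝ) : Measurable (nrm (k := k) β) := by
  have h : nrm (k := k) β = fun φ => ⨆ n : ℕ, (n : ℝ≥0∞) * ‖cutOp β n φ‖ₑ :=
    funext fun φ => nrm_eq_iSup β φ
  rw [h]
  exact Measurable.iSup fun n => (cutOp β n).continuous.measurable.enorm.const_mul _

theorem measurableSet_nice : MeasurableSet {φ : Ker k | Nice φ} := by
  have h : {φ : Ker k | Nice φ} = ⋂ n : ℕ, {φ | nrm (1 - 1 / ((n : ℝ) + 1)) φ < ∞} := by
    ext φ
    simp only [mem_ofPred_eq, mem_iInter]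
    constructor
    · intro h n
      exact h _ (by have : (0 : ℝ) < 1 / ((n : ℝ) + 1) := by positivity
                    linarith)
    · intro h β hβ
      obtain ⟨n, hn⟩ := exists_nat_one_div_lt (sub_pos.2 hβ)
      exact (nrm_mono (by linarith) φ).trans_lt (h n)
  rw [h]
  exact MeasurableSet.iInter fun n => measurableSet_lt (measurable_nrm _) measurable_const

theorem nrm_integral_le {X : Type*} [MeasurableSpace X] {μ : Measure X} (β : ℝ) (F : X → Ker k) :
    nrm β (∫ x, F x ∂μ) ≤ ∫⁻ x, nrm β (F x) ∂μ := by
  by_cases hF : Integrable F μ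
  · rw [nrm_eq_iSup]
    refine iSup_le fun n => ?_
    rw [← ContinuousLinearMap.integral_comp_comm _ hF]
    refine (mul_le_mul_right (enorm_integral_le_lintegral_enorm _) _).trans ?_
    rw [← lintegral_const_mul' _ _ (by simp)]
    refine lintegral_mono fun x => ?_
    rw [nrm_eq_iSup]
    exact le_iSup (fun n : ℕ => (n : ℝ≥0∞) * ‖cutOp β n (F x)‖ₑ) n
  · rw [integral_undef hF, nrm_zero]
    exact zero_le

/-! ### Bounded approximations of the contractions -/

/-- The indicator function of a sublevel set of the energy weight. -/
def cutInd (n : ℕ) (u : Conf k) : ℂ := if sobolevWeight 1 u ≤ n then 1 else 0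

theorem measurable_cutInd (n : ℕ) : Measurable (cutInd (k := k) n) :=
  Measurable.ite (measurableSet_le (measurable_sobolevWeight 1) measurable_const)
    measurable_const measurable_const

theorem norm_cutInd_le (n : ℕ) (u : Conf k) : ‖cutInd n u‖ ≤ 1 := by
  unfold cutInd
  split_ifs <;> simp

/-- The projection to a sublevel set of the energy weight. -/
def cutProj (n : ℕ) : Ker k →L[ℂ] Ker k :=
  mulOp (cutInd n) (measurable_cutInd n) (norm_cutInd_le n)

theorem cutProj_ae (n : ℕ) (φ : Ker k) : cutProj n φ =ᵐ[volume] fun u => cutInd n u * φ u :=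
  mulOp_ae _ _ _ _

theorem nrm_cutProj_le (β : ℝ) (n : ℕ) (φ : Ker k) : nrm β (cutProj n φ) ≤ nrm β φ := by
  have := nrm_le_of_sq_le (β := β) (β' := β) (φ := cutProj n φ) (ψ := φ) (C := 1) (by
    rw [nrm_sq, nrm_sq, one_mul]
    refine lintegral_mono_ae ?_
    filter_upwards [cutProj_ae n φ] with u hu
    rw [hu]
    refine mul_le_mul_right (pow_le_pow_left' ?_ 2) _
    rw [enorm_mul]
    refine mul_le_of_le_one_left' ?_
    rw [← ofReal_norm, ← ENNReal.ofReal_one]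
    exact ENNReal.ofReal_le_ofReal (norm_cutInd_le n u))
  simpa using this

theorem nrm_one_cutProj_le (n : ℕ) (φ : Ker k) : nrm 1 (cutProj n φ) ≤ n * ‖φ‖ₑ := by
  rw [← nrm_zero_exponent]
  have := nrm_le_of_sq_le (β := 1) (β' := 0) (φ := cutProj n φ) (ψ := φ) (C := (n : ℝ≥0∞) ^ 2) (by
    rw [nrm_sq, nrm_sq, ← lintegral_const_mul' _ _ (by simp)]
    refine lintegral_mono_ae ?_
    filter_upwards [cutProj_ae n φ] with u hu
    rw [hu, sqWeight_zero, one_mul, ← enorm_sobolevWeight_sq, ← mul_pow, ← mul_pow]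
    refine pow_le_pow_left' ?_ 2
    rw [enorm_mul, ← mul_assoc]
    refine mul_le_mul_left ?_ _
    unfold cutInd
    split_ifs with h
    · rw [enorm_one, mul_one, ← ofReal_norm, Complex.norm_real,
        Real.norm_of_nonneg (sobolevWeight_pos 1 u).le, ← ENNReal.ofReal_natCast]
      exact ENNReal.ofReal_le_ofReal h
    · simp)
  rw [← ENNReal.rpow_natCast, ← ENNReal.rpow_mul] at this
  norm_num at this
  exact this

theorem cutProj_nice (n : ℕ) (φ : Ker k) : Nice (cutProj n φ) :=
  nice_of_nrm_one ((nrm_one_cutProj_le n φ).trans_lt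
    (ENNReal.mul_lt_top (by simp) enorm_lt_top))

theorem tendsto_nrm_sub_cutProj {β : ℝ} {φ : Ker k} (hφ : nrm β φ < ∞) :
    Filter.Tendsto (fun n => nrm β (φ - cutProj n φ)) Filter.atTop (nhds 0) := by
  refine tendsto_nrm_of_ae hφ (m := fun n u => 1 - cutInd n u)
    (fun n => measurable_const.sub (measurable_cutInd n)) (fun n u => ?_) (fun u => ?_) fun n => ?_
  · refine (norm_sub_le _ _).trans ?_
    have := norm_cutInd_le n u
    rw [norm_one]
    linarith
  · obtain ⟨N, hN⟩ := exists_nat_ge (sobolevWeight 1 u)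
    refine tendsto_const_nhds.congr' ?_
    filter_upwards [Filter.eventually_ge_atTop N] with n hn
    have : sobolevWeight 1 u ≤ n := hN.trans (by exact_mod_cast hn)
    simp [cutInd, this]
  · filter_upwards [Lp.coeFn_sub φ (cutProj n φ), cutProj_ae n φ] with u h1 h2
    rw [h1, Pi.sub_apply, h2]
    ring

theorem contr_sub {φ ψ : Ker (k + 2)} (h : Nice φ) (h' : Nice ψ) (a : Particle k) :
    contr a (φ - ψ) = contr a φ - contr a ψ := by
  have h1 := contr_add h (h'.smul (-1)) a
  rw [contr_smul h', neg_one_smul, neg_one_smul, ← sub_eq_add_neg, ← sub_eq_add_neg] at h1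
  exact h1

theorem Nice.sub {φ ψ : Ker k} (h : Nice φ) (h' : Nice ψ) : Nice (φ - ψ) := by
  have := h.add (h'.smul (-1))
  rwa [neg_one_smul, ← sub_eq_add_neg] at this

theorem exists_enorm_contr_le : ∃ C : ℝ≥0∞, C ≠ ∞ ∧ ∀ (k : ℕ) (a : Particle k) (φ : Ker (k + 2)),
    Nice φ → ‖contr a φ‖ₑ ≤ C * nrm (9 / 10) φ := by
  obtain ⟨C, hC, h⟩ := exists_nrm_contr_le (β := 9 / 10) (β' := 0) le_rfl (by norm_num)
    (by norm_num)
  refine ⟨C, hC, fun k a φ hφ => ?_⟩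
  rw [← nrm_zero_exponent]
  exact h k a φ hφ

/-- The contraction of the projection to a sublevel set of the energy weight. -/
def cutContr (a : Particle k) (n : ℕ) : Ker (k + 2) →L[ℂ] Ker k :=
  LinearMap.mkContinuousOfExistsBound
    { toFun := fun φ => contr a (cutProj n φ)
      map_add' := fun φ ψ => by
        rw [map_add, contr_add (cutProj_nice n φ) (cutProj_nice n ψ)]
      map_smul' := fun c φ => by
        rw [map_smul, contr_smul (cutProj_nice n φ), RingHom.id_apply] } <| by
    obtain ⟨C, hC, h⟩ := exists_enorm_contr_le
    refine ⟨(C * n).toReal, fun φ => ?_⟩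
    have h1 : ‖contr a (cutProj n φ)‖ₑ ≤ C * n * ‖φ‖ₑ := by
      refine (h k a _ (cutProj_nice n φ)).trans ?_
      rw [mul_assoc]
      exact mul_le_mul_right ((nrm_mono (by norm_num) _).trans (nrm_one_cutProj_le n φ)) _
    have h2 := ENNReal.toReal_mono (ENNReal.mul_ne_top (ENNReal.mul_ne_top hC (by simp))
      enorm_ne_top) h1
    rw [ENNReal.toReal_mul, toReal_enorm, toReal_enorm] at h2
    exact h2

theorem cutContr_apply (a : Particle k) (n : ℕ) (φ : Ker (k + 2)) :
    cutContr a n φ = contr a (cutProj n φ) := rfl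

theorem tendsto_cutContr (a : Particle k) {φ : Ker (k + 2)} (hφ : Nice φ) :
    Filter.Tendsto (fun n => cutContr a n φ) Filter.atTop (nhds (contr a φ)) := by
  obtain ⟨C, hC, h⟩ := exists_enorm_contr_le
  rw [tendsto_iff_edist_tendsto_0]
  have h1 := ENNReal.Tendsto.const_mul (tendsto_nrm_sub_cutProj (hφ (9 / 10) (by norm_num)))
    (Or.inr hC)
  rw [mul_zero] at h1
  refine tendsto_of_tendsto_of_tendsto_of_le_of_le tendsto_const_nhds h1 (fun n => zero_le)
    fun n => ?_
  rw [edist_comm, edist_eq_enorm_sub, cutContr_apply, ← contr_sub hφ (cutProj_nice n φ)]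
  exact h k a _ (hφ.sub (cutProj_nice n φ))

theorem measurable_contr_comp {X : Type*} [MeasurableSpace X] (a : Particle k)
    {F : X → Ker (k + 2)} (hF : Measurable F) (hn : ∀ x, Nice (F x)) :
    Measurable fun x => contr a (F x) :=
  measurable_of_tendsto_metrizable (f := fun n x => cutContr a n (F x))
    (fun n => (cutContr a n).continuous.measurable.comp hF)
    (tendsto_pi_nhds.2 fun x => tendsto_cutContr a (hn x))

theorem measurable_con (a : Particle k) : Measurable fun z : ℝ × Ker (k + 2) => con a z.1 z.2 := by
  have hS : MeasurableSet {z : ℝ × Ker (k + 2) | Nice z.2} := measurable_snd measurableSet_nice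
  refine measurable_of_restrict_of_restrict_compl hS ?_ ?_
  · have h1 : Measurable fun z : {z : ℝ × Ker (k + 2) | Nice z.2} => phaseMul z.1.1 z.1.2 :=
      measurable_phaseMul.comp measurable_subtype_coe
    have h2 := measurable_contr_comp a h1 fun z => Nice.phase z.2 z.1.1
    have h3 := measurable_phaseMul.comp (((measurable_fst.comp
      (measurable_subtype_coe (p := fun z : ℝ × Ker (k + 2) => Nice z.2))).neg).prodMk h2)
    refine (congrArg Measurable (funext fun z => ?_)).mpr h3
    exact con_eq z.2 a _
  · have h : {z : ℝ × Ker (k + 2) | Nice z.2}ᶜ.domRestrict (fun z => con a z.1 z.2) =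
        fun _ => 0 := funext fun z => con_of_not_nice z.2 a _
    rw [h]
    exact measurable_const

/-! ### Families of nice elements and their integrals -/

section Family

variable {k : ℕ} {X : Type*} [MeasurableSpace X] {μ : Measure X}

theorem measurable_con_comp (a : Particle k) {s : X → ℝ} {F : X → Ker (k + 2)}
    (hs : Measurable s) (hF : Measurable F) : Measurable fun x => con a (s x) (F x) :=
  Measurable.comp (g := fun z : ℝ × Ker (k + 2) => con a z.1 z.2) (f := fun x => (s x, F x))
    (measurable_con a) (hs.prodMk hF)

/-- A measurable family that is integrable in all Sobolev norms below the energy norm. -/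
structure NiceFamily (F : X → Ker k) (μ : Measure X) : Prop where
  measurable : Measurable F
  nice : ∀ x, Nice (F x)
  lintegral_lt_top : ∀ β < 1, ∫⁻ x, nrm β (F x) ∂μ < ∞

theorem NiceFamily.integrable {F : X → Ker k} (hF : NiceFamily F μ) : Integrable F μ := by
  refine ⟨hF.measurable.aestronglyMeasurable, ?_⟩
  refine lt_of_le_of_lt (lintegral_mono fun x => ?_) (hF.lintegral_lt_top 0 one_pos)
  rw [nrm_zero_exponent]

theorem NiceFamily.nice_integral {F : X → Ker k} (hF : NiceFamily F μ) : Nice (∫ x, F x ∂μ) :=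
  fun β hβ => (nrm_integral_le β F).trans_lt (hF.lintegral_lt_top β hβ)

theorem NiceFamily.phase {F : X → Ker k} (hF : NiceFamily F μ) (s : ℝ) :
    NiceFamily (fun x => phaseMul s (F x)) μ :=
  ⟨Measurable.comp (g := phaseMul s) (phaseMul s).continuous.measurable hF.measurable, fun x => (hF.nice x).phase s,
    fun β hβ => by simpa using hF.lintegral_lt_top β hβ⟩

theorem NiceFamily.con {F : X → Ker (k + 2)} (hF : NiceFamily F μ) (a : Particle k) (s : ℝ) :
    NiceFamily (fun x => con a s (F x)) μ := by
  refine ⟨measurable_con_comp a measurable_const hF.measurable,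
    fun x => con_nice a s _, fun β hβ => ?_⟩
  have hb : max β 0 < 1 := max_lt hβ one_pos
  have h2 : (max β 0 + 5) / 6 < 1 := by linarith
  obtain ⟨C, hC, hCφ⟩ := exists_nrm_con_le (β := (max β 0 + 5) / 6) (β' := max β 0)
    (le_max_right _ _) (by linarith) h2.le
  calc ∫⁻ x, nrm β (QuinticGP.con a s (F x)) ∂μ
      ≤ ∫⁻ x, C * nrm ((max β 0 + 5) / 6) (F x) ∂μ :=
        lintegral_mono fun x => (nrm_mono (le_max_left β 0) _).trans (hCφ k a s _)
    _ = C * ∫⁻ x, nrm ((max β 0 + 5) / 6) (F x) ∂μ := lintegral_const_mul' _ _ hC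
    _ < ∞ := ENNReal.mul_lt_top hC.lt_top (hF.lintegral_lt_top _ h2)

theorem NiceFamily.contr_integral {F : X → Ker (k + 2)} (hF : NiceFamily F μ) (a : Particle k) :
    contr a (∫ x, F x ∂μ) = ∫ x, contr a (F x) ∂μ := by
  obtain ⟨C, hC, h⟩ := exists_enorm_contr_le
  have h1 := tendsto_cutContr a hF.nice_integral
  have h2 : Filter.Tendsto (fun n => ∫ x, cutContr a n (F x) ∂μ) Filter.atTop
      (nhds (∫ x, contr a (F x) ∂μ)) := by
    refine tendsto_integral_of_dominated_convergence
      (fun x => (C * nrm (9 / 10) (F x)).toReal) (fun n => ?_) ?_ (fun n => ?_) ?_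
    · exact ((cutContr a n).continuous.measurable.comp hF.measurable).aestronglyMeasurable
    · refine integrable_toReal_of_lintegral_ne_top
        (((measurable_nrm _).comp hF.measurable).const_mul _).aemeasurable ?_
      rw [lintegral_const_mul' _ _ hC]
      exact ENNReal.mul_ne_top hC (hF.lintegral_lt_top _ (by norm_num)).ne
    · refine Filter.Eventually.of_forall fun x => ?_
      rw [← toReal_enorm]
      refine ENNReal.toReal_mono (ENNReal.mul_ne_top hC (hF.nice x _ (by norm_num)).ne) ?_
      exact (h k a _ (cutProj_nice n _)).trans (mul_le_mul_right (nrm_cutProj_le _ n _) _)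
    · exact Filter.Eventually.of_forall fun x => tendsto_cutContr a (hF.nice x)
  refine tendsto_nhds_unique h1 ?_
  refine h2.congr fun n => ?_
  exact (cutContr a n).integral_comp_comm hF.integrable

theorem NiceFamily.con_integral {F : X → Ker (k + 2)} (hF : NiceFamily F μ) (a : Particle k)
    (s : ℝ) : QuinticGP.con a s (∫ x, F x ∂μ) = ∫ x, QuinticGP.con a s (F x) ∂μ := by
  simp_rw [con_eq hF.nice_integral, con_eq (hF.nice _)]
  have h1 : Integrable (fun x => contr a (phaseMul s (F x))) μ := by
    have h := ((hF.con a s).phase s).integrable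
    refine h.congr (Filter.Eventually.of_forall fun x => ?_)
    simp only
    rw [con_eq (hF.nice x), ← phaseMul_add, add_neg_cancel, phaseMul_zero]
  rw [(phaseMul (-s)).integral_comp_comm h1, ← (hF.phase s).contr_integral,
    (phaseMul s).integral_comp_comm hF.integrable]

end Family

/-! ### Permutations of the particles -/

section Permutation

variable {k : ℕ}

/-- The permutation of the coordinates that belongs to a permutation of the particles. -/
def coordPerm (σ : Equiv.Perm (Fin k)) : Equiv.Perm (Particle k × Fin 2) :=
  (Equiv.sumCongr σ σ).prodCongr (Equiv.refl _)

/-- `permutePoint` as a linear isometry. -/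
def permuteIsometry (σ : Equiv.Perm (Fin k)) : Conf k ≃ₗᵢ[ℝ] Conf k :=
  LinearIsometryEquiv.piLpCongrLeft 2 ℝ ℝ (coordPerm σ).symm

theorem permuteIsometry_apply (σ : Equiv.Perm (Fin k)) (x : Conf k) :
    permuteIsometry σ x = permutePoint σ x := by
  ext p
  rw [permuteIsometry, LinearIsometryEquiv.piLpCongrLeft_apply]
  rfl

theorem volume_preserving_permutePoint (σ : Equiv.Perm (Fin k)) :
    MeasurePreserving (permutePoint σ) := by
  have h := (permuteIsometry σ).measurePreserving
  exact (congrArg (fun f => MeasurePreserving f volume volume)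
    (funext fun x => permuteIsometry_apply σ x)).mp h

/-- The action of the permutations of the particles on kernels. -/
def permKer (σ : Equiv.Perm (Fin k)) : Ker k →L[ℂ] Ker k :=
  (Lp.compMeasurePreservingₗᵢ ℂ (permutePoint σ)
    (volume_preserving_permutePoint σ)).toContinuousLinearMap

theorem permKer_ae (σ : Equiv.Perm (Fin k)) (φ : Ker k) :
    permKer σ φ =ᵐ[volume] fun u => φ (permutePoint σ u) :=
  Lp.coeFn_compMeasurePreserving φ (volume_preserving_permutePoint σ)

theorem leg_permutePoint (σ : Equiv.Perm (Fin k)) (u : Conf k) (a : Particle k) :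
    leg (permutePoint σ u) a = leg u (Sum.map σ σ a) := rfl

theorem leg_injective : Function.Injective (leg : Conf k → Particle k → Plane) :=
  (legsEquiv k).injective

theorem sqWeight_permutePoint (β : ℝ) (σ : Equiv.Perm (Fin k)) (u : Conf k) :
    sqWeight β (permutePoint σ u) = sqWeight β u :=
  Equiv.prod_comp (Equiv.sumCongr σ σ) fun a => jap β (leg u a)

theorem laplacianSymbol_permutePoint (σ : Equiv.Perm (Fin k)) (u : Conf k) :
    laplacianSymbol (permutePoint σ u) = laplacianSymbol u := by
  rw [laplacianSymbol_eq, laplacianSymbol_eq,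
    ← Equiv.sum_comp (Equiv.sumCongr σ σ) fun a => particleSign a * ∑ c, leg u a c ^ 2]
  congr 1
  refine Finset.sum_congr rfl fun a _ => ?_
  rcases a with a | a <;> rfl

@[simp]
theorem nrm_permKer (β : ℝ) (σ : Equiv.Perm (Fin k)) (φ : Ker k) :
    nrm β (permKer σ φ) = nrm β φ := by
  have h : nrm β (permKer σ φ) ^ 2 = nrm β φ ^ 2 := by
    rw [nrm_sq, nrm_sq, ← (volume_preserving_permutePoint σ).lintegral_comp
      (f := fun u => sqWeight β u * ‖φ u‖ₑ ^ 2)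
      ((measurable_sqWeight β).mul ((Ker.measurable φ).enorm.pow_const 2))]
    refine lintegral_congr_ae ?_
    filter_upwards [permKer_ae σ φ] with u hu
    rw [hu, sqWeight_permutePoint]
  exact le_antisymm ((ENNReal.pow_le_pow_left_iff two_ne_zero).1 h.le)
    ((ENNReal.pow_le_pow_left_iff two_ne_zero).1 h.ge)

theorem nice_permKer {σ : Equiv.Perm (Fin k)} {φ : Ker k} : Nice (permKer σ φ) ↔ Nice φ := by
  simp [Nice]

theorem phaseMul_permKer (s : ℝ) (σ : Equiv.Perm (Fin k)) (φ : Ker k) :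
    phaseMul s (permKer σ φ) = permKer σ (phaseMul s φ) := by
  refine Lp.ext ?_
  filter_upwards [phaseMul_ae s (permKer σ φ), permKer_ae σ φ, permKer_ae σ (phaseMul s φ),
    (volume_preserving_permutePoint σ).quasiMeasurePreserving.ae (phaseMul_ae s φ)]
    with u h1 h2 h3 h4
  rw [h1, h2, h3, h4, laplacianSymbol_permutePoint]

theorem fourier_permKer (σ : Equiv.Perm (Fin k)) (f : Ker k) :
    (𝓕 (permKer σ f) : Ker k) = permKer σ (𝓕 f) := by
  have hd : DenseRange (SchwartzMap.toLpCLM ℝ (E := Conf k) ℂ 2 volume) :=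
    SchwartzMap.denseRange_toLpCLM (by norm_num)
  have hc : Continuous fun f : Ker k => (𝓕 f : Ker k) :=
    FourierTransform.continuous_fourier
  refine congrFun (hd.equalizer (hc.comp (permKer σ).continuous)
    ((permKer σ).continuous.comp hc) (funext fun g => ?_)) f
  let g' : 𝓢(Conf k, ℂ) := SchwartzMap.compCLMOfContinuousLinearEquiv ℝ
    (permuteIsometry σ).toContinuousLinearEquiv g
  have hg' : ∀ x, g' x = g (permutePoint σ x) := fun x => by
    rw [← permuteIsometry_apply]; rfl
  have h1 : permKer σ (g.toLp 2) = g'.toLp 2 := by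
    refine Lp.ext ?_
    filter_upwards [permKer_ae σ (g.toLp 2), g'.coeFn_toLp 2 volume,
      (volume_preserving_permutePoint σ).quasiMeasurePreserving.ae (g.coeFn_toLp 2 volume)]
      with u h1 h2 h3
    rw [h1, h2, h3, hg']
  have h2 : permKer σ ((𝓕 g).toLp 2) = (𝓕 g').toLp 2 := by
    refine Lp.ext ?_
    filter_upwards [permKer_ae σ ((𝓕 g).toLp 2), (𝓕 g').coeFn_toLp 2 volume,
      (volume_preserving_permutePoint σ).quasiMeasurePreserving.ae ((𝓕 g).coeFn_toLp 2 volume)]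
      with u h1 h2 h3
    rw [h1, h2, h3, SchwartzMap.fourier_coe, SchwartzMap.fourier_coe, ← permuteIsometry_apply,
      ← Real.fourier_comp_linearIsometry]
    rfl
  show (𝓕 (permKer σ (g.toLp 2)) : Ker k) = permKer σ (𝓕 (g.toLp 2))
  rw [h1, SchwartzMap.toLp_fourier_eq, SchwartzMap.toLp_fourier_eq, h2]

/-- The extension of a permutation of the particles by the identity on two more particles. -/
def extendPerm (σ : Equiv.Perm (Fin k)) : Equiv.Perm (Fin (k + 2)) :=
  finSumFinEquiv.permCongr (Equiv.sumCongr σ (Equiv.refl (Fin 2)))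

theorem map_extendPerm_old (σ : Equiv.Perm (Fin k)) (b : Particle k) :
    Sum.map (extendPerm σ) (extendPerm σ) (oldParticle b) = oldParticle (Sum.map σ σ b) := by
  rcases b with b | b <;> simp [extendPerm, oldParticle, Equiv.permCongr_apply]

theorem map_extendPerm_new (σ : Equiv.Perm (Fin k)) (b : Particle 2) :
    Sum.map (extendPerm σ) (extendPerm σ) (newParticle b : Particle (k + 2)) = newParticle b := by
  rcases b with b | b <;> simp [extendPerm, newParticle, Equiv.permCongr_apply]

theorem permutePoint_insertPair (σ : Equiv.Perm (Fin k)) (a : Particle k) (u : Conf k)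
    (q : Conf 2) : permutePoint (extendPerm σ) (insertPair (Sum.map σ σ a) u q) =
      insertPair a (permutePoint σ u) q := by
  refine leg_injective (funext fun p => ?_)
  rw [leg_permutePoint, leg_insertPair, leg_insertPair]
  refine particle_cases (P := fun p => joinLegs _ _ (Sum.map (extendPerm σ) (extendPerm σ) p) =
    joinLegs _ _ p) (fun b => ?_) (fun b => ?_) p
  · rw [map_extendPerm_old, joinLegs_old, joinLegs_old, leg_permutePoint]
    have h : Sum.map σ σ b = Sum.map σ σ a ↔ b = a := (Equiv.sumCongr σ σ).injective.eq_iff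
    simp only [h]
  · rw [map_extendPerm_new, joinLegs_new, joinLegs_new]

theorem contr_permKer {φ : Ker (k + 2)} (h : Nice φ) (σ : Equiv.Perm (Fin k)) (a : Particle k) :
    contr (Sum.map σ σ a) (permKer (extendPerm σ) φ) = permKer σ (contr a φ) := by
  refine Lp.ext ?_
  filter_upwards [(nice_permKer.2 h).contr_ae (Sum.map σ σ a), permKer_ae σ (contr a φ),
    (volume_preserving_permutePoint σ).quasiMeasurePreserving.ae (h.contr_ae a),
    ae_insertPair (Sum.map σ σ a) (permKer_ae (extendPerm σ) φ)] with u h1 h2 h3 h4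
  rw [h1, h2, h3, contrFun, contrFun]
  refine integral_congr_ae ?_
  filter_upwards [h4] with q hq
  rw [hq, permutePoint_insertPair]

theorem con_permKer (φ : Ker (k + 2)) (σ : Equiv.Perm (Fin k)) (a : Particle k) (s : ℝ) :
    con (Sum.map σ σ a) s (permKer (extendPerm σ) φ) = permKer σ (con a s φ) := by
  by_cases h : Nice φ
  · rw [con_eq h, con_eq (nice_permKer.2 h), phaseMul_permKer, contr_permKer (h.phase s),
      phaseMul_permKer]
  · rw [con_of_not_nice h, con_of_not_nice (fun h' => h (nice_permKer.1 h')), map_zero]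

end Permutation

/-! ### Contractions at different variables commute -/

section Commute

variable {k : ℕ}

/-- The transposition of the last two pairs of particles. -/
def swapPairs (k : ℕ) : Equiv.Perm (Fin (k + 2 + 2)) :=
  finSumFinEquiv.permCongr <| (Equiv.sumCongr finSumFinEquiv.symm (Equiv.refl (Fin 2))).trans <|
    ((Equiv.sumAssoc _ _ _).trans ((Equiv.sumCongr (Equiv.refl (Fin k)) (Equiv.sumComm _ _)).trans
      (Equiv.sumAssoc _ _ _).symm)).trans (Equiv.sumCongr finSumFinEquiv (Equiv.refl (Fin 2)))

theorem map_swapPairs_old_old (b : Particle k) :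
    Sum.map (swapPairs k) (swapPairs k) (oldParticle (oldParticle b)) =
      oldParticle (oldParticle b) := by
  rcases b with b | b <;> simp [swapPairs, oldParticle, Equiv.permCongr_apply]

theorem map_swapPairs_old_new (b : Particle 2) :
    Sum.map (swapPairs k) (swapPairs k) (oldParticle (newParticle b)) = newParticle b := by
  rcases b with b | b <;> simp [swapPairs, oldParticle, newParticle, Equiv.permCongr_apply]

theorem map_swapPairs_new (b : Particle 2) :
    Sum.map (swapPairs k) (swapPairs k) (newParticle b) = oldParticle (newParticle b) := by
  rcases b with b | b <;> simp [swapPairs, oldParticle, newParticle, Equiv.permCongr_apply]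

theorem oldParticle_injective : Function.Injective (oldParticle (k := k)) :=
  Function.Injective.sumMap (Fin.castAdd_injective k 2) (Fin.castAdd_injective k 2)

theorem newParticle_ne_old (e : Particle 2) (b : Particle k) :
    (newParticle e : Particle (k + 2)) ≠ oldParticle b := by
  rcases e with e | e <;> rcases b with b | b <;> simp [newParticle, oldParticle, Fin.ext_iff] <;>
    omega

theorem permutePoint_insertPair_insertPair {a b : Particle k} (u : Conf k) (q q' : Conf 2) :
    permutePoint (swapPairs k) (insertPair (oldParticle b) (insertPair a u q') q) =
      insertPair (oldParticle a) (insertPair b u q) q' := by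
  refine leg_injective (funext fun p => ?_)
  rw [leg_permutePoint, leg_insertPair, leg_insertPair, leg_insertPair, leg_insertPair]
  refine particle_cases (P := fun p => joinLegs _ _ (Sum.map (swapPairs k) (swapPairs k) p) =
    joinLegs _ _ p) (fun p => ?_) (fun e => ?_) p
  · refine particle_cases (P := fun p => joinLegs _ _ (Sum.map (swapPairs k) (swapPairs k)
      (oldParticle p)) = joinLegs _ _ (oldParticle p)) (fun c => ?_) (fun e => ?_) p
    · rw [map_swapPairs_old_old]
      simp only [joinLegs_old, oldParticle_injective.eq_iff]
      abel
    · rw [map_swapPairs_old_new]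
      simp only [joinLegs_old, joinLegs_new, newParticle_ne_old, if_false, sub_zero]
  · rw [map_swapPairs_new]
    simp only [joinLegs_old, joinLegs_new, newParticle_ne_old, if_false, sub_zero]

theorem legPhase_old (a : Particle k) (v : Plane) (q : Conf 2) :
    legPhase (oldParticle a) v q = legPhase a v q := by
  rcases a with a | a <;> rfl

theorem leg_insertPair_old_of_ne {a b : Particle k} (h : a ≠ b) (u : Conf k) (q : Conf 2) :
    leg (insertPair b u q) (oldParticle a) = leg u a := by
  rw [leg_insertPair, joinLegs_old, if_neg h, sub_zero]

/-- The pointwise absolute value. -/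
def absKer (φ : Ker k) : Ker k := (Lp.memLp φ).norm.ofReal.toLp

theorem absKer_ae (φ : Ker k) : absKer φ =ᵐ[volume] fun u => ((‖φ u‖ : ℝ) : ℂ) :=
  (Lp.memLp φ).norm.ofReal.coeFn_toLp

theorem Nice.abs {φ : Ker k} (h : Nice φ) : Nice (absKer φ) := by
  intro β hβ
  refine lt_of_le_of_lt (le_of_eq (eLpNorm_congr_norm_ae ?_)) (h β hβ)
  filter_upwards [absKer_ae φ] with u hu
  rw [hu, norm_mul, norm_mul, Complex.norm_real ‖φ u‖, norm_norm]

theorem Nice.ae_integrable_prod {φ : Ker (k + 2 + 2)} (h : Nice φ) (a : Particle (k + 2))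
    (b : Particle k) : ∀ᵐ u : Conf k, Integrable (fun z : Conf 2 × Conf 2 =>
      φ (insertPair a (insertPair b u z.1) z.2)) (volume.prod volume) := by
  filter_upwards [(h.abs.contr_nice a).ae_integrable b, ae_insertPair b (h.abs.contr_ae a),
    ae_insertPair b (h.ae_integrable a), ae_insertPair b (ae_insertPair a (absKer_ae φ))]
    with u h1 h2 h3 h4
  have hm : Measurable fun z : Conf 2 × Conf 2 => φ (insertPair a (insertPair b u z.1) z.2) :=
    (measurable_comp_insertPair a φ).comp ((((measurable_insertPair b).comp
      (measurable_const.prodMk measurable_fst))).prodMk measurable_snd)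
  rw [integrable_prod_iff hm.aestronglyMeasurable]
  refine ⟨h3, ?_⟩
  have h5 : Integrable (fun q => (((∫ q', ‖φ (insertPair a (insertPair b u q) q')‖ : ℝ)) : ℂ)) := by
    refine h1.congr ?_
    filter_upwards [h2, h4] with q hq hq'
    rw [hq, contrFun, integral_congr_ae hq']
    exact integral_ofReal
  exact h5.re

theorem con_con_ae {φ : Ker (k + 2 + 2)} (h : Nice φ) (a b : Particle k) (hab : a ≠ b) (s s' : ℝ) :
    con b s (con (oldParticle a) s' φ) =ᵐ[volume] fun u => ∫ q, ∫ q',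
      Complex.exp ((s * legPhase b (leg u b) q : ℝ) * Complex.I) *
        Complex.exp ((s' * legPhase a (leg u a) q' : ℝ) * Complex.I) *
          φ (insertPair (oldParticle a) (insertPair b u q) q') := by
  filter_upwards [(con_nice (oldParticle a) s' φ).con_ae b s,
    ae_insertPair b (h.con_ae (oldParticle a) s')] with u h1 h2
  rw [h1, conFun]
  refine integral_congr_ae ?_
  filter_upwards [h2] with q hq
  rw [hq, conFun, ← integral_const_mul]
  refine integral_congr_ae (Filter.Eventually.of_forall fun q' => ?_)
  simp only
  rw [leg_insertPair_old_of_ne hab, legPhase_old, mul_assoc]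

theorem measurable_phase_mul_phase {X : Type*} [MeasurableSpace X] {f g : X → ℝ} {s s' : ℝ}
    (hf : Measurable f) (hg : Measurable g) :
    Measurable fun x => Complex.exp ((s * f x : ℝ) * Complex.I) *
      Complex.exp ((s' * g x : ℝ) * Complex.I) := by fun_prop

theorem con_comm {a b : Particle k} (hab : a ≠ b) (s s' : ℝ) (φ : Ker (k + 2 + 2)) :
    con b s (con (oldParticle a) s' φ) =
      con a s' (con (oldParticle b) s (permKer (swapPairs k) φ)) := by
  by_cases h : Nice φ
  swap
  · rw [con_of_not_nice h, con_of_not_nice (fun h' => h (nice_permKer.1 h')),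
      con_eq nice_zero, con_eq nice_zero]
    have := con_smul (k := k) nice_zero 0 b s
    have h' := con_smul (k := k) nice_zero 0 a s'
    rw [zero_smul, zero_smul, con_eq nice_zero] at this h'
    rw [this, h']
  have hρ := nice_permKer (σ := swapPairs k).2 h
  refine Lp.ext ?_
  filter_upwards [con_con_ae h a b hab s s', con_con_ae hρ b a hab.symm s' s,
    h.ae_integrable_prod (oldParticle a) b, ae_insertPair a (ae_insertPair (oldParticle b)
      (permKer_ae (swapPairs k) φ))] with u h1 h2 h3 h4
  rw [h1, h2, integral_integral_swap]
  · refine integral_congr_ae ?_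
    filter_upwards [h4] with q' hq'
    refine integral_congr_ae ?_
    filter_upwards [hq'] with q hq
    rw [hq, permutePoint_insertPair_insertPair]
    ring
  · have hm : ∀ c : Particle k, Measurable fun q => legPhase c (leg u c) q := fun c =>
      Measurable.comp (g := fun z : Plane × Conf 2 => legPhase c z.1 z.2)
        (f := fun q => (leg u c, q)) (measurable_legPhase c)
        (measurable_const.prodMk measurable_id)
    refine h3.bdd_mul (c := 1) (Measurable.aestronglyMeasurable ?_)
      (Filter.Eventually.of_forall fun z => ?_)
    · exact measurable_phase_mul_phase (f := fun z : Conf 2 × Conf 2 => legPhase b (leg u b) z.1)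
        (Measurable.comp (g := fun q => legPhase b (leg u b) q) (hm b) measurable_fst)
        (Measurable.comp (g := fun q => legPhase a (leg u a) q) (hm a) measurable_snd)
    · rw [norm_mul, Complex.norm_exp_ofReal_mul_I, Complex.norm_exp_ofReal_mul_I, one_mul]

end Commute

/-! ### Iterated time integrals -/

theorem measurable_lintegral_Ioo {X : Type*} [MeasurableSpace X] {f : X × ℝ → ℝ≥0∞}
    (hf : Measurable f) {τ : X → ℝ} (hτ : Measurable τ) :
    Measurable fun x => ∫⁻ s in Ioo 0 (τ x), f (x, s) := by
  have hS : MeasurableSet {z : X × ℝ | z.2 ∈ Ioo 0 (τ z.1)} :=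
    (measurableSet_lt measurable_const measurable_snd).inter
      (measurableSet_lt measurable_snd (hτ.comp measurable_fst))
  have h := (hf.indicator hS).lintegral_prod_right' (ν := (volume : Measure ℝ))
  refine (congrArg Measurable (funext fun x => ?_)).mpr h
  rw [← lintegral_indicator measurableSet_Ioo]
  rfl

theorem lintegral_triangle_add_le {Φ : ℝ → ℝ → ℝ≥0∞} (hΦ : Measurable fun z : ℝ × ℝ => Φ z.1 z.2)
    (τ : ℝ) : (∫⁻ x in Ioo 0 τ, ∫⁻ y in Ioo 0 x, Φ x y) + ∫⁻ y in Ioo 0 τ, ∫⁻ x in Ioo 0 y, Φ x y ≤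
      ∫⁻ x in Ioo 0 τ, ∫⁻ y in Ioo 0 τ, Φ x y := by
  let Ψ : ℝ × ℝ → ℝ≥0∞ := fun z => Φ z.1 z.2
  have hΨ : Measurable Ψ := hΦ
  let S₁ : Set (ℝ × ℝ) := {z | z.1 ∈ Ioo 0 τ ∧ z.2 ∈ Ioo 0 z.1}
  let S₂ : Set (ℝ × ℝ) := {z | z.2 ∈ Ioo 0 τ ∧ z.1 ∈ Ioo 0 z.2}
  have h1 : MeasurableSet S₁ := by
    simp only [S₁, mem_Ioo]; measurability
  have h2 : MeasurableSet S₂ := by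
    simp only [S₂, mem_Ioo]; measurability
  have m1 : ∀ x y, (x, y) ∈ S₁ ↔ x ∈ Ioo 0 τ ∧ y ∈ Ioo 0 x := fun x y => Iff.rfl
  have m2 : ∀ x y, (x, y) ∈ S₂ ↔ y ∈ Ioo 0 τ ∧ x ∈ Ioo 0 y := fun x y => Iff.rfl
  have e1 : ∫⁻ x in Ioo 0 τ, ∫⁻ y in Ioo 0 x, Φ x y = ∫⁻ x, ∫⁻ y, S₁.indicator Ψ (x, y) := by
    rw [← lintegral_indicator measurableSet_Ioo]
    refine lintegral_congr fun x => ?_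
    by_cases hx : x ∈ Ioo 0 τ
    · rw [indicator_of_mem hx, ← lintegral_indicator measurableSet_Ioo]
      refine lintegral_congr fun y => ?_
      simp only [indicator_apply, m1, hx, true_and, Ψ]
    · simp only [indicator_apply, m1, hx, false_and, if_false, lintegral_zero]
  have e2 : ∫⁻ y in Ioo 0 τ, ∫⁻ x in Ioo 0 y, Φ x y = ∫⁻ x, ∫⁻ y, S₂.indicator Ψ (x, y) := by
    rw [lintegral_lintegral_swap (f := fun x y => S₂.indicator Ψ (x, y))
      (hΨ.indicator h2).aemeasurable, ← lintegral_indicator measurableSet_Ioo]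
    refine lintegral_congr fun y => ?_
    by_cases hy : y ∈ Ioo 0 τ
    · rw [indicator_of_mem hy, ← lintegral_indicator measurableSet_Ioo]
      refine lintegral_congr fun x => ?_
      simp only [indicator_apply, m2, hy, true_and, Ψ]
    · simp only [indicator_apply, m2, hy, false_and, if_false, lintegral_zero]
  rw [e1, e2, ← lintegral_add_left (Measurable.lintegral_prod_right' (hΨ.indicator h1)),
    ← lintegral_indicator measurableSet_Ioo]
  refine lintegral_mono fun x => ?_
  rw [← lintegral_add_left (f := fun y => S₁.indicator Ψ (x, y))
    ((hΨ.indicator h1).comp measurable_prodMk_left)]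
  by_cases hx : x ∈ Ioo 0 τ
  · rw [indicator_of_mem hx, ← lintegral_indicator measurableSet_Ioo]
    refine lintegral_mono fun y => ?_
    by_cases hy : y ∈ Ioo 0 x
    · have hy' : y ∈ Ioo 0 τ := ⟨hy.1, hy.2.trans hx.2⟩
      have hn : ¬ x ∈ Ioo 0 y := fun h => absurd h.2 (not_lt.2 hy.2.le)
      simp [m1, m2, hx, hy, hy', hn, Ψ]
    · by_cases hy' : y ∈ Ioo 0 τ
      · simp only [indicator_apply, m1, m2, hy, hy', and_false, true_and, if_false, if_true,
          zero_add]
        split_ifs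
        · exact le_rfl
        · exact zero_le
      · simp [m1, m2, hy, hy']
  · have hn : ∀ y, ¬ (y ∈ Ioo 0 τ ∧ x ∈ Ioo 0 y) := fun y h => hx ⟨h.2.1, h.2.2.trans h.1.2⟩
    simp only [indicator_apply, m1, m2, hx, hn, false_and, if_false, lintegral_zero, add_zero,
      le_refl]

/-! ### The combinatorial organization of the Duhamel terms -/

/-- The active particle variables after the addition of two particles. -/
def grow {k : ℕ} (P : Finset (Particle k)) : Finset (Particle (k + 2)) :=
  P.image oldParticle ∪ Finset.univ.image newParticle

theorem grow_univ {k : ℕ} : grow (Finset.univ : Finset (Particle k)) = Finset.univ := by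
  ext p
  refine particle_cases (P := fun p => p ∈ grow (Finset.univ : Finset (Particle k)) ↔
    p ∈ Finset.univ) (fun b => ?_) (fun b => ?_) p <;> simp [grow]

theorem mem_grow_old {k : ℕ} {P : Finset (Particle k)} {b : Particle k} :
    oldParticle b ∈ grow P ↔ b ∈ P := by
  simp [grow, oldParticle_injective.eq_iff, newParticle_ne_old]

theorem mem_grow_new {k : ℕ} {P : Finset (Particle k)} (e : Particle 2) :
    newParticle e ∈ grow P := by
  simp [grow]

theorem grow_erase {k : ℕ} (P : Finset (Particle k)) (a : Particle k) :
    grow (P.erase a) = (grow P).erase (oldParticle a) := by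
  ext p
  refine particle_cases (P := fun p => p ∈ grow (P.erase a) ↔ p ∈ (grow P).erase (oldParticle a))
    (fun b => ?_) (fun b => ?_) p
  · simp [mem_grow_old, oldParticle_injective.eq_iff]
  · simp [mem_grow_new, newParticle_ne_old]

theorem card_grow_le {k : ℕ} (P : Finset (Particle k)) : (grow P).card ≤ P.card + 4 := by
  refine (Finset.card_union_le _ _).trans (add_le_add Finset.card_image_le ?_)
  refine Finset.card_image_le.trans ?_
  simp

theorem image_grow {k : ℕ} (P : Finset (Particle k)) (σ : Equiv.Perm (Fin k)) :
    (grow P).image (Sum.map (extendPerm σ) (extendPerm σ)) = grow (P.image (Sum.map σ σ)) := by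
  simp only [grow, Finset.image_union, Finset.image_image]
  congr 1
  · exact congrArg (fun f => Finset.image f P) (funext fun b => map_extendPerm_old σ b)
  · exact congrArg (fun f => Finset.image f Finset.univ) (funext fun b => map_extendPerm_new σ b)

theorem image_swapPairs_grow_grow {k : ℕ} (P : Finset (Particle k)) :
    (grow (grow P)).image (Sum.map (swapPairs k) (swapPairs k)) = grow (grow P) := by
  simp only [grow, Finset.image_union, Finset.image_image]
  have h1 : Sum.map (swapPairs k) (swapPairs k) ∘ oldParticle ∘ oldParticle =
      oldParticle ∘ oldParticle := funext map_swapPairs_old_old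
  have h2 : Sum.map (swapPairs k) (swapPairs k) ∘ oldParticle ∘ newParticle = newParticle :=
    funext map_swapPairs_old_new
  have h3 : Sum.map (swapPairs k) (swapPairs k) ∘ newParticle = oldParticle ∘ newParticle :=
    funext map_swapPairs_new
  rw [h1, h2, h3, Finset.union_assoc, Finset.union_assoc]
  congr 1
  exact Finset.union_comm _ _

/-- The sum over all iterated contractions of `h` at active variables of the integrals of the
functional `N` over decreasing times below `τ`. -/
def board : (n k : ℕ) → Finset (Particle k) → ℝ → (Ker k → ℝ≥0∞) → ((j : ℕ) → Ker j) → ℝ≥0∞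
  | 0, k, _, _, N, h => N (h k)
  | n + 1, k, P, τ, N, h =>
      ∑ b ∈ P, ∫⁻ s in Ioo 0 τ, board n (k + 2) (grow P) s (fun φ => N (con b s φ)) h

theorem board_zero {k : ℕ} (P : Finset (Particle k)) (τ : ℝ) (N : Ker k → ℝ≥0∞)
    (h : (j : ℕ) → Ker j) : board 0 k P τ N h = N (h k) := rfl

theorem board_succ {n k : ℕ} (P : Finset (Particle k)) (τ : ℝ) (N : Ker k → ℝ≥0∞)
    (h : (j : ℕ) → Ker j) : board (n + 1) k P τ N h =
      ∑ b ∈ P, ∫⁻ s in Ioo 0 τ, board n (k + 2) (grow P) s (fun φ => N (con b s φ)) h := rfl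

theorem measurable_functional_con {k : ℕ} {X : Type*} [MeasurableSpace X] {N : X → Ker k → ℝ≥0∞}
    (hN : Measurable fun z : X × Ker k => N z.1 z.2) (b : Particle k) :
    Measurable fun z : (X × ℝ) × Ker (k + 2) => N z.1.1 (con b z.1.2 z.2) :=
  Measurable.comp (g := fun z : X × Ker k => N z.1 z.2)
    (f := fun z : (X × ℝ) × Ker (k + 2) => (z.1.1, con b z.1.2 z.2)) hN
    ((measurable_fst.comp measurable_fst).prodMk
      (measurable_con_comp b (measurable_snd.comp measurable_fst) measurable_snd))

theorem measurable_board (n : ℕ) : ∀ (k : ℕ) (P : Finset (Particle k)) {X : Type}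
    [MeasurableSpace X] {τ : X → ℝ} {N : X → Ker k → ℝ≥0∞} {h : X → (j : ℕ) → Ker j},
    Measurable τ → Measurable (fun z : X × Ker k => N z.1 z.2) →
    (∀ j, Measurable fun x => h x j) → Measurable fun x => board n k P (τ x) (N x) (h x) := by
  induction n with
  | zero =>
    intro k P X _ τ N h hτ hN hh
    exact hN.comp (measurable_id.prodMk (hh k))
  | succ n ih =>
    intro k P X _ τ N h hτ hN hh
    simp only [board_succ]
    refine Finset.measurable_sum _ fun b _ => ?_
    refine measurable_lintegral_Ioo (f := fun z : X × ℝ => board n (k + 2) (grow P) z.2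
      (fun φ => N z.1 (con b z.2 φ)) (h z.1)) ?_ hτ
    exact ih (k + 2) (grow P) (N := fun (z : X × ℝ) φ => N z.1 (con b z.2 φ))
      (h := fun z : X × ℝ => h z.1) measurable_snd (measurable_functional_con hN b)
      fun j => (hh j).comp measurable_fst

theorem lintegral_board (n : ℕ) : ∀ (k : ℕ) (P : Finset (Particle k)) (τ : ℝ) {X : Type}
    [MeasurableSpace X] (μ : Measure X) [SFinite μ] {N : X → Ker k → ℝ≥0∞} (h : (j : ℕ) → Ker j),
    Measurable (fun z : X × Ker k => N z.1 z.2) →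
    ∫⁻ x, board n k P τ (N x) h ∂μ = board n k P τ (fun φ => ∫⁻ x, N x φ ∂μ) h := by
  induction n with
  | zero => intros; rfl
  | succ n ih =>
    intro k P τ X _ μ _ N h hN
    have hm : ∀ b, Measurable fun z : X × ℝ => board n (k + 2) (grow P) z.2
        (fun φ => N z.1 (con b z.2 φ)) h := fun b =>
      measurable_board n (k + 2) (grow P) (N := fun (z : X × ℝ) φ => N z.1 (con b z.2 φ))
        (h := fun _ => h) measurable_snd (measurable_functional_con hN b) fun j => measurable_const
    simp only [board_succ]
    rw [lintegral_finsetSum _ fun b _ =>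
      measurable_lintegral_Ioo (τ := fun _ => τ) (hm b) measurable_const]
    refine Finset.sum_congr rfl fun b _ => ?_
    rw [lintegral_lintegral_swap (f := fun x s => board n (k + 2) (grow P) s
        (fun φ => N x (con b s φ)) h) (hm b).aemeasurable]
    refine lintegral_congr fun s => ?_
    refine ih (k + 2) (grow P) s μ (N := fun x φ => N x (con b s φ)) h ?_
    exact Measurable.comp (g := fun z : X × Ker k => N z.1 z.2)
      (f := fun z : X × Ker (k + 2) => (z.1, con b s z.2)) hN
      (measurable_fst.prodMk (measurable_con_comp b measurable_const measurable_snd))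

/-- A sequence of kernels that is invariant under the permutations of the particles. -/
def Symm (h : (j : ℕ) → Ker j) : Prop := ∀ (j : ℕ) (σ : Equiv.Perm (Fin j)), permKer σ (h j) = h j

theorem board_permKer {h : (j : ℕ) → Ker j} (hh : Symm h) (n : ℕ) :
    ∀ (k : ℕ) (P : Finset (Particle k)) (τ : ℝ) (N : Ker k → ℝ≥0∞) (σ : Equiv.Perm (Fin k)),
      board n k P τ (fun φ => N (permKer σ φ)) h = board n k (P.image (Sum.map σ σ)) τ N h := by
  induction n with
  | zero =>
    intro k P τ N σ
    rw [board_zero, board_zero, hh k σ]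
  | succ n ih =>
    intro k P τ N σ
    rw [board_succ, board_succ, Finset.sum_image
      (show Set.InjOn (Sum.map σ σ) P from (Equiv.sumCongr σ σ).injective.injOn)]
    refine Finset.sum_congr rfl fun b _ => lintegral_congr fun s => ?_
    have h1 : (fun φ => N (permKer σ (con b s φ))) =
        fun φ => N (con (Sum.map σ σ b) s (permKer (extendPerm σ) φ)) :=
      funext fun φ => by rw [con_permKer]
    rw [h1, ← image_grow]
    exact ih (k + 2) (grow P) s (fun φ => N (con (Sum.map σ σ b) s φ)) (extendPerm σ)

theorem board_con_con {h : (j : ℕ) → Ker j} (hh : Symm h) (n : ℕ) {k : ℕ} {a b : Particle k}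
    (hab : a ≠ b) (P : Finset (Particle k)) (τ s s' : ℝ) (N : Ker k → ℝ≥0∞) :
    board n (k + 2 + 2) (grow (grow P)) τ (fun φ => N (con b s (con (oldParticle a) s' φ))) h =
      board n (k + 2 + 2) (grow (grow P)) τ
        (fun φ => N (con a s' (con (oldParticle b) s φ))) h := by
  have h1 : (fun φ => N (con b s (con (oldParticle a) s' φ))) =
      fun φ => N (con a s' (con (oldParticle b) s (permKer (swapPairs k) φ))) :=
    funext fun φ => by rw [con_comm hab]
  rw [h1, board_permKer hh n _ _ τ (fun φ => N (con a s' (con (oldParticle b) s φ))) (swapPairs k),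
    image_swapPairs_grow_grow]

/-- The contractions at an active variable can be taken first. -/
theorem board_split {h : (j : ℕ) → Ker j} (hh : Symm h) (n : ℕ) :
    ∀ (k : ℕ) (P : Finset (Particle k)) (a : Particle k), a ∈ P → ∀ (τ : ℝ) (N : Ker k → ℝ≥0∞),
      Measurable N → board (n + 1) k P τ N h ≤ board (n + 1) k (P.erase a) τ N h +
        ∫⁻ s in Ioo 0 τ, board n (k + 2) (grow P) τ (fun φ => N (con a s φ)) h := by
  induction n with
  | zero =>
    intro k P a ha τ N hN
    rw [board_succ, board_succ, ← Finset.sum_erase_add _ _ ha]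
    rfl
  | succ n ih =>
    intro k P a ha τ N hN
    let Φ : Particle (k + 2) → ℝ → ℝ → ℝ≥0∞ := fun c s' s =>
      board n (k + 2 + 2) (grow (grow P)) s (fun φ => N (con a s' (con c s φ))) h
    have hNc : ∀ b : Particle k, Measurable fun z : ℝ × Ker (k + 2) => N (con b z.1 z.2) :=
      fun b => hN.comp (measurable_con b)
    have hΦ : ∀ c, Measurable fun z : ℝ × ℝ => Φ c z.1 z.2 := fun c =>
      measurable_board n _ _ (N := fun (z : ℝ × ℝ) φ => N (con a z.1 (con c z.2 φ)))
        (h := fun _ => h) measurable_snd (measurable_functional_con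
          (N := fun s φ => N (con a s φ)) (hNc a) c)
        fun j => measurable_const
    have hA : ∀ b ∈ P.erase a, ∫⁻ s in Ioo 0 τ, board (n + 1) (k + 2) (grow P) s
        (fun φ => N (con b s φ)) h ≤
        (∫⁻ s in Ioo 0 τ, board (n + 1) (k + 2) (grow (P.erase a)) s
          (fun φ => N (con b s φ)) h) +
        ∫⁻ s in Ioo 0 τ, ∫⁻ s' in Ioo 0 s, Φ (oldParticle b) s' s := by
      intro b hb
      have hab : a ≠ b := (Finset.ne_of_mem_erase hb).symm
      rw [← lintegral_add_left]
      · refine lintegral_mono fun s => ?_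
        refine (ih (k + 2) (grow P) (oldParticle a) (mem_grow_old.2 ha) s _
          ((hNc b).comp measurable_prodMk_left)).trans (le_of_eq ?_)
        rw [← grow_erase]
        congr 1
        refine lintegral_congr fun s' => ?_
        exact board_con_con hh n hab P s s s' N
      · exact measurable_board (n + 1) _ _ (N := fun (s : ℝ) φ => N (con b s φ))
          (h := fun _ => h) measurable_id (hNc b) fun j => measurable_const
    have hin : ∀ c, Measurable fun s' => ∫⁻ s in Ioo 0 s', Φ c s' s := fun c =>
      measurable_lintegral_Ioo (hΦ c) measurable_id
    have hin' : ∀ c, Measurable fun s' => ∫⁻ s in Ioo 0 τ, Φ c s' s := fun c =>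
      measurable_lintegral_Ioo (τ := fun _ => τ) (hΦ c) measurable_const
    have hB : ∫⁻ s' in Ioo 0 τ, board (n + 1) (k + 2) (grow P) s' (fun φ => N (con a s' φ)) h =
        ∑ c ∈ grow P, ∫⁻ s' in Ioo 0 τ, ∫⁻ s in Ioo 0 s', Φ c s' s := by
      rw [← lintegral_finsetSum _ fun c _ => hin c]
      rfl
    have hC : ∫⁻ s' in Ioo 0 τ, board (n + 1) (k + 2) (grow P) τ (fun φ => N (con a s' φ)) h =
        ∑ c ∈ grow P, ∫⁻ s' in Ioo 0 τ, ∫⁻ s in Ioo 0 τ, Φ c s' s := by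
      rw [← lintegral_finsetSum _ fun c _ => hin' c]
      rfl
    have hD : ∑ b ∈ P.erase a, ∫⁻ s in Ioo 0 τ, ∫⁻ s' in Ioo 0 s, Φ (oldParticle b) s' s ≤
        ∑ c ∈ grow P, ∫⁻ s in Ioo 0 τ, ∫⁻ s' in Ioo 0 s, Φ c s' s := by
      rw [← Finset.sum_image (f := fun c => ∫⁻ s in Ioo 0 τ, ∫⁻ s' in Ioo 0 s, Φ c s' s)
        (oldParticle_injective.injOn)]
      refine Finset.sum_le_sum_of_subset fun c hc => ?_
      obtain ⟨b, hb, rfl⟩ := Finset.mem_image.1 hc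
      exact mem_grow_old.2 (Finset.mem_of_mem_erase hb)
    rw [board_succ, board_succ, ← Finset.sum_erase_add _ _ ha, hB, hC]
    refine (add_le_add ((Finset.sum_le_sum hA).trans (le_of_eq Finset.sum_add_distrib))
      le_rfl).trans ?_
    rw [add_assoc]
    refine add_le_add le_rfl ?_
    refine (add_le_add hD le_rfl).trans ?_
    rw [add_comm, ← Finset.sum_add_distrib]
    exact Finset.sum_le_sum fun c _ => lintegral_triangle_add_le (hΦ c) τ

theorem lintegral_Ioo_nrm_con_le {α : ℝ} {C : ℝ≥0∞}
    (hC : ∀ (k : ℕ) (a : Particle k) (φ : Ker (k + 2)),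
      ∫⁻ s, nrm α (con a s φ) ^ 2 ≤ C * nrm α φ ^ 2)
    (k : ℕ) (a : Particle k) (φ : Ker (k + 2)) (τ : ℝ) :
    ∫⁻ s in Ioo 0 τ, nrm α (con a s φ) ≤ (ENNReal.ofReal τ * C) ^ (1 / 2 : ℝ) * nrm α φ := by
  have hm : Measurable fun s => nrm α (con a s φ) :=
    (measurable_nrm α).comp (measurable_con_comp a measurable_id measurable_const)
  have h1 : (∫⁻ s in Ioo 0 τ, nrm α (con a s φ)) ^ 2 ≤
      (ENNReal.ofReal τ * C) * nrm α φ ^ 2 := by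
    have h2 := lintegral_sq_le (μ := volume.restrict (Ioo 0 τ)) (w := fun _ => 1)
      (g := fun s => nrm α (con a s φ)) measurable_const hm.aemeasurable (by simp) (by simp)
    simp only [one_mul, inv_one, lintegral_one, Measure.restrict_apply_univ, Real.volume_Ioo,
      sub_zero] at h2
    refine h2.trans ?_
    rw [mul_assoc]
    exact mul_le_mul_right ((setLIntegral_le_lintegral _ _).trans (hC k a φ)) _
  have h3 := ENNReal.rpow_le_rpow h1 (show (0 : ℝ) ≤ 1 / 2 by norm_num)
  rw [ENNReal.mul_rpow_of_nonneg _ (nrm α φ ^ 2) (by norm_num), ← ENNReal.rpow_natCast,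
    ← ENNReal.rpow_natCast, ← ENNReal.rpow_mul, ← ENNReal.rpow_mul] at h3
  norm_num at h3 ⊢
  exact h3

theorem board_le {α : ℝ} {D : ℝ≥0∞} {τ : ℝ} (hD : ∀ (k : ℕ) (a : Particle k) (φ : Ker (k + 2)),
      ∫⁻ s in Ioo 0 τ, nrm α (con a s φ) ≤ D * nrm α φ)
    {h : (j : ℕ) → Ker j} (hh : Symm h) (n : ℕ) :
    ∀ (k : ℕ) (P : Finset (Particle k)) (N : Ker k → ℝ≥0∞) (K : ℝ≥0∞), Measurable N →
      (∀ φ, N φ ≤ K * nrm α φ) →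
      board n k P τ N h ≤ 2 ^ (P.card + 5 * n) * D ^ n * K * nrm α (h (k + 2 * n)) := by
  induction n with
  | zero =>
    intro k P N K hN hNK
    rw [board_zero]
    refine (hNK _).trans ?_
    have h1 : (1 : ℝ≥0∞) ≤ 2 ^ (P.card + 5 * 0) := one_le_pow₀ (by norm_num)
    rw [pow_zero, mul_one, mul_assoc]
    exact le_mul_of_one_le_left' h1
  | succ n ih =>
    intro k P
    induction hP : P.card generalizing P with
    | zero =>
      intro N K hN hNK
      rw [Finset.card_eq_zero.1 hP, board_succ, Finset.sum_empty]
      exact zero_le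
    | succ p ihp =>
      intro N K hN hNK
      obtain ⟨a, ha⟩ : P.Nonempty := Finset.card_pos.1 (by omega)
      have hNc : Measurable fun z : ℝ × Ker (k + 2) => N (con a z.1 z.2) :=
        hN.comp (measurable_con a)
      have hcard : (P.erase a).card = p := by rw [Finset.card_erase_of_mem ha]; omega
      have h1 := ihp (P.erase a) hcard N K hN hNK
      have h2 : ∫⁻ s in Ioo 0 τ, board n (k + 2) (grow P) τ (fun φ => N (con a s φ)) h ≤
          2 ^ ((grow P).card + 5 * n) * D ^ n * (K * D) * nrm α (h (k + 2 + 2 * n)) := by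
        rw [lintegral_board n (k + 2) (grow P) τ (volume.restrict (Ioo 0 τ))
          (N := fun s φ => N (con a s φ)) h hNc]
        refine ih (k + 2) (grow P) _ (K * D) (hNc.comp measurable_swap).lintegral_prod_right'
          fun φ => ?_
        have hm : Measurable fun s => nrm α (con a s φ) :=
          (measurable_nrm α).comp (measurable_con_comp a measurable_id measurable_const)
        calc ∫⁻ s in Ioo 0 τ, N (con a s φ) ≤ ∫⁻ s in Ioo 0 τ, K * nrm α (con a s φ) :=
              lintegral_mono fun s => hNK _
          _ = K * ∫⁻ s in Ioo 0 τ, nrm α (con a s φ) := lintegral_const_mul K hm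
          _ ≤ K * (D * nrm α φ) := mul_le_mul_right (hD k a φ) _
          _ = K * D * nrm α φ := (mul_assoc _ _ _).symm
      refine (board_split hh n k P a ha τ N hN).trans ((add_le_add h1 h2).trans ?_)
      have e : k + 2 + 2 * n = k + 2 * (n + 1) := by ring
      rw [e]
      have h3 : (2 : ℝ≥0∞) ^ ((grow P).card + 5 * n) ≤ 2 ^ (p + 5 * (n + 1)) :=
        pow_le_pow_right₀ (by norm_num) (by have := card_grow_le P; omega)
      calc 2 ^ (p + 5 * (n + 1)) * D ^ (n + 1) * K * nrm α (h (k + 2 * (n + 1))) +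
            2 ^ ((grow P).card + 5 * n) * D ^ n * (K * D) * nrm α (h (k + 2 * (n + 1)))
          ≤ 2 ^ (p + 5 * (n + 1)) * D ^ (n + 1) * K * nrm α (h (k + 2 * (n + 1))) +
            2 ^ (p + 5 * (n + 1)) * D ^ n * (K * D) * nrm α (h (k + 2 * (n + 1))) := by gcongr
        _ = 2 ^ (p + 1 + 5 * (n + 1)) * D ^ (n + 1) * K * nrm α (h (k + 2 * (n + 1))) := by
          ring

/-! ### Gauges -/

variable {k : ℕ}

/-- The interaction operator on the Fourier side, in the interaction picture. -/
def conSum (s : ℝ) (φ : Ker (k + 2)) : Ker k :=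
  ∑ j : Fin k, (con (Sum.inl j) s φ - con (Sum.inr j) s φ)

theorem nice_conSum (s : ℝ) (φ : Ker (k + 2)) : Nice (conSum s φ) :=
  Nice.sum fun _ _ => (con_nice _ s φ).sub (con_nice _ s φ)

theorem measurable_conSum_comp {X : Type*} [MeasurableSpace X] {s : X → ℝ} {F : X → Ker (k + 2)}
    (hs : Measurable s) (hF : Measurable F) : Measurable fun x => conSum (s x) (F x) :=
  Finset.measurable_sum _ fun _ _ =>
    (measurable_con_comp _ hs hF).sub (measurable_con_comp _ hs hF)

theorem permKer_conSum (σ : Equiv.Perm (Fin k)) (s : ℝ) {φ : Ker (k + 2)}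
    (h : permKer (extendPerm σ) φ = φ) : permKer σ (conSum s φ) = conSum s φ := by
  unfold conSum
  rw [map_sum]
  simp only [map_sub]
  rw [← Equiv.sum_comp σ fun j => con (Sum.inl j) s φ - con (Sum.inr j) s φ]
  refine Finset.sum_congr rfl fun j _ => ?_
  rw [← con_permKer, ← con_permKer, h]
  rfl

theorem con_sub {φ ψ : Ker (k + 2)} (h : Nice φ) (h' : Nice ψ) (a : Particle k) (s : ℝ) :
    con a s (φ - ψ) = con a s φ - con a s ψ := by
  have h1 := con_add h (h'.smul (-1)) a s
  rw [con_smul h', neg_one_smul, neg_one_smul, ← sub_eq_add_neg, ← sub_eq_add_neg] at h1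
  exact h1

theorem conSum_sub {φ ψ : Ker (k + 2)} (h : Nice φ) (h' : Nice ψ) (s : ℝ) :
    conSum s (φ - ψ) = conSum s φ - conSum s ψ := by
  unfold conSum
  rw [← Finset.sum_sub_distrib]
  refine Finset.sum_congr rfl fun j _ => ?_
  rw [con_sub h h', con_sub h h']
  abel

theorem con_phaseMul (a : Particle k) (s t : ℝ) (φ : Ker (k + 2)) :
    con a s (phaseMul t φ) = phaseMul t (con a (s + t) φ) := by
  by_cases h : Nice φ
  · rw [con_eq h, con_eq (h.phase t), ← phaseMul_add, ← phaseMul_add]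
    congr 2
    ring
  · rw [con_of_not_nice h, con_of_not_nice, map_zero]
    intro h'
    refine h ?_
    have := h'.phase (-t)
    rwa [← phaseMul_add, neg_add_cancel, phaseMul_zero] at this

theorem conSum_phaseMul (s t : ℝ) (φ : Ker (k + 2)) :
    conSum s (phaseMul t φ) = phaseMul t (conSum (s + t) φ) := by
  simp only [conSum, map_sum, map_sub, con_phaseMul]

/-- Measurable seminorms on the nice elements that are compatible with integration. -/
structure Gauge (N : Ker k → ℝ≥0∞) : Prop where
  measurable : Measurable N
  add_le : ∀ φ ψ, Nice φ → Nice ψ → N (φ + ψ) ≤ N φ + N ψ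
  smul_le : ∀ (c : ℂ) φ, Nice φ → N (c • φ) ≤ ‖c‖ₑ * N φ
  integral_le : ∀ (μ : Measure ℝ) (F : ℝ → Ker k), NiceFamily F μ →
    N (∫ x, F x ∂μ) ≤ ∫⁻ x, N (F x) ∂μ

theorem gauge_nrm (β : ℝ) : Gauge (nrm (k := k) β) where
  measurable := measurable_nrm β
  add_le φ ψ _ _ := nrm_add_le β φ ψ
  smul_le c φ _ := (nrm_smul β c φ).le
  integral_le _ F _ := nrm_integral_le β F

theorem Gauge.comp_con {N : Ker k → ℝ≥0∞} (hN : Gauge N) (b : Particle k) (s : ℝ) :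
    Gauge fun φ => N (con b s φ) where
  measurable := hN.measurable.comp (measurable_con_comp b measurable_const measurable_id)
  add_le φ ψ h h' := by
    rw [con_add h h']; exact hN.add_le _ _ (con_nice b s φ) (con_nice b s ψ)
  smul_le c φ h := by
    rw [con_smul h]; exact hN.smul_le _ _ (con_nice b s φ)
  integral_le μ F hF := by
    rw [hF.con_integral b s]; exact hN.integral_le μ _ (hF.con b s)

theorem Gauge.zero {N : Ker k → ℝ≥0∞} (hN : Gauge N) : N 0 = 0 := by
  have := hN.smul_le 0 0 nice_zero
  simpa using this

theorem Gauge.sum_le {N : Ker k → ℝ≥0∞} (hN : Gauge N) {ι : Type*} (s : Finset ι) (φ : ι → Ker k)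
    (hφ : ∀ i, Nice (φ i)) : N (∑ i ∈ s, φ i) ≤ ∑ i ∈ s, N (φ i) := by
  classical
  induction s using Finset.induction with
  | empty => simp [hN.zero]
  | insert i s hi ih =>
    rw [Finset.sum_insert hi, Finset.sum_insert hi]
    exact (hN.add_le _ _ (hφ i) (Nice.sum fun j _ => hφ j)).trans (add_le_add le_rfl ih)

theorem Gauge.sub_le {N : Ker k → ℝ≥0∞} (hN : Gauge N) {φ ψ : Ker k} (h : Nice φ) (h' : Nice ψ) :
    N (φ - ψ) ≤ N φ + N ψ := by
  rw [sub_eq_add_neg, ← neg_one_smul ℂ ψ]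
  refine (hN.add_le _ _ h (h'.smul _)).trans (add_le_add le_rfl ?_)
  refine (hN.smul_le _ _ h').trans (le_of_eq ?_)
  simp

theorem Gauge.conSum_le {N : Ker k → ℝ≥0∞} (hN : Gauge N) (s : ℝ) (φ : Ker (k + 2)) :
    N (conSum s φ) ≤ ∑ b : Particle k, N (con b s φ) := by
  unfold conSum
  refine (hN.sum_le _ _ fun j => (con_nice _ s φ).sub (con_nice _ s φ)).trans ?_
  rw [Fintype.sum_sum_type, ← Finset.sum_add_distrib]
  exact Finset.sum_le_sum fun j _ => hN.sub_le (con_nice _ s φ) (con_nice _ s φ)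

theorem exists_nrm_conSum_le {α : ℝ} (hα : 0 ≤ α) (hα1 : α < 1) :
    ∃ C : ℝ≥0∞, C ≠ ∞ ∧ ∀ (k : ℕ) (s : ℝ) (φ : Ker (k + 2)),
      nrm α (conSum s φ) ≤ (2 * k : ℕ) * C * nrm 1 φ := by
  obtain ⟨C, hC, h⟩ := exists_nrm_con_le (β := 1) hα (by linarith) le_rfl
  refine ⟨C, hC, fun k s φ => ((gauge_nrm α).conSum_le s φ).trans ?_⟩
  refine (Finset.sum_le_sum fun b _ => h k b s φ).trans (le_of_eq ?_)
  rw [Finset.sum_const, Finset.card_univ, Fintype.card_sum, Fintype.card_fin, nsmul_eq_mul,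
    ← two_mul, mul_assoc]

theorem lintegral_board_step {h : ℝ → (j : ℕ) → Ker j} (hh : ∀ j, Measurable fun σ => h σ j)
    (n : ℕ) {N : Ker k → ℝ≥0∞} (hN : Measurable N) (τ : ℝ) :
    ∫⁻ s in Ioo 0 τ, ∑ b : Particle k, ∫⁻ σ in Ioo 0 s,
        board n (k + 2) Finset.univ s (fun φ => N (con b s φ)) (h σ) ≤
      ∫⁻ σ in Ioo 0 τ, board (n + 1) k Finset.univ τ N (h σ) := by
  have hm : ∀ b : Particle k, Measurable fun z : ℝ × ℝ =>
      board n (k + 2) Finset.univ z.1 (fun φ => N (con b z.1 φ)) (h z.2) := fun b =>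
    measurable_board n _ _ (X := ℝ × ℝ) (τ := Prod.fst) (N := fun z φ => N (con b z.1 φ))
      (h := fun z => h z.2) measurable_fst
      (hN.comp (measurable_con_comp b (measurable_fst.comp measurable_fst) measurable_snd))
      fun j => (hh j).comp measurable_snd
  have hm' : ∀ b : Particle k, Measurable fun z : ℝ × ℝ =>
      board n (k + 2) Finset.univ z.2 (fun φ => N (con b z.2 φ)) (h z.1) := fun b =>
    (hm b).comp measurable_swap
  simp only [board_succ, grow_univ]
  rw [lintegral_finsetSum _ fun b _ => measurable_lintegral_Ioo (τ := fun _ => τ) (hm' b)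
    measurable_const, lintegral_finsetSum (f := fun b s => ∫⁻ σ in Ioo 0 s,
      board n (k + 2) Finset.univ s (fun φ => N (con b s φ)) (h σ)) _
      fun b _ => measurable_lintegral_Ioo (τ := fun s => s) (hm b) measurable_id]
  refine Finset.sum_le_sum fun b _ => ?_
  rw [lintegral_lintegral_swap (f := fun σ s => board n (k + 2) Finset.univ s
    (fun φ => N (con b s φ)) (h σ)) (hm' b).aemeasurable]
  refine setLIntegral_mono_ae' measurableSet_Ioo (Filter.Eventually.of_forall fun s hs => ?_)
  exact lintegral_mono_set (Ioo_subset_Ioo_right hs.2.le)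

/-! ### Iterated Duhamel integrands in the interaction picture -/

/-- Time dependent symmetric Fourier transforms with bounded energy. -/
structure Profile (A : ℝ) (g : (k : ℕ) → ℝ → Ker k) : Prop where
  measurable : ∀ k, Measurable (g k)
  bound : ∀ k t, nrm 1 (g k t) ≤ ENNReal.ofReal (A ^ k)
  symm : ∀ t, Symm fun k => g k t

section

variable {A : ℝ} {g : (k : ℕ) → ℝ → Ker k}

theorem Profile.nice (hg : Profile A g) (k : ℕ) (t : ℝ) : Nice (g k t) :=
  nice_of_nrm_one ((hg.bound k t).trans_lt ENNReal.ofReal_lt_top)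

/-- The innermost interaction term of the Duhamel integrands. -/
def source (g : (k : ℕ) → ℝ → Ker k) (σ : ℝ) (k : ℕ) : Ker k := conSum σ (g (k + 2) σ)

theorem Profile.measurable_source (hg : Profile A g) (k : ℕ) :
    Measurable fun σ => source g σ k :=
  measurable_conSum_comp measurable_id (hg.measurable _)

theorem Profile.symm_source (hg : Profile A g) (σ : ℝ) : Symm (source g σ) := fun j π =>
  permKer_conSum π σ (hg.symm σ (j + 2) (extendPerm π))

/-- The Duhamel integrands in the interaction picture. -/
def duh (g : (k : ℕ) → ℝ → Ker k) : (n r : ℕ) → ℝ → (Fin n → ℝ) → Ker r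
  | 0, r, t, _ => g r t
  | n + 1, r, _, s => conSum (s 0) (duh g n (r + 2) (s 0) (Fin.tail s))

theorem Profile.nice_duh (hg : Profile A g) : ∀ (n r : ℕ) (t : ℝ) (s : Fin n → ℝ),
    Nice (duh g n r t s)
  | 0, r, t, _ => hg.nice r t
  | _ + 1, _, _, _ => nice_conSum _ _

theorem measurable_tail {n : ℕ} : Measurable fun s : Fin (n + 1) → ℝ => Fin.tail s :=
  measurable_pi_lambda _ fun _ => measurable_pi_apply _

theorem Profile.measurable_duh (hg : Profile A g) (n : ℕ) : ∀ r : ℕ,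
    Measurable fun z : ℝ × (Fin n → ℝ) => duh g n r z.1 z.2 := by
  induction n with
  | zero => exact fun r => (hg.measurable r).comp measurable_fst
  | succ n ih =>
    intro r
    have h0 : Measurable fun z : ℝ × (Fin (n + 1) → ℝ) => z.2 0 :=
      (measurable_pi_apply 0).comp measurable_snd
    exact measurable_conSum_comp h0 ((ih (r + 2)).comp
      (h0.prodMk (measurable_tail.comp measurable_snd)))

theorem Profile.measurable_duh_right (hg : Profile A g) (n r : ℕ) (t : ℝ) :
    Measurable fun s : Fin n → ℝ => duh g n r t s :=
  Measurable.comp (g := fun z : ℝ × (Fin n → ℝ) => duh g n r z.1 z.2) (f := fun s => (t, s))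
    (hg.measurable_duh n r) measurable_prodMk_left

theorem isClosed_timeSimplex (n : ℕ) (t : ℝ) : IsClosed (timeSimplex n t) := by
  have h : timeSimplex n t = (⋂ i, {s | s i ∈ Icc 0 t}) ∩ ⋂ i, ⋂ j, ⋂ (_ : i ≤ j),
      {s : Fin n → ℝ | s j ≤ s i} := by
    ext s
    simp [timeSimplex, Antitone]
  rw [h]
  refine IsClosed.inter (isClosed_iInter fun i =>
    isClosed_Icc.preimage (continuous_apply i)) ?_
  exact isClosed_iInter fun i => isClosed_iInter fun j => isClosed_iInter fun _ =>
    isClosed_le (continuous_apply j) (continuous_apply i)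

theorem cons_mem_timeSimplex {n : ℕ} {t x : ℝ} {s : Fin n → ℝ} :
    (Fin.cons x s : Fin (n + 1) → ℝ) ∈ timeSimplex (n + 1) t ↔
      x ∈ Icc 0 t ∧ s ∈ timeSimplex n x := by
  constructor
  · rintro ⟨h1, h2⟩
    have h3 : ∀ i, s i ≤ x := fun i => by simpa using h2 (Fin.zero_le i.succ)
    refine ⟨by simpa using h1 0, fun i => ⟨by simpa using (h1 i.succ).1, h3 i⟩, fun i j hij => ?_⟩
    simpa using h2 (Fin.succ_le_succ_iff.2 hij)
  · rintro ⟨h1, h2, h3⟩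
    refine ⟨fun i => ?_, fun i j hij => ?_⟩
    · refine Fin.cases (by simpa using h1) (fun i => ?_) i
      simpa using ⟨(h2 i).1, (h2 i).2.trans h1.2⟩
    · revert hij
      refine Fin.cases (fun hij => ?_) (fun i => ?_) i
      · refine Fin.cases (by simp) (fun j => ?_) j
        simpa using (h2 j).2
      · refine Fin.cases (fun hij => ?_) (fun j hij => ?_) j
        · exact absurd hij (by simp)
        · simpa using h3 (Fin.succ_le_succ_iff.1 hij)

theorem lintegral_timeSimplex_succ {n : ℕ} {t : ℝ} {F : (Fin (n + 1) → ℝ) → ℝ≥0∞}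
    (hF : Measurable F) : ∫⁻ s in timeSimplex (n + 1) t, F s =
      ∫⁻ x in Ioo 0 t, ∫⁻ s in timeSimplex n x, F (Fin.cons x s) := by
  rw [← lintegral_indicator (isClosed_timeSimplex _ _).measurableSet,
    lintegral_insertNth 0 (hF.indicator (isClosed_timeSimplex _ _).measurableSet),
    lintegral_lintegral_swap (α := Fin n → ℝ) (β := ℝ)
      (f := fun y x => (timeSimplex (n + 1) t).indicator F (Fin.insertNth 0 x y)) (((hF.indicator (isClosed_timeSimplex _ _).measurableSet).comp
      (measurable_insertNth 0)).comp measurable_swap).aemeasurable, Measure.restrict_congr_set Ioo_ae_eq_Icc, ← lintegral_indicator measurableSet_Icc]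
  refine lintegral_congr fun x => ?_
  by_cases hx : x ∈ Icc 0 t
  · rw [indicator_of_mem hx, ← lintegral_indicator (isClosed_timeSimplex _ _).measurableSet]
    refine lintegral_congr fun s => ?_
    simp only [Fin.insertNth_zero']
    by_cases hs : s ∈ timeSimplex n x
    · rw [indicator_of_mem hs, indicator_of_mem (cons_mem_timeSimplex.2 ⟨hx, hs⟩)]
    · rw [indicator_of_notMem hs, indicator_of_notMem fun h => hs (cons_mem_timeSimplex.1 h).2]
  · simp only [Fin.insertNth_zero']
    rw [indicator_of_notMem hx]
    refine lintegral_eq_zero_of_ae_eq_zero (Filter.Eventually.of_forall fun s => ?_)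
    exact indicator_of_notMem (fun h => hx (cons_mem_timeSimplex.1 h).1) _

theorem Profile.lintegral_duh_le (hg : Profile A g) (n : ℕ) : ∀ (r : ℕ) (N : Ker r → ℝ≥0∞),
    Gauge N → ∀ t, ∫⁻ s in timeSimplex (n + 1) t, N (duh g (n + 1) r t s) ≤
      ∫⁻ σ in Ioo 0 t, board n r Finset.univ t N (source g σ) := by
  induction n with
  | zero =>
    intro r N hN t
    rw [lintegral_timeSimplex_succ (F := fun s => N (duh g 1 r t s)) 
      (hN.measurable.comp (hg.measurable_duh_right 1 r t))]
    refine lintegral_mono fun x => ?_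
    refine (setLIntegral_le_lintegral _ _).trans ?_
    rw [lintegral_unique]
    simp [duh, board_zero, source, volume_pi]
  | succ n ih =>
    intro r N hN t
    rw [lintegral_timeSimplex_succ (F := fun s => N (duh g (n + 2) r t s)) 
      (hN.measurable.comp (hg.measurable_duh_right (n + 2) r t))]
    refine le_trans (lintegral_mono fun x => ?_)
      (lintegral_board_step hg.measurable_source n hN.measurable t)
    calc ∫⁻ s in timeSimplex (n + 1) x, N (duh g (n + 2) r t (Fin.cons x s))
        ≤ ∫⁻ s in timeSimplex (n + 1) x, ∑ b, N (con b x (duh g (n + 1) (r + 2) x s)) :=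
          lintegral_mono fun s => hN.conSum_le x _
      _ = ∑ b, ∫⁻ s in timeSimplex (n + 1) x, N (con b x (duh g (n + 1) (r + 2) x s)) :=
          lintegral_finsetSum _ fun b _ => hN.measurable.comp (measurable_con_comp b
            measurable_const (hg.measurable_duh_right (n + 1) (r + 2) x))
      _ ≤ _ := Finset.sum_le_sum fun b _ => ih (r + 2) _ (hN.comp_con b x) x

theorem Profile.niceFamily (hg : Profile A g) (k : ℕ) (t : ℝ) :
    NiceFamily (fun s => conSum s (g (k + 2) s)) (volume.restrict (Ioc 0 t)) := by
  refine ⟨hg.measurable_source k, fun s => nice_conSum _ _, fun β hβ => ?_⟩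
  obtain ⟨C, hC, h⟩ := exists_nrm_conSum_le (α := max β 0) (le_max_right _ _) (max_lt hβ one_pos)
  refine lt_of_le_of_lt (lintegral_mono fun s => ((nrm_mono (le_max_left β 0) _).trans
    (h k s _)).trans (mul_le_mul_right (hg.bound (k + 2) s) _)) ?_
  rw [lintegral_const, Measure.restrict_apply_univ, Real.volume_Ioc]
  exact ENNReal.mul_lt_top (ENNReal.mul_lt_top (ENNReal.mul_lt_top
    (ENNReal.natCast_lt_top _) hC.lt_top)
    ENNReal.ofReal_lt_top) ENNReal.ofReal_lt_top

/-- The interaction picture form of the hierarchy with zero initial data. -/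
def SolvesZero (c : ℂ) (T : ℝ) (g : (k : ℕ) → ℝ → Ker k) : Prop :=
  ∀ k, 1 ≤ k → ∀ t ∈ Icc 0 T, g k t = c • ∫ s in Ioc 0 t, conSum s (g (k + 2) s)

theorem Profile.gauge_le_board (hg : Profile A g) {c : ℂ} {T : ℝ} (hs : SolvesZero c T g) (n : ℕ) :
    ∀ (k : ℕ), 1 ≤ k → ∀ (N : Ker k → ℝ≥0∞), Gauge N → ∀ t ∈ Icc 0 T, N (g k t) ≤
      ‖c‖ₑ ^ (n + 1) * ∫⁻ σ in Ioo 0 t, board n k Finset.univ t N (source g σ) := by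
  have h0 : ∀ (k : ℕ), 1 ≤ k → ∀ (N : Ker k → ℝ≥0∞), Gauge N → ∀ t ∈ Icc 0 T, N (g k t) ≤
      ‖c‖ₑ * ∫⁻ s in Ioo 0 t, N (conSum s (g (k + 2) s)) := by
    intro k hk N hN t ht
    have h := hg.niceFamily k t
    rw [hs k hk t ht, Measure.restrict_congr_set Ioo_ae_eq_Ioc]
    refine (hN.smul_le _ _ h.nice_integral).trans ?_
    exact mul_le_mul_right (hN.integral_le _ _ h) _
  induction n with
  | zero =>
    intro k hk N hN t ht
    rw [zero_add, pow_one]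
    exact h0 k hk N hN t ht
  | succ n ih =>
    intro k hk N hN t ht
    refine (h0 k hk N hN t ht).trans ?_
    rw [pow_succ' _ (n + 1), mul_assoc]
    refine mul_le_mul_right ?_ _
    refine le_trans ?_ (mul_le_mul_right
      (lintegral_board_step hg.measurable_source n hN.measurable t) _)
    rw [← lintegral_const_mul' _ _ (ENNReal.pow_ne_top enorm_ne_top)]
    refine setLIntegral_mono_ae' measurableSet_Ioo (Filter.Eventually.of_forall fun s hs' => ?_)
    refine (hN.conSum_le s _).trans ?_
    rw [Finset.mul_sum]
    exact Finset.sum_le_sum fun b _ => ih (k + 2) (by omega) _ (hN.comp_con b s) s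
      ⟨hs'.1.le, hs'.2.le.trans ht.2⟩

end

/-! ### Bounds for the iterated Duhamel terms -/

theorem nat_mul_pow_le {A K c x : ℝ} (hA : 0 < A) (hK : 0 ≤ K) (hc : 0 ≤ c) (hx : 0 ≤ x) (n r : ℕ) :
    2 ^ (2 * r + 5 * n) * (x * K) ^ n * ((2 * (r + 2 * n) : ℕ) * c * A ^ (r + 2 * n + 2)) ≤
      x ^ n * ((2 * c * A ^ 2) * (8 * A) ^ r * (128 * K * A ^ 2) ^ n) := by
  have h1 : ((r + 2 * n : ℕ) : ℝ) ≤ 2 ^ (r + 2 * n) := by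
    exact_mod_cast (Nat.lt_two_pow_self (n := r + 2 * n)).le
  have h8 : (8 : ℝ) ^ r = 2 ^ (2 * r) * 2 ^ r := by
    rw [pow_mul, ← mul_pow]; norm_num
  have h128 : (128 : ℝ) ^ n = 2 ^ (5 * n) * 2 ^ (2 * n) := by
    rw [pow_mul, pow_mul, ← mul_pow]; norm_num
  calc 2 ^ (2 * r + 5 * n) * (x * K) ^ n * ((2 * (r + 2 * n) : ℕ) * c * A ^ (r + 2 * n + 2))
      = 2 ^ (2 * r + 5 * n) * (x * K) ^ n * (2 * c * A ^ (r + 2 * n + 2)) *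
          ((r + 2 * n : ℕ) : ℝ) := by push_cast; ring
    _ ≤ 2 ^ (2 * r + 5 * n) * (x * K) ^ n * (2 * c * A ^ (r + 2 * n + 2)) * 2 ^ (r + 2 * n) :=
        mul_le_mul_of_nonneg_left h1 (by positivity)
    _ = x ^ n * ((2 * c * A ^ 2) * (8 * A) ^ r * (128 * K * A ^ 2) ^ n) := by
        rw [mul_pow 8 A, mul_pow (128 * K), mul_pow 128 K, h8, h128]
        ring

theorem exists_lintegral_board_le {α : ℝ} (hα : 5 / 6 < α) (hα1 : α < 1) :
    ∃ c κ : ℝ, 0 ≤ c ∧ 0 ≤ κ ∧ ∀ (A : ℝ), 0 < A → ∀ g : (k : ℕ) → ℝ → Ker k, Profile A g →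
      ∀ (n r : ℕ) (t : ℝ), 0 ≤ t →
        ∫⁻ σ in Ioo 0 t, board n r Finset.univ t (nrm α) (source g σ) ≤
          ENNReal.ofReal (t * (Real.sqrt t ^ n *
            ((c * A ^ 2) * (8 * A) ^ r * (κ * A ^ 2) ^ n))) := by
  obtain ⟨C, hC, hCK⟩ := exists_lintegral_nrm_con_sq_le hα hα1
  obtain ⟨C₁, hC₁, hS⟩ := exists_nrm_conSum_le (α := α) (by linarith) hα1
  refine ⟨2 * C₁.toReal, 128 * Real.sqrt C.toReal, by positivity, by positivity,
    fun A hA g hg n r t ht => ?_⟩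
  have hD : (ENNReal.ofReal t * C) ^ (1 / 2 : ℝ) =
      ENNReal.ofReal (Real.sqrt t * Real.sqrt C.toReal) := by
    conv_lhs => rw [← ENNReal.ofReal_toReal hC]
    rw [← ENNReal.ofReal_mul ht, ENNReal.ofReal_rpow_of_nonneg (by positivity) (by norm_num),
      ← Real.sqrt_eq_rpow, Real.sqrt_mul ht]
  have hb : ∀ σ, board n r Finset.univ t (nrm α) (source g σ) ≤
      ENNReal.ofReal (Real.sqrt t ^ n * ((2 * C₁.toReal * A ^ 2) * (8 * A) ^ r *
        (128 * Real.sqrt C.toReal * A ^ 2) ^ n)) := by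
    intro σ
    refine (board_le (fun k a φ => lintegral_Ioo_nrm_con_le hCK k a φ t) (hg.symm_source σ) n r
      Finset.univ (nrm α) 1 (measurable_nrm α) fun φ => (one_mul _).ge).trans ?_
    have h1 : nrm α (source g σ (r + 2 * n)) ≤
        ENNReal.ofReal ((2 * (r + 2 * n) : ℕ) * C₁.toReal * A ^ (r + 2 * n + 2)) := by
      refine (hS _ σ _).trans ((mul_le_mul_right (hg.bound _ σ) _).trans (le_of_eq ?_))
      rw [ENNReal.ofReal_mul (by positivity), ENNReal.ofReal_mul (by positivity),
        ENNReal.ofReal_toReal hC₁, ENNReal.ofReal_natCast]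
    have hcard : (Finset.univ : Finset (Particle r)).card = 2 * r := by
      rw [Finset.card_univ, Fintype.card_sum, Fintype.card_fin, two_mul]
    rw [hD, mul_one, hcard]
    refine (mul_le_mul_right h1 _).trans ?_
    rw [← ENNReal.ofReal_pow (by positivity), ← ENNReal.ofReal_ofNat 2,
      ← ENNReal.ofReal_pow (by norm_num), ← ENNReal.ofReal_mul (by positivity),
      ← ENNReal.ofReal_mul (by positivity)]
    exact ENNReal.ofReal_le_ofReal (nat_mul_pow_le hA (Real.sqrt_nonneg _) ENNReal.toReal_nonneg
      (Real.sqrt_nonneg t) n r)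
  refine (lintegral_mono fun σ => hb σ).trans ?_
  rw [lintegral_const, Measure.restrict_apply_univ, Real.volume_Ioo, sub_zero, mul_comm,
    ← ENNReal.ofReal_mul ht]

/-! ### Vanishing of solutions with zero initial data -/

theorem exists_time_eq_zero (A : ℝ) (hA : 0 < A) (c : ℂ) : ∃ T₀ : ℝ, 0 < T₀ ∧
    ∀ g : (k : ℕ) → ℝ → Ker k, Profile A g → ∀ T ≤ T₀, SolvesZero c T g →
      ∀ k, 1 ≤ k → ∀ t ∈ Icc 0 T, g k t = 0 := by
  obtain ⟨d, κ, hd, hκ, hb⟩ := exists_lintegral_board_le (α := 9 / 10) (by norm_num) (by norm_num)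
  set Q := ‖c‖ * (κ * A ^ 2) with hQ
  have hQ0 : 0 ≤ Q := by positivity
  refine ⟨(1 / (Q + 1)) ^ 2 / 4, by positivity, fun g hg T hT hs k hk t ht => ?_⟩
  have hsq : Real.sqrt t ≤ 1 / (Q + 1) / 2 := by
    rw [Real.sqrt_le_left (by positivity)]
    exact (ht.2.trans hT).trans (le_of_eq (by ring))
  have hlt : Real.sqrt t * Q < 1 := by
    have h1 : Real.sqrt t * Q ≤ 1 / (Q + 1) / 2 * Q := mul_le_mul_of_nonneg_right hsq hQ0
    have h2 : 1 / (Q + 1) / 2 * Q = Q / (2 * (Q + 1)) := by field_simp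
    have h3 : Q / (2 * (Q + 1)) < 1 := by rw [div_lt_one (by positivity)]; linarith
    linarith
  have hle : ∀ n : ℕ, nrm (9 / 10) (g k t) ≤ ENNReal.ofReal
      ((‖c‖ * t * ((d * A ^ 2) * (8 * A) ^ k)) * (Real.sqrt t * Q) ^ n) := by
    intro n
    refine (hg.gauge_le_board hs n k hk _ (gauge_nrm _) t ht).trans ?_
    refine (mul_le_mul_right (hb A hA g hg n k t ht.1) _).trans (le_of_eq ?_)
    rw [← ofReal_norm, ← ENNReal.ofReal_pow (norm_nonneg _), ← ENNReal.ofReal_mul (by positivity)]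
    congr 1
    rw [hQ, mul_pow (Real.sqrt t), mul_pow ‖c‖]
    ring
  have hlim : Filter.Tendsto (fun n : ℕ => ENNReal.ofReal
      ((‖c‖ * t * ((d * A ^ 2) * (8 * A) ^ k)) * (Real.sqrt t * Q) ^ n)) Filter.atTop (nhds 0) := by
    have h := (tendsto_pow_atTop_nhds_zero_of_lt_one (by positivity) hlt).const_mul
      (‖c‖ * t * ((d * A ^ 2) * (8 * A) ^ k))
    rw [mul_zero] at h
    have h2 := ENNReal.tendsto_ofReal h
    rwa [ENNReal.ofReal_zero] at h2
  have h0 : nrm (9 / 10) (g k t) ≤ 0 := ge_of_tendsto' hlim hle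
  have h1 : ‖g k t‖ₑ = 0 := le_antisymm ((enorm_le_nrm (by norm_num) _).trans h0) zero_le
  exact enorm_eq_zero.1 h1

theorem conSum_zero {k : ℕ} (s : ℝ) : conSum s (0 : Ker (k + 2)) = 0 := by
  have h := conSum_sub (k := k) nice_zero nice_zero s
  rwa [sub_zero, sub_self] at h

/-- The time translate of a profile. -/
def translate (a : ℝ) (g : (k : ℕ) → ℝ → Ker k) (k : ℕ) (t : ℝ) : Ker k :=
  phaseMul a (g k (t + a))

theorem Profile.translate {A : ℝ} {g : (k : ℕ) → ℝ → Ker k} (hg : Profile A g) (a : ℝ) :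
    Profile A (translate a g) where
  measurable k := Measurable.comp (g := phaseMul a) (f := fun t => g k (t + a))
    (phaseMul a).continuous.measurable ((hg.measurable k).comp (measurable_id.add_const a))
  bound k t := (nrm_phaseMul 1 a _).trans_le (hg.bound k _)
  symm t k σ := by
    show permKer σ (phaseMul a (g k (t + a))) = phaseMul a (g k (t + a))
    rw [← phaseMul_permKer, hg.symm (t + a) k σ]

theorem SolvesZero.translate {A : ℝ} {g : (k : ℕ) → ℝ → Ker k} (hg : Profile A g) {c : ℂ} {T a : ℝ}
    (ha : 0 ≤ a) (hs : SolvesZero c T g) (h0 : ∀ k, 1 ≤ k → ∀ t ∈ Icc 0 a, g k t = 0) :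
    SolvesZero c (T - a) (translate a g) := by
  intro k hk t ht
  have h1 := hs k hk (t + a) ⟨by linarith [ht.1], by linarith [ht.2]⟩
  show phaseMul a (g k (t + a)) = _
  rw [h1, map_smul, ← (phaseMul a).integral_comp_comm (hg.niceFamily k (t + a)).integrable,
    setIntegral_eq_of_subset_of_forall_sdiff_eq_zero (s := Ioc a (t + a)) measurableSet_Ioc
      (Ioc_subset_Ioc_left ha) (fun s hs' => ?_),
    ← intervalIntegral.integral_of_le (by linarith [ht.1])]
  · have h2 := intervalIntegral.integral_comp_add_right (a := 0) (b := t)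
      (fun s => phaseMul a (conSum s (g (k + 2) s))) a
    rw [zero_add] at h2
    rw [← h2, intervalIntegral.integral_of_le ht.1]
    congr 1
    refine integral_congr_ae (Filter.Eventually.of_forall fun s => ?_)
    exact (conSum_phaseMul s a _).symm
  · have h3 : s ≤ a := by
      by_contra hcon
      exact hs'.2 ⟨not_le.1 hcon, hs'.1.2⟩
    rw [h0 (k + 2) (by omega) s ⟨hs'.1.1.le, h3⟩, conSum_zero, map_zero]

/-- A profile that solves the hierarchy with zero initial data vanishes. -/
theorem SolvesZero.eq_zero {A : ℝ} (hA : 0 < A) {c : ℂ} {T : ℝ} {g : (k : ℕ) → ℝ → Ker k}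
    (hg : Profile A g) (hs : SolvesZero c T g) : ∀ k, 1 ≤ k → ∀ t ∈ Icc 0 T, g k t = 0 := by
  obtain ⟨T₀, hT₀, h⟩ := exists_time_eq_zero A hA c
  obtain ⟨m, hm⟩ := exists_nat_ge (T / T₀)
  rw [div_le_iff₀ hT₀] at hm
  induction m generalizing T g with
  | zero =>
    intro k hk t ht
    have ht0 : t = 0 := le_antisymm (by simpa using ht.2.trans hm) ht.1
    rw [hs k hk t ht, ht0]
    simp
  | succ m ih =>
    rcases le_or_gt T T₀ with hT | hT
    · exact h g hg T hT hs
    · have h0 := h g hg T₀ le_rfl fun k hk t ht => hs k hk t ⟨ht.1, ht.2.trans hT.le⟩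
      have h1 := ih (hg.translate T₀) (hs.translate hg hT₀.le h0) (by push_cast at hm; linarith)
      intro k hk t ht
      rcases le_or_gt t T₀ with htT | htT
      · exact h0 k hk t ⟨ht.1, htT⟩
      · have h2 : phaseMul T₀ (g k (t - T₀ + T₀)) = 0 :=
          h1 k hk (t - T₀) ⟨by linarith, by linarith [ht.2]⟩
        have h3 := congrArg (phaseMul (-T₀)) h2
        rwa [← phaseMul_add, neg_add_cancel, phaseMul_zero, map_zero, sub_add_cancel] at h3

/-! ### Hierarchies in the interaction picture -/

open Classical in
/-- The Fourier transform of a hierarchy in the interaction picture, extended by zero. -/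
def picture (T : ℝ) (γ : Hierarchy) (k : ℕ) (t : ℝ) : Ker k :=
  if 1 ≤ k ∧ t ∈ Icc 0 T then phaseMul (-t) (𝓕 (γ k t)) else 0

/-- The Fourier transform of kernels as a continuous linear map. -/
def fourierKer (k : ℕ) : Ker k →L[ℂ] Ker k := FourierTransform.fourierCLM ℂ (Ker k)

/-- The inverse Fourier transform of kernels as a continuous linear map. -/
def fourierInvKer (k : ℕ) : Ker k →L[ℂ] Ker k := FourierTransform.fourierInvCLM ℂ (Ker k)

theorem fourierKer_apply {k : ℕ} (f : Ker k) : fourierKer k f = 𝓕 f := rfl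

theorem fourierInvKer_apply {k : ℕ} (f : Ker k) : fourierInvKer k f = 𝓕⁻ f := rfl

theorem sobolevNorm_eq {k : ℕ} (β : ℝ) (f : Ker k) : sobolevNorm β f = nrm β (𝓕 f) := rfl

section

variable {A T : ℝ} {γ : Hierarchy}

theorem picture_of_mem {k : ℕ} (hk : 1 ≤ k) {t : ℝ} (ht : t ∈ Icc 0 T) :
    picture T γ k t = phaseMul (-t) (𝓕 (γ k t)) := if_pos ⟨hk, ht⟩

theorem fourier_eq_picture {k : ℕ} (hk : 1 ≤ k) {t : ℝ} (ht : t ∈ Icc 0 T) :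
    (𝓕 (γ k t) : Ker k) = phaseMul t (picture T γ k t) := by
  rw [picture_of_mem hk ht, ← phaseMul_add, add_neg_cancel, phaseMul_zero]

theorem eq_of_picture_eq {γ₁ γ₂ : Hierarchy} {k : ℕ} (hk : 1 ≤ k) {t : ℝ} (ht : t ∈ Icc 0 T)
    (h : picture T γ₁ k t = picture T γ₂ k t) : γ₁ k t = γ₂ k t := by
  have h1 : (𝓕 (γ₁ k t) : Ker k) = 𝓕 (γ₂ k t) := by
    rw [fourier_eq_picture hk ht, fourier_eq_picture hk ht, h]
  have h2 := congrArg (fun f : Ker k => (𝓕⁻ f : Ker k)) h1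
  simpa using h2

open Classical in
theorem profile_picture (hγ : IsEnergyHierarchy A T γ) : Profile A (picture T γ) where
  measurable k := by
    by_cases hk : 1 ≤ k
    · have h1 : Measurable ((Icc 0 T).piecewise (γ k) 0) := by
        refine measurable_of_measurable_inner fun f => ?_
        have h2 := (hγ.continuous k hk f).measurable_piecewise (g := fun _ => (0 : ℂ))
          continuousOn_const measurableSet_Icc
        refine (congrArg Measurable (funext fun t => ?_)).mpr h2
        by_cases ht : t ∈ Icc 0 T
        · rw [piecewise_eq_of_mem _ _ _ ht, piecewise_eq_of_mem _ _ _ ht]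
        · rw [piecewise_eq_of_notMem _ _ _ ht, piecewise_eq_of_notMem _ _ _ ht]
          exact inner_zero_right f
      have h3 : Measurable fun t => fourierKer k ((Icc 0 T).piecewise (γ k) 0 t) :=
        Measurable.comp (g := fourierKer k) (fourierKer k).continuous.measurable h1
      have h4 : Measurable fun t => phaseMul (-t) (fourierKer k ((Icc 0 T).piecewise (γ k) 0 t)) :=
        Measurable.comp (g := fun z : ℝ × Ker k => phaseMul z.1 z.2)
          (f := fun t => (-t, fourierKer k ((Icc 0 T).piecewise (γ k) 0 t))) measurable_phaseMul
          (measurable_neg.prodMk h3)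
      refine (congrArg Measurable (funext fun t => ?_)).mpr h4
      by_cases ht : t ∈ Icc 0 T
      · rw [picture_of_mem hk ht, piecewise_eq_of_mem _ _ _ ht, fourierKer_apply]
      · rw [picture, if_neg fun h => ht h.2, piecewise_eq_of_notMem _ _ _ ht, Pi.zero_apply,
          map_zero, map_zero]
    · have h : picture T γ k = fun _ => 0 := funext fun t => if_neg fun h => hk h.1
      rw [h]
      exact measurable_const
  bound k t := by
    unfold picture
    split_ifs with h
    · rw [nrm_phaseMul, ← sobolevNorm_eq]
      exact hγ.energy k h.1 t h.2
    · rw [nrm_zero]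
      exact zero_le
  symm t k σ := by
    simp only [picture]
    split_ifs with h
    · rw [← phaseMul_permKer, ← fourier_permKer]
      congr 2
      refine Lp.ext ?_
      filter_upwards [permKer_ae σ (γ k t), hγ.symmetric k h.1 t h.2 σ] with x h1 h2
      rw [h1, h2]
    · exact map_zero _

theorem contr_phaseMul {k : ℕ} {φ : Ker (k + 2)} (h : Nice φ) (a : Particle k) (s : ℝ) :
    contr a (phaseMul s φ) = phaseMul s (con a s φ) := by
  rw [con_eq h, ← phaseMul_add, add_neg_cancel, phaseMul_zero]

theorem fourier_interaction {k : ℕ} {f : Ker (k + 2)} {φ : Ker (k + 2)} {s : ℝ} (hφ : Nice φ)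
    (hf : (𝓕 f : Ker (k + 2)) = phaseMul s φ) :
    (𝓕 (interaction f) : Ker k) = phaseMul s (conSum s φ) := by
  have hn : Nice (𝓕 f : Ker (k + 2)) := by rw [hf]; exact hφ.phase s
  have h1 : ∀ a : Particle k, fourierKer k (contraction a f) = phaseMul s (con a s φ) := by
    intro a
    rw [fourierKer_apply, fourier_contraction hn, hf, contr_phaseMul hφ]
  rw [← fourierKer_apply, interaction, conSum, map_sum, map_sum]
  simp only [map_sub, h1]

theorem duhamelIntegrand_link (hp : Profile A (picture T γ)) (n : ℕ) : ∀ r : ℕ, 1 ≤ r →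
    ∀ t ∈ Icc 0 T, ∀ s ∈ timeSimplex n t, DuhamelDefined γ n r s ∧
      (𝓕 (duhamelIntegrand γ n r t s) : Ker r) = phaseMul t (duh (picture T γ) n r t s) := by
  induction n with
  | zero =>
    intro r hr t ht s _
    exact ⟨trivial, fourier_eq_picture hr ht⟩
  | succ n ih =>
    intro r hr t ht s hs
    rw [← Fin.cons_self_tail s] at hs
    obtain ⟨h0, h1⟩ := cons_mem_timeSimplex.1 hs
    obtain ⟨h2, h3⟩ := ih (r + 2) (by omega) (s 0) ⟨h0.1, h0.2.trans ht.2⟩ (Fin.tail s) h1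
    have hn := hp.nice_duh n (r + 2) (s 0) (Fin.tail s)
    refine ⟨⟨h2, fun a => hasContraction_of_nice (by rw [h3]; exact hn.phase _) a⟩, ?_⟩
    rw [duhamelIntegrand, fourier_freeEvolution, fourier_interaction hn h3, ← phaseMul_add,
      sub_add_cancel]
    rfl

theorem duhamelIntegrand_eq (hp : Profile A (picture T γ)) {n r : ℕ} (hr : 1 ≤ r) {t : ℝ}
    (ht : t ∈ Icc 0 T) {s : Fin n → ℝ} (hs : s ∈ timeSimplex n t) : duhamelIntegrand γ n r t s =
      ((fourierInvKer r).comp (phaseMul t)) (duh (picture T γ) n r t s) := by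
  rw [ContinuousLinearMap.comp_apply, ← (duhamelIntegrand_link hp n r hr t ht s hs).2,
    fourierInvKer_apply, FourierTransform.fourierInv_fourier_eq]

theorem integrableOn_duh (hp : Profile A (picture T γ)) {n r : ℕ} {t : ℝ}
    (h : ∫⁻ s in timeSimplex n t, nrm 0 (duh (picture T γ) n r t s) < ∞) :
    IntegrableOn (duh (picture T γ) n r t) (timeSimplex n t) := by
  refine ⟨(hp.measurable_duh_right n r t).aestronglyMeasurable, ?_⟩
  simp_rw [nrm_zero_exponent] at h
  exact h

theorem integrableOn_duhamelIntegrand (hp : Profile A (picture T γ)) {n r : ℕ} (hr : 1 ≤ r) {t : ℝ}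
    (ht : t ∈ Icc 0 T) (h : ∫⁻ s in timeSimplex n t, nrm 0 (duh (picture T γ) n r t s) < ∞) :
    IntegrableOn (duhamelIntegrand γ n r t) (timeSimplex n t) :=
  IntegrableOn.congr_fun (((fourierInvKer r).comp (phaseMul t)).integrable_comp
    (integrableOn_duh hp h)) (fun _ hs => (duhamelIntegrand_eq hp hr ht hs).symm)
    (isClosed_timeSimplex n t).measurableSet

theorem sobolevNorm_duhamelTerm_le (hp : Profile A (picture T γ)) {n r : ℕ} (hr : 1 ≤ r) {t : ℝ}
    (ht : t ∈ Icc 0 T) (h : ∫⁻ s in timeSimplex n t, nrm 0 (duh (picture T γ) n r t s) < ∞) (α : ℝ) :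
    sobolevNorm α (duhamelTerm γ n r t) ≤
      ∫⁻ s in timeSimplex n t, nrm α (duh (picture T γ) n r t s) := by
  have h1 : duhamelTerm γ n r t = ((fourierInvKer r).comp (phaseMul t))
      (∫ s in timeSimplex n t, duh (picture T γ) n r t s) := by
    rw [← ContinuousLinearMap.integral_comp_comm _ (integrableOn_duh hp h)]
    exact setIntegral_congr_fun (isClosed_timeSimplex n t).measurableSet
      fun s hs => duhamelIntegrand_eq hp hr ht hs
  rw [sobolevNorm_eq, h1, ContinuousLinearMap.comp_apply, fourierInvKer_apply,
    FourierTransform.fourier_fourierInv_eq, nrm_phaseMul]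
  exact nrm_integral_le α _

theorem picture_solves (hp : Profile A (picture T γ)) {b₀ : ℝ} (hs : SolvesGP b₀ T γ) {k : ℕ}
    (hk : 1 ≤ k) {t : ℝ} (ht : t ∈ Icc 0 T) : picture T γ k t = picture T γ k 0 +
      (-(Complex.I * (b₀ : ℂ))) • ∫ s in Ioc 0 t, conSum s (picture T γ (k + 2) s) := by
  have h0 : (0 : ℝ) ∈ Icc 0 T := ⟨le_rfl, ht.1.trans ht.2⟩
  have h1 : ∫ s in (0 : ℝ)..t, freeEvolution (t - s) (interaction (γ (k + 2) s)) =
      ((fourierInvKer k).comp (phaseMul t)) (∫ s in Ioc 0 t, conSum s (picture T γ (k + 2) s)) := by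
    rw [← ContinuousLinearMap.integral_comp_comm _ (hp.niceFamily k t).integrable,
      intervalIntegral.integral_of_le ht.1]
    refine setIntegral_congr_fun measurableSet_Ioc fun s hs => ?_
    have hs' : s ∈ Icc 0 T := ⟨hs.1.le, hs.2.trans ht.2⟩
    rw [freeEvolution_eq, fourier_interaction (hp.nice (k + 2) s)
      (fourier_eq_picture (by omega) hs'), ← phaseMul_add, sub_add_cancel]
    rfl
  have h2 := congrArg (fun f => phaseMul (-t) (fourierKer k f)) (hs k hk t ht)
  simp only [map_sub, map_smul, h1] at h2
  rw [picture_of_mem hk ht, ← fourierKer_apply, h2, fourierKer_apply, fourier_freeEvolution,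
    ← phaseMul_add, neg_add_cancel, phaseMul_zero, ContinuousLinearMap.comp_apply,
    fourierInvKer_apply, fourierKer_apply, FourierTransform.fourier_fourierInv_eq, ← phaseMul_add,
    neg_add_cancel, phaseMul_zero, picture_of_mem hk h0, neg_zero, phaseMul_zero, neg_smul,
    sub_eq_add_neg]

theorem duh_zero (n : ℕ) : ∀ (r : ℕ) (t : ℝ) (s : Fin n → ℝ), duh (fun _ _ => 0) n r t s = 0 := by
  induction n with
  | zero => exact fun _ _ _ => rfl
  | succ n ih =>
    intro r t s
    rw [duh, ih, conSum_zero]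

theorem IsEnergyHierarchy.picture_eq_zero (hA : 0 < A) (hγ : IsEnergyHierarchy A T γ) {b₀ : ℝ}
    (hs : SolvesGP b₀ T γ) (h0 : ∀ k, 1 ≤ k → γ k 0 = 0) : picture T γ = fun _ _ => 0 := by
  have hp := profile_picture hγ
  have hz : SolvesZero (-(Complex.I * (b₀ : ℂ))) T (picture T γ) := by
    intro k hk t ht
    rw [picture_solves hp hs hk ht, picture_of_mem hk ⟨le_rfl, ht.1.trans ht.2⟩, h0 k hk,
      ← fourierKer_apply, map_zero, map_zero, zero_add]
  funext k t
  by_cases h : 1 ≤ k ∧ t ∈ Icc 0 T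
  · exact hz.eq_zero hA hp k h.1 t h.2
  · exact if_neg h

theorem IsEnergyHierarchy.eq_zero (hA : 0 < A) (hγ : IsEnergyHierarchy A T γ) {b₀ : ℝ}
    (hs : SolvesGP b₀ T γ) (h0 : ∀ k, 1 ≤ k → γ k 0 = 0) {k : ℕ} (hk : 1 ≤ k) {t : ℝ}
    (ht : t ∈ Icc 0 T) : γ k t = 0 := by
  have h1 : (𝓕 (γ k t) : Ker k) = 0 := by
    rw [fourier_eq_picture hk ht, hγ.picture_eq_zero hA hs h0, map_zero]
  have h2 := congrArg (fourierInvKer k) h1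
  rwa [fourierInvKer_apply, FourierTransform.fourierInv_fourier_eq, map_zero] at h2

theorem IsEnergyHierarchy.duhamelTerm_eq_zero (hA : 0 < A) (hγ : IsEnergyHierarchy A T γ) {b₀ : ℝ}
    (hs : SolvesGP b₀ T γ) (h0 : ∀ k, 1 ≤ k → γ k 0 = 0) (n : ℕ) {r : ℕ} (hr : 1 ≤ r) {t : ℝ}
    (ht : t ∈ Icc 0 T) : duhamelTerm γ n r t = 0 := by
  refine (setIntegral_congr_fun (isClosed_timeSimplex n t).measurableSet fun s hs' => ?_).trans
    (integral_zero _ _)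
  show duhamelIntegrand γ n r t s = 0
  rw [duhamelIntegrand_eq (profile_picture hγ) hr ht hs', hγ.picture_eq_zero hA hs h0, duh_zero,
    map_zero]

theorem Profile.sub {g₁ g₂ : (k : ℕ) → ℝ → Ker k} (h₁ : Profile A g₁) (h₂ : Profile A g₂)
    (hA : 0 < A) (h0 : ∀ t, g₁ 0 t = 0 ∧ g₂ 0 t = 0) :
    Profile (2 * A) fun k t => g₁ k t - g₂ k t where
  measurable k := (h₁.measurable k).sub (h₂.measurable k)
  bound k t := by
    rcases Nat.eq_zero_or_pos k with rfl | hk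
    · simp only [(h0 t).1, (h0 t).2, sub_zero, nrm_zero]
      exact zero_le
    · refine ((gauge_nrm 1).sub_le (h₁.nice k t) (h₂.nice k t)).trans
        ((add_le_add (h₁.bound k t) (h₂.bound k t)).trans ?_)
      rw [← ENNReal.ofReal_add (by positivity) (by positivity)]
      refine ENNReal.ofReal_le_ofReal ?_
      rw [mul_pow, ← two_mul]
      exact mul_le_mul_of_nonneg_right (le_self_pow₀ (by norm_num) hk.ne') (by positivity)
  symm t k σ := by
    simp only [map_sub]
    rw [h₁.symm t k σ, h₂.symm t k σ]

theorem IsEnergyHierarchy.unique (hA : 0 < A) {γ₁ γ₂ : Hierarchy} (h₁ : IsEnergyHierarchy A T γ₁)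
    (h₂ : IsEnergyHierarchy A T γ₂) {b₀ : ℝ} (hs₁ : SolvesGP b₀ T γ₁) (hs₂ : SolvesGP b₀ T γ₂)
    (h0 : ∀ k, 1 ≤ k → γ₁ k 0 = γ₂ k 0) {k : ℕ} (hk : 1 ≤ k) {t : ℝ} (ht : t ∈ Icc 0 T) :
    γ₁ k t = γ₂ k t := by
  have hp₁ := profile_picture h₁
  have hp₂ := profile_picture h₂
  have hp := hp₁.sub hp₂ hA fun t => ⟨if_neg (by simp), if_neg (by simp)⟩
  have hz : SolvesZero (-(Complex.I * (b₀ : ℂ))) T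
      fun k t => picture T γ₁ k t - picture T γ₂ k t := by
    intro k hk t ht
    have h00 : (0 : ℝ) ∈ Icc 0 T := ⟨le_rfl, ht.1.trans ht.2⟩
    have h3 : picture T γ₁ k 0 = picture T γ₂ k 0 := by
      rw [picture_of_mem hk h00, picture_of_mem hk h00, h0 k hk]
    simp only
    rw [picture_solves hp₁ hs₁ hk ht, picture_solves hp₂ hs₂ hk ht, h3, add_sub_add_left_eq_sub,
      ← smul_sub, ← integral_sub (hp₁.niceFamily k t).integrable (hp₂.niceFamily k t).integrable]
    congr 1
    refine integral_congr_ae (Filter.Eventually.of_forall fun s => ?_)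
    exact (conSum_sub (hp₁.nice (k + 2) s) (hp₂.nice (k + 2) s) s).symm
  exact eq_of_picture_eq hk ht
    (sub_eq_zero.1 (hz.eq_zero (by positivity) hp k hk t ht))

theorem volume_univ_fin_zero : volume (univ : Set (Fin 0 → ℝ)) = 1 := by
  simp [volume_pi]

end

theorem duhamel_bound_lt {c κ A T t : ℝ} (hc : 0 ≤ c) (hκ : 0 ≤ κ) (hA : 0 < A) (hT : 0 < T)
    (ht : t ∈ Icc 0 T) (n r : ℕ) (hr : 1 ≤ r) :
    t * (Real.sqrt t ^ n * (c * (8 * A) ^ r * κ ^ n)) <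
      (8 * A + 1) ^ r * ((c + κ + 1) * max T (Real.sqrt T)) ^ (n + 1) := by
  set M := max T (Real.sqrt T) with hM
  have hM0 : 0 < M := hT.trans_le (le_max_left _ _)
  have h1 : t ≤ M := ht.2.trans (le_max_left _ _)
  have h2 : Real.sqrt t ≤ M := (Real.sqrt_le_sqrt ht.2).trans (le_max_right _ _)
  have h3 : (8 * A) ^ r < (8 * A + 1) ^ r :=
    pow_lt_pow_left₀ (by linarith) (by positivity) (by omega)
  calc t * (Real.sqrt t ^ n * (c * (8 * A) ^ r * κ ^ n))
      ≤ M * (M ^ n * ((c + κ + 1) * (8 * A) ^ r * (c + κ + 1) ^ n)) := by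
        have h4 : κ ≤ c + κ + 1 := by linarith
        have h5 : c ≤ c + κ + 1 := by linarith
        have := ht.1
        gcongr
    _ = (8 * A) ^ r * ((c + κ + 1) * M) ^ (n + 1) := by rw [mul_pow (c + κ + 1) M]; ring
    _ < (8 * A + 1) ^ r * ((c + κ + 1) * M) ^ (n + 1) :=
        mul_lt_mul_of_pos_right h3 (by positivity)

end QuinticGP

end

theorem theorem6p2 (α : ℝ) (hα : 5 / 6 < α) (hα1 : α < 1) (A : ℝ) (hA : 0 < A) (b₀ : ℝ) :
    ∃ C C₀ : ℝ, 0 < C ∧ 0 < C₀ ∧ ∀ T : ℝ, 0 < T →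
      -- the iterated Duhamel terms of an arbitrary hierarchy of finite energy
      (∀ γ : QuinticGP.Hierarchy, QuinticGP.IsEnergyHierarchy A T γ →
        ∀ n r : ℕ, 1 ≤ r → ∀ t ∈ Set.Icc 0 T,
          (∀ᵐ s ∂(MeasureTheory.volume.restrict (QuinticGP.timeSimplex n t)),
            QuinticGP.DuhamelDefined γ n r s) ∧
          MeasureTheory.IntegrableOn (QuinticGP.duhamelIntegrand γ n r t)
            (QuinticGP.timeSimplex n t) ∧
          QuinticGP.sobolevNorm α (QuinticGP.duhamelTerm γ n r t) <
            ENNReal.ofReal (C ^ r * (C₀ * max T (Real.sqrt T)) ^ n)) ∧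
      -- the iterated Duhamel terms of a solution of the hierarchy with zero initial data
      (∀ γ : QuinticGP.Hierarchy, QuinticGP.IsEnergyHierarchy A T γ →
        QuinticGP.SolvesGP b₀ T γ → (∀ k, 1 ≤ k → γ k 0 = 0) →
        ∀ n r : ℕ, 1 ≤ r → ∀ t ∈ Set.Icc 0 T,
          γ r t = (-(Complex.I * (b₀ : ℂ))) ^ n • QuinticGP.duhamelTerm γ n r t ∧
          QuinticGP.sobolevNorm α (QuinticGP.duhamelTerm γ n r t) <
            ENNReal.ofReal (C ^ r * (C₀ * T) ^ n)) ∧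
      -- uniqueness for short times
      (C₀ * T < 1 → ∀ γ₁ γ₂ : QuinticGP.Hierarchy,
        QuinticGP.IsEnergyHierarchy A T γ₁ → QuinticGP.IsEnergyHierarchy A T γ₂ →
        QuinticGP.SolvesGP b₀ T γ₁ → QuinticGP.SolvesGP b₀ T γ₂ →
        (∀ k, 1 ≤ k → γ₁ k 0 = γ₂ k 0) →
        ∀ k, 1 ≤ k → ∀ t ∈ Set.Icc 0 T, γ₁ k t = γ₂ k t) := by
  obtain ⟨c, κ, hc, hκ, hb⟩ := QuinticGP.exists_lintegral_board_le hα hα1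
  have hc' : 0 ≤ c * A ^ 2 := by positivity
  have hκ' : 0 ≤ κ * A ^ 2 := by positivity
  refine ⟨8 * A + 1, c * A ^ 2 + κ * A ^ 2 + 1, by positivity, by positivity, fun T hT =>
    ⟨fun γ hγ n r hr t ht => ?_, fun γ hγ hs h0 n r hr t ht => ?_,
      fun _ γ₁ γ₂ h₁ h₂ hs₁ hs₂ h0 k hk t ht => h₁.unique hA h₂ hs₁ hs₂ h0 hk ht⟩⟩
  · have hp := QuinticGP.profile_picture hγ
    have key : ∫⁻ s in QuinticGP.timeSimplex n t,
        QuinticGP.nrm α (QuinticGP.duh (QuinticGP.picture T γ) n r t s) <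
          ENNReal.ofReal ((8 * A + 1) ^ r *
            ((c * A ^ 2 + κ * A ^ 2 + 1) * max T (Real.sqrt T)) ^ n) := by
      rcases n with _ | n
      · refine lt_of_le_of_lt (MeasureTheory.setLIntegral_le_lintegral _ _) ?_
        rw [MeasureTheory.lintegral_unique, QuinticGP.volume_univ_fin_zero, mul_one, pow_zero,
          mul_one]
        refine lt_of_le_of_lt ((QuinticGP.nrm_mono hα1.le _).trans (hp.bound r t)) ?_
        rw [ENNReal.ofReal_lt_ofReal_iff (by positivity)]
        exact pow_lt_pow_left₀ (by linarith) hA.le (by omega)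
      · refine lt_of_le_of_lt ((hp.lintegral_duh_le n r _ (QuinticGP.gauge_nrm α) t).trans
          (hb A hA _ hp n r t ht.1)) ?_
        rw [ENNReal.ofReal_lt_ofReal_iff (by have := lt_max_of_lt_left (c := Real.sqrt T) hT
                                             positivity)]
        exact QuinticGP.duhamel_bound_lt hc' hκ' hA hT ht n r hr
    have hfin : ∫⁻ s in QuinticGP.timeSimplex n t,
        QuinticGP.nrm 0 (QuinticGP.duh (QuinticGP.picture T γ) n r t s) < ⊤ :=
      lt_of_le_of_lt (MeasureTheory.lintegral_mono fun s => QuinticGP.nrm_mono (by linarith) _)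
        (key.trans ENNReal.ofReal_lt_top)
    refine ⟨?_, QuinticGP.integrableOn_duhamelIntegrand hp hr ht hfin,
      (QuinticGP.sobolevNorm_duhamelTerm_le hp hr ht hfin α).trans_lt key⟩
    exact (MeasureTheory.ae_restrict_iff' (QuinticGP.isClosed_timeSimplex n t).measurableSet).2
      (Filter.Eventually.of_forall fun s hs =>
        (QuinticGP.duhamelIntegrand_link hp n r hr t ht s hs).1)
  · rw [hγ.duhamelTerm_eq_zero hA hs h0 n hr ht, hγ.eq_zero hA hs h0 hr ht, smul_zero]
    refine ⟨rfl, ?_⟩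
    rw [QuinticGP.sobolevNorm_eq, ← QuinticGP.fourierKer_apply, map_zero, QuinticGP.nrm_zero]
    exact ENNReal.ofReal_pos.2 (by positivity)
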